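/- **Definitions.** A (nonnegative) signature of length $N$ is $a=(a_1\ge\dots\ge a_N\ge 0)$, $a_i\in\mathbb Z$; it is drawn as $N$ vertical arrows at the sites $a_1,\dots,a_N$ of $\mathbb Z_{\ge0}$. For signatures $\mu$ of length $N$ and $\lambda$ of length $N+1$, $\mu\prec\lambda$ means $\lambda_{N+1}\le\mu_N\le\lambda_N\le\dots\le\mu_1\le\lambda_1$. *Cross moves at $s=t=0$.* A cross vertex has a bottom left, a top left, a bottom right and a top right edge, each with $0$ or $1$ arrow, and conserves the number of arrows; its state $(k_1,k_2\,|\,j_1,j_2)$ lists these numbers (bottom left, top left | bottom right, top right). Suppose that the cross stands to the left of a column with $\ell$, $g$, $m$ vertical arrows at the bottom, in the middle and at the top, and that $k_1'=\ell+j_1-g$, $k_2'=g+j_2-m$ are in $\{0,1\}$. Dragging it through the column replaces its state by a state $(j_1',j_2'\,|\,k_1',k_2')$ and $g$ by $n=\ell+k_1-j_1'$. If $k_1'=k_2'$, the new state is the only possible one. If the right edges are $(1,0)$, the new state is $(1,0|1,0)$ or $(0,1|1,0)$: the first has probability $u/v$ if the old state is $(0,0|0,0)$, $(1,0|1,0)$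 or $(1,1|1,1)$, probability $1$ if it is $(0,1|0,1)$, and probability $0$ if it is $(0,1|1,0)$ or $(1,0|0,1)$. If the right edges are $(0,1)$, the new state is $(1,0|0,1)$ if the old state is $(1,0|0,1)$, and $(0,1|0,1)$ otherwise. (These are the values at $s=t=0$ of the forward transition weights of the Yang-Baxter equation of the higher spin six vertex model.) *Forward transition probabilities.* Let $\kappa,\lambda$ have length $N$, and $\mu$ length $N+1$. Put $\lambda,\kappa,\mu$ at the bottom, in the middle and at the top, start with the cross in state $(1,1|1,1)$ to the left of column $0$, and drag it to the right through the columns $0,1,2,\dots$ until it stabilizes in the state $(0,1|1,0)$. Then $\mathsf U_{v,u}(\kappa\to\nu\mid\lambda,\mu)$ is the probability that the middle signature has become $\nu$ (of length $N+1$). *Yang-Baxter field.* For $v>u>0$ the field with constant parameters $u,v$ consists of random signatures $\boldsymbol\lambda^{(x,y)}$ of length $y$, $x,y\in\mathbb Z_{\ge0}$, with $\boldsymbol\lambda^{(x,0)}=\varnothing$ and $\boldsymbol\lambda^{(0,y)}=(0^y)$, such that for each $n\ge1$, given all $\boldsymbol\lambda^{(x',y')}$ with $x'+y'\le n$, the $\boldsymbol\lambda^{(x,y)}$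 with $x+y=n+1$, $x,y\ge1$, are independent and equal to $\nu$ with probability $\mathsf U_{v,u}(\boldsymbol\lambda^{(x-1,y-1)}\to\nu\mid\boldsymbol\lambda^{(x,y-1)},\boldsymbol\lambda^{(x-1,y)})$. *Continuous time dynamics.* An interlacing array of depth $M$ is $\lambda^{(1)}\prec\dots\prec\lambda^{(M)}$, where $\lambda^{(k)}$ is a signature of length $k$; the $\lambda^{(k)}_i$ are regarded as positions of particles. The dynamics with parameter $u$ is the continuous time Markov chain on such arrays in which one particle at a time makes an independent jump, and this triggers an instantaneous sequence of updates on the levels $k+1,\dots,M$ above the level $k$ of the jump. At levels $k-1,k$, let $\kappa,\mu$ be the signatures before and $\lambda,\nu$ those after an event. * If $\lambda=\kappa$, each $\mu_i$ independently jumps to the right by one at rate $u$, except that the rate is $0$ if $\mu_i=\lambda_{i-1}$ (blocking from below), or if $\mu_i=\lambda_i=\mu_{i+1}=\lambda_{i+1}=\dots=\mu_{i+m}=\lambda_{i+m}>\mu_{i+m+1}$ for some $m\ge0$ (special blocking). * If $\lambda$ differs from $\kappa$ only in $\lambda_i=\kappa_i+1$, then $\nu=\mu$, except in two cases: if $\lambda_i=\mu_i+1$,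 then $\nu$ differs from $\mu$ only in $\nu_i=\mu_i+1$ (mandatory pushing); if $\mu_i=\lambda_i=\mu_{i-1}=\lambda_{i-1}=\dots=\mu_{i-m}=\lambda_{i-m}<\lambda_{i-m-1}$ for some $m\ge0$ (with $\lambda_0=+\infty$), then $\nu$ differs from $\mu$ only in $\nu_{i-m}=\mu_{i-m}+1$ (special pushing). **Proposition.** Let $u>0$. For every $v>u$ the Yang-Baxter field with $s=t=0$ and constant parameters $u,v$ exists. For every $M$, the dynamics on interlacing arrays of depth $M$ is a well-defined Markov chain: there is a transition function $p_\tau(a,b)$, $\tau\ge0$, whose derivative at $\tau=0$ is the matrix of the jump rates described above (with minus the total jump rate on the diagonal). Moreover, under the scaling $x=\lfloor\tau v\rfloor$, $v\to+\infty$, the first $M$ rows $(\boldsymbol\lambda^{(\lfloor\tau v\rfloor,k)})_{1\le k\le M}$ of the field converge in finite-dimensional distributions to this dynamics started from $\lambda^{(k)}(0)=(0^k)$: for all $0=\tau_0\le\tau_1\le\dots\le\tau_n$ and all arrays $a_1,\dots,a_n$, with $a_0$ the zero array, $$\lim_{v\to+\infty}\mathrm{Prob}\bigl(\boldsymbol\lambda^{(\lfloor\tau_jv\rfloor,k)}=a_j^{(k)}\text{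 for all }1\le j\le n,\ 1\le k\le M\bigr)=\prod_{j=1}^{n}p_{\tau_j-\tau_{j-1}}(a_{j-1},a_j).$$ -/

import Mathlib

open Filter Topology MeasureTheory

namespace YangBaxter

/-! ### Signatures and interlacing arrays -/

/-- Nonnegative signatures with `N` parts, `a 0 ≥ a 1 ≥ ... ≥ a (N-1) ≥ 0`
(the part written `a_i` in one-based notation is `a (i-1)` here). -/
abbrev Signature (N : ℕ) : Type := {a : Fin N → ℕ // Antitone a}

/-- The signature `(0, ..., 0)`; for `N = 0` it is the empty signature. -/
def zeroSig (N : ℕ) : Signature N := ⟨fun _ => 0, antitone_const⟩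

/-- The multiplicity of `r` in a signature, that is, the number of vertical arrows in column `r`. -/
def Signature.mult {N : ℕ} (a : Signature N) (r : ℕ) : ℕ :=
  (Finset.univ.filter fun i => a.1 i = r).card

/-- The largest part (`0` for the empty signature). -/
def Signature.largest {N : ℕ} (a : Signature N) : ℕ := Finset.univ.sup a.1

/-- The interlacing `a ≺ b` of signatures of consecutive lengths. -/
def Interlaces {N : ℕ} (a : Signature N) (b : Signature (N + 1)) : Prop :=
  ∀ i : Fin N, b.1 i.succ ≤ a.1 i ∧ a.1 i ≤ b.1 i.castSucc

/-- `b` is obtained from `a` by moving the `i`-th particle to the right by one. -/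
def IsMove {N : ℕ} (a b : Signature N) (i : Fin N) : Prop :=
  b.1 = Function.update a.1 i (a.1 i + 1)

/-- Interlacing arrays of depth `M`: one signature on every level `k ≤ M`
(level `0` holds the empty signature), consecutive levels interlace. -/
@[ext]
structure InterlacingArray (M : ℕ) where
  level : ∀ k : ℕ, k ≤ M → Signature k
  interlaces : ∀ (k : ℕ) (h : k + 1 ≤ M), Interlaces (level k (Nat.le_of_succ_le h)) (level (k + 1) h)

/-- The packed array, all of whose particles are at `0`. -/
def packed (M : ℕ) : InterlacingArray M where
  level k _ := zeroSig k
  interlaces _ _ _ := ⟨le_rfl, le_rfl⟩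

/-! ### Forward Yang-Baxter moves -/

/-- The six states of the cross vertex. The letters record, in this order, the edges bottom left,
top left, bottom right, top right; `i` means an arrow and `o` an empty edge. -/
inductive Cross
  | oooo | ioio | oiio | oioi | iooi | iiii
  deriving DecidableEq

instance : Fintype Cross where
  elems := {.oooo, .ioio, .oiio, .oioi, .iooi, .iiii}
  complete c := by cases c <;> simp

/-- Number of arrows on the bottom left edge. -/
def Cross.botLeft : Cross → ℕ
  | .oooo => 0 | .ioio => 1 | .oiio => 0 | .oioi => 0 | .iooi => 1 | .iiii => 1

/-- Number of arrows on the top left edge. -/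
def Cross.topLeft : Cross → ℕ
  | .oooo => 0 | .ioio => 0 | .oiio => 1 | .oioi => 1 | .iooi => 0 | .iiii => 1

/-- Number of arrows on the bottom right edge. -/
def Cross.botRight : Cross → ℕ
  | .oooo => 0 | .ioio => 1 | .oiio => 1 | .oioi => 0 | .iooi => 0 | .iiii => 1

/-- Number of arrows on the top right edge. -/
def Cross.topRight : Cross → ℕ
  | .oooo => 0 | .ioio => 0 | .oiio => 0 | .oioi => 1 | .iooi => 1 | .iiii => 1

/-- The local forward transition weights `P^fwd_{u,v}` (quantization parameter `t`, spin `s`) for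
dragging the cross through one column. The first cross is the state before the move, the second
one the state after it, and `g` is the number of vertical arrows in the middle before the move. -/
noncomputable def pFwd (t s u v : ℝ) (g : ℕ) : Cross → Cross → ℝ
  | .oooo, .oooo => 1
  | .oooo, .ioio => (1 - t) * v / (u - t * v) * ((1 - s * t ^ g * u) / (1 - s * t ^ g * v))
  | .oooo, .oiio => (u - v) / (u - t * v) * ((1 - s * t ^ (g + 1) * v) / (1 - s * t ^ g * v))
  | .oooo, .oioi => (1 - t) * u / (u - t * v) * ((1 - s * t ^ g * v) / (1 - s * t ^ g * u))
  | .oooo, .iooi => t * (u - v) / (u - t * v) * ((1 - s * t ^ (g - 1) * u) / (1 - s * t ^ g * u))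
  | .oooo, .iiii => 1
  | .ioio, .oooo => 1
  | .ioio, .ioio => (v - s * t ^ g) / (u - s * t ^ g) * ((1 - s * t ^ g * u) / (1 - s * t ^ g * v))
  | .ioio, .oiio => (u - v) / (u - s * t ^ g) * ((1 - s ^ 2 * t ^ (2 * g)) / (1 - s * t ^ g * v))
  | .ioio, .oioi => 1
  | .ioio, .iooi => 0
  | .ioio, .iiii => 1
  | .oiio, .oooo => 1
  | .oiio, .ioio => 0
  | .oiio, .oiio => 1
  | .oiio, .oioi =>
      (1 - t) / (1 - t ^ g) * ((1 - s ^ 2 * t ^ (2 * g - 2)) / (1 - s ^ 2 * t ^ (g - 1)))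
  | .oiio, .iooi =>
      (t - t ^ g) / (1 - t ^ g) * ((1 - s ^ 2 * t ^ (g - 2)) / (1 - s ^ 2 * t ^ (g - 1)))
  | .oiio, .iiii => 1
  | .oioi, .oooo => 1
  | .oioi, .ioio => 1
  | .oioi, .oiio => 0
  | .oioi, .oioi => 1
  | .oioi, .iooi => 0
  | .oioi, .iiii => 1
  | .iooi, .oooo => 1
  | .iooi, .ioio => 0
  | .iooi, .oiio => 1
  | .iooi, .oioi => 0
  | .iooi, .iooi => 1
  | .iooi, .iiii => 1
  | .iiii, .oooo => 1
  | .iiii, .ioio => (1 - t) * u / (u - t * v) * ((v - s * t ^ g) / (u - s * t ^ g))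
  | .iiii, .oiio => (u - v) / (u - t * v) * ((u - s * t ^ (g + 1)) / (u - s * t ^ g))
  | .iiii, .oioi => (1 - t) * v / (u - t * v) * ((u - s * t ^ g) / (v - s * t ^ g))
  | .iiii, .iooi => t * (u - v) / (u - t * v) * ((v - s * t ^ (g - 1)) / (v - s * t ^ g))
  | .iiii, .iiii => 1

/-- The probability that the cross, in state `c` to the left of a column with `l`, `g`, `m`
vertical arrows at the bottom, in the middle and at the top, is dragged to the right of the column,
arrives there in state `d` and leaves `n` vertical arrows in the middle. The four equations are
the arrow preservation at the two vertices of the column before and after the move. -/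
noncomputable def columnWeight (t s u v : ℝ) (l g m n : ℕ) (c d : Cross) : ℝ :=
  if l + c.botRight = g + d.botRight ∧ g + c.topRight = m + d.topRight ∧
      l + c.botLeft = n + d.botLeft ∧ n + c.topLeft = m + d.topLeft
  then pFwd t s u v g c d else 0

/-- The cross starts to the left of column `0` in state `iiii` and is dragged to the right;
`dragWeight ... r d` is the probability that, after it has passed the columns `0, ..., r-1`,
it is in state `d` and the middle signature `κ` has been replaced in these columns by `ν`.
The bottom and top signatures are `lam` and `μ`. -/
noncomputable def dragWeight (t s u v : ℝ) {N : ℕ} (κ lam : Signature N) (μ ν : Signature (N + 1)) :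
    ℕ → Cross → ℝ
  | 0, d => if d = Cross.iiii then 1 else 0
  | r + 1, d => ∑ c : Cross, dragWeight t s u v κ lam μ ν r c *
      columnWeight t s u v (lam.mult r) (κ.mult r) (μ.mult r) (ν.mult r) c d

/-- The forward transition probability `U^fwd_{v,u}(κ → ν ∣ lam, μ)` on signatures, built from the
local weights `P^fwd_{v,u}`: the cross is dragged through all columns that contain arrows,
and there has stabilized in state `oiio`. -/
noncomputable def uFwd (t s v u : ℝ) {N : ℕ} (κ lam : Signature N) (μ ν : Signature (N + 1)) : ℝ :=
  dragWeight t s v u κ lam μ ν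
    (max (max κ.largest lam.largest) (max μ.largest ν.largest) + 1) Cross.oiio

/-! ### The Yang-Baxter field -/

/-- `Λ` is a Yang-Baxter field with parameters `t`, `s`, `v 1, v 2, ...` and `u 1, u 2, ...`:
the boundary values are `Λ (x, 0) = ∅` and `Λ (0, y) = (0, ..., 0)`, and, given the values at all
points with `x + y ≤ n + 1`, the values at the points of the quadrant with `x + y = n + 2` and
`x, y ≥ 1` are sampled independently from the forward transition probabilities. -/
structure IsYangBaxterField (t s : ℝ) (v u : ℕ → ℝ) {Ω : Type*} [MeasurableSpace Ω]
    (P : Measure Ω) (Λ : (x y : ℕ) → Ω → Signature y) : Prop where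
  measurable : ∀ x y, Measurable (Λ x y)
  boundary : ∀ y, ∀ᵐ ω ∂P, Λ 0 y ω = zeroSig y
  sample : ∀ (n : ℕ) (a : (x y : ℕ) → Signature y), (∀ y, a 0 y = zeroSig y) →
    P.real {ω | ∀ x y, x + y ≤ n + 2 → Λ x y ω = a x y} =
      P.real {ω | ∀ x y, x + y ≤ n + 1 → Λ x y ω = a x y} *
        ∏ q ∈ Finset.HasAntidiagonal.antidiagonal n,
          uFwd t s (v (q.1 + 1)) (u (q.2 + 1)) (a q.1 q.2) (a (q.1 + 1) q.2)
            (a q.1 (q.2 + 1)) (a (q.1 + 1) (q.2 + 1))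

/-! ### The continuous time dynamics on interlacing arrays -/

/-- Blocking from below: `μ_i = lam_{i-1}`. -/
def BlockedBelow {k : ℕ} (lam : Signature k) (μ : Signature (k + 1)) (i : Fin (k + 1)) : Prop :=
  ∃ j : Fin k, j.succ = i ∧ μ.1 i = lam.1 j

/-- Special blocking: `μ_i = lam_i = μ_{i+1} = lam_{i+1} = ... = μ_j = lam_j > μ_{j+1}`
for some `j ≥ i`. -/
def SpeciallyBlocked {k : ℕ} (lam : Signature k) (μ : Signature (k + 1)) (i : Fin (k + 1)) : Prop :=
  ∃ j : Fin k, i ≤ j.castSucc ∧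
    (∀ l : Fin k, i ≤ l.castSucc → l ≤ j → μ.1 l.castSucc = μ.1 i ∧ lam.1 l = μ.1 i) ∧
    μ.1 j.succ < μ.1 i

open Classical in
/-- The rate of the independent jump of `μ_i`, where `lam` is the signature on the level below. -/
noncomputable def jumpRate (u : ℝ) {k : ℕ} (lam : Signature k) (μ : Signature (k + 1))
    (i : Fin (k + 1)) : ℝ :=
  if BlockedBelow lam μ i ∨ SpeciallyBlocked lam μ i then 0 else u

/-- Special pushing of `μ_j` by `lam_i`, `j ≤ i`:
`μ_i = lam_i = μ_{i-1} = lam_{i-1} = ... = μ_j = lam_j < lam_{j-1}`,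
where the last inequality is void when `j` is the first index. -/
def SpecialPush {k : ℕ} (lam : Signature k) (μ : Signature (k + 1)) (i j : Fin k) : Prop :=
  j ≤ i ∧ (∀ l : Fin k, j ≤ l → l ≤ i → μ.1 l.castSucc = lam.1 i ∧ lam.1 l = lam.1 i) ∧
    ∀ l : Fin k, l < j → lam.1 j < lam.1 l

/-- The update `μ → ν` that is triggered by the update `κ → lam` on the level below: nothing moves
if `lam = κ`; if `lam_i = κ_i + 1` is the only difference, then there is a mandatory push of `μ_i`,
or a special push, or no move. -/
def Propagates {k : ℕ} (κ lam : Signature k) (μ ν : Signature (k + 1)) : Prop :=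
  (lam = κ ∧ ν = μ) ∨
  ∃ i : Fin k, IsMove κ lam i ∧
    ((lam.1 i = μ.1 i.castSucc + 1 ∧ IsMove μ ν i.castSucc) ∨
     (∃ j : Fin k, SpecialPush lam μ i j ∧ IsMove μ ν j.castSucc) ∨
     (lam.1 i ≠ μ.1 i.castSucc + 1 ∧ (¬ ∃ j : Fin k, SpecialPush lam μ i j) ∧ ν = μ))

open Classical in
/-- The transition probabilities `U(μ → ν ∣ κ → lam)` of the move propagation. -/
noncomputable def propagationProb {k : ℕ} (κ lam : Signature k) (μ ν : Signature (k + 1)) : ℝ :=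
  if Propagates κ lam μ ν then 1 else 0

open Classical in
/-- The rate at which an independent jump of the `i`-th particle on level `k + 1` turns the array
`a` into `b`: the levels up to `k` stay, level `k + 1` makes the jump, and the move
propagates sequentially to the levels above. -/
noncomputable def clockRate (u : ℝ) {M : ℕ} (a b : InterlacingArray M) (k : Fin M)
    (i : Fin (k + 1)) : ℝ :=
  if (∀ (l : ℕ) (hl : l ≤ M), l ≤ k → b.level l hl = a.level l hl) ∧
      IsMove (a.level (k + 1) k.2) (b.level (k + 1) k.2) i
  then jumpRate u (a.level k k.2.le) (a.level (k + 1) k.2) i *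
    ∏ l ∈ Finset.univ.filter (fun l : Fin M => k < l),
      propagationProb (a.level l l.2.le) (b.level l l.2.le)
        (a.level (l + 1) l.2) (b.level (l + 1) l.2)
  else 0

open Classical in
/-- The matrix of jump rates of the sequential update dynamics on arrays of depth `M`. -/
noncomputable def generator (u : ℝ) (M : ℕ) (a b : InterlacingArray M) : ℝ :=
  if a = b
  then -∑ k : Fin M, ∑ i : Fin (k + 1), jumpRate u (a.level k k.2.le) (a.level (k + 1) k.2) i
  else ∑ k : Fin M, ∑ i : Fin (k + 1), clockRate u a b k i

open Classical in
/-- `p τ a b`, `τ ≥ 0`, is the transition function of a continuous time Markov chain on the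
countable set `S` with jump rates `Q a b` (`a ≠ b`) and exit rates `-Q a a`. -/
structure IsTransitionFunction {S : Type*} (Q : S → S → ℝ) (p : ℝ → S → S → ℝ) : Prop where
  nonneg : ∀ τ, 0 ≤ τ → ∀ a b, 0 ≤ p τ a b
  total : ∀ τ, 0 ≤ τ → ∀ a, HasSum (fun b => p τ a b) 1
  start : ∀ a b, p 0 a b = if a = b then 1 else 0
  chapman_kolmogorov : ∀ σ τ, 0 ≤ σ → 0 ≤ τ → ∀ a b,
    HasSum (fun c => p σ a c * p τ c b) (p (σ + τ) a b)
  rates : ∀ a b, HasDerivWithinAt (fun τ => p τ a b) (Q a b) (Set.Ici 0) 0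

end YangBaxter

namespace YangBaxter

/-! ### Counting functions of signatures -/

/-! At `s = t = 0` the local weights depend only on `ρ = u / v`. Arrow conservation forces the right
edges of the cross, and among the at most two states left the next one is either forced or chosen by
a coin with probabilities `ρ` and `1 - ρ`. To the right of all arrows the cross is in `ioio` or in
the absorbing state `oiio`, and it stays in `ioio` with probability at most `ρ` per column. Hence it
stabilizes almost surely and the transition probabilities sum to one (`tsum_uZero`).

The field is realized on a product space with one independent sample for every face and every triple
of values at three of its corners (`sampleMeasure_cylinder`). The sampling rule determines the law
on triangles, so every field with the same parameters has the law of this model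
(`IsYangBaxterField.measure_eq`). Consequently the signatures of length at most `M` in column `x`
form a Markov chain in `x` with kernel `arrayKernel ρ` (`IsYangBaxterField.measure_columnEvents`).

The limit rests on the expansion `arrayKernel ρ = 1 + (ρ / u) * generator + O(ρ ^ 2)` in `ℓ¹`,
uniformly in the starting array (`tsum_abs_arrayKernel_sub_le`). Only lower bounds are needed. For
prescribed signatures around a face the path of the cross is determined by the counting functions
(`crossAt`), and its weight can be read off: a resting level pays `1 - ρ` for each free particle, a
jump pays one factor `ρ`, and the propagation of a jump costs no factor `ρ`, only powers of `1 - ρ`.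
Free particles correspond to the columns in which a coin is tossed, and the deterministic moves of
the cross reproduce the two pushing rules. These lower bounds already add up to `1 - O(ρ ^ 2)`,
while the kernel has total mass at most one, so no room is left for a larger error.

Since the jump rates are bounded, the generator is a bounded operator `Q` on `ℓ¹`. The kernels act
as contractions `T v` with `v • (T v - 1)` tending to `Q` in norm, so `T v ^ ⌊τ * v⌋₊` tends to `exp
(τ • Q)` (`tendsto_pow_exp`). The matrix of this exponential is the transition function, and
products of such powers give the finite-dimensional distributions. -/

/-- The number of parts of `a` that are at least `r`. -/
def Signature.cnt {N : ℕ} (a : Signature N) (r : ℕ) : ℕ :=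
  (Finset.univ.filter fun i => r ≤ a.1 i).card

/-- Parts decrease, so those that are at least `r` occupy an initial segment of the indices. This is
the dictionary between parts and counting functions (conjugate partitions) used throughout. -/
theorem Signature.le_iff_lt_cnt {N : ℕ} (a : Signature N) (r : ℕ) (i : Fin N) :
    r ≤ a.1 i ↔ (i : ℕ) < a.cnt r := by
  constructor
  · intro h
    have : Finset.Iic i ⊆ Finset.univ.filter fun j => r ≤ a.1 j := by
      intro j hj
      simp only [Finset.mem_Iic] at hj
      simpa using h.trans (a.2 hj)
    have := Finset.card_le_card this
    rw [Fin.card_Iic] at this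
    exact this
  · intro h
    by_contra hc
    have : (Finset.univ.filter fun j => r ≤ a.1 j) ⊆ Finset.Iio i := by
      intro j hj
      simp only [Finset.mem_filter, Finset.mem_univ, true_and] at hj
      rw [Finset.mem_Iio]
      by_contra hij
      exact hc (hj.trans (a.2 (not_lt.1 hij)))
    have := Finset.card_le_card this
    rw [Fin.card_Iio] at this
    exact absurd h (not_lt.2 this)

theorem Signature.cnt_le {N : ℕ} (a : Signature N) (r : ℕ) : a.cnt r ≤ N := by
  simpa [Signature.cnt] using Finset.card_le_univ (Finset.univ.filter fun i => r ≤ a.1 i)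

@[simp] theorem Signature.cnt_zero {N : ℕ} (a : Signature N) : a.cnt 0 = N := by
  simp [Signature.cnt]

theorem Signature.cnt_antitone {N : ℕ} (a : Signature N) : Antitone a.cnt := by
  intro r s h
  exact Finset.card_le_card fun i hi => by
    simp only [Finset.mem_filter, Finset.mem_univ, true_and] at hi ⊢
    omega

theorem Signature.cnt_eq_mult_add {N : ℕ} (a : Signature N) (r : ℕ) :
    a.cnt r = a.mult r + a.cnt (r + 1) := by
  unfold Signature.cnt Signature.mult
  rw [← Finset.card_union_of_disjoint]
  · congr 1
    ext i
    simp only [Finset.mem_filter, Finset.mem_univ, true_and, Finset.mem_union]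
    omega
  · rw [Finset.disjoint_left]
    intro i
    simp only [Finset.mem_filter, Finset.mem_univ, true_and]
    omega

theorem Signature.sum_mult_add_cnt {N : ℕ} (a : Signature N) (r : ℕ) :
    ∑ s ∈ Finset.range r, a.mult s + a.cnt r = N := by
  induction r with
  | zero => simp
  | succ r ih =>
    rw [Finset.sum_range_succ]
    have := a.cnt_eq_mult_add r
    omega

theorem Signature.largest_lt_iff {N : ℕ} (a : Signature N) {r : ℕ} (hr : 0 < r) :
    a.largest < r ↔ ∀ i, a.1 i < r := by
  unfold Signature.largest
  rw [Finset.sup_lt_iff (by simpa using hr)]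
  simp

theorem Signature.cnt_eq_zero {N : ℕ} (a : Signature N) {r : ℕ} (h : a.largest < r) :
    a.cnt r = 0 := by
  rw [a.largest_lt_iff (by omega)] at h
  simp only [Signature.cnt, Finset.card_eq_zero, Finset.filter_eq_empty_iff, Finset.mem_univ,
    not_le, forall_const]
  exact fun i => h i

theorem Signature.mult_eq_zero {N : ℕ} (a : Signature N) {r : ℕ} (h : a.largest < r) :
    a.mult r = 0 := by
  have := a.cnt_eq_mult_add r
  rw [a.cnt_eq_zero h] at this
  omega

theorem Signature.eq_of_cnt {N : ℕ} {a b : Signature N} (h : ∀ r, a.cnt r = b.cnt r) : a = b := by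
  apply Subtype.ext
  funext i
  apply le_antisymm
  · rw [b.le_iff_lt_cnt, ← h, ← a.le_iff_lt_cnt]
  · rw [a.le_iff_lt_cnt, h, ← b.le_iff_lt_cnt]

theorem Signature.eq_of_mult {N : ℕ} {a b : Signature N} (h : ∀ r, a.mult r = b.mult r) :
    a = b := by
  refine Signature.eq_of_cnt fun r => ?_
  have h1 := a.sum_mult_add_cnt r
  have h2 := b.sum_mult_add_cnt r
  have h3 : ∑ s ∈ Finset.range r, a.mult s = ∑ s ∈ Finset.range r, b.mult s :=
    Finset.sum_congr rfl fun s _ => h s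
  omega

/-- A signature can be recovered from its multiplicities. -/
theorem Signature.exists_of_mult {N : ℕ} (n : ℕ → ℕ) (R : ℕ) (hR : ∀ r, R ≤ r → n r = 0)
    (hN : ∑ r ∈ Finset.range R, n r = N) :
    ∃ a : Signature N, (∀ r, a.mult r = n r) ∧ ∀ i, a.1 i < R := by
  set S : ℕ → ℕ := fun r => ∑ s ∈ Finset.range r, n s with hS
  have hSmono : Monotone S := fun r s h =>
    Finset.sum_le_sum_of_subset (Finset.range_mono h)
  have hSR : ∀ r, R ≤ r → S r = N := by
    intro r hr
    induction r, hr using Nat.le_induction with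
    | base => exact hN
    | succ r hr ih => rw [hS]; simp only [Finset.sum_range_succ]; rw [hR r hr]; exact ih
  have hSle : ∀ r, S r ≤ N := fun r =>
    (hSmono (le_max_left r R)).trans (hSR _ (le_max_right r R)).le
  -- The counting function must be `N - S r`, so part `i` is the largest `r` with `i < N - S r`.
  set f : Fin N → ℕ := fun i => Nat.findGreatest (fun r => (i : ℕ) + S r < N) R with hf
  have key : ∀ (i : Fin N) r, r ≤ f i ↔ (i : ℕ) + S r < N := by
    intro i r
    constructor
    · intro h
      have h0 : (fun r => (i : ℕ) + S r < N) 0 := by simp [hS]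
      have := Nat.findGreatest_spec (P := fun r => (i : ℕ) + S r < N) (Nat.zero_le R) h0
      have h2 := hSmono h
      simp only [hf] at h2
      omega
    · intro h
      refine Nat.le_findGreatest ?_ h
      by_contra hc
      have := hSR r (by omega)
      omega
  have hanti : Antitone f := by
    intro i j hij
    rw [key]
    have := (key j (f j)).1 le_rfl
    have : (i : ℕ) ≤ j := hij
    omega
  refine ⟨⟨f, hanti⟩, fun r => ?_, fun i => ?_⟩
  · have hc : ∀ r, Signature.cnt ⟨f, hanti⟩ r = N - S r := by
      intro r
      apply le_antisymm
      · by_contra hlt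
        have hN' := Signature.cnt_le ⟨f, hanti⟩ r
        have := ((Signature.le_iff_lt_cnt ⟨f, hanti⟩ r ⟨N - S r, by omega⟩)).2 (not_le.1 hlt)
        have := (key _ _).1 this
        simp only at this
        omega
      · by_contra hlt
        push Not at hlt
        have h1 : Signature.cnt ⟨f, hanti⟩ r < N := by omega
        have := (Signature.le_iff_lt_cnt ⟨f, hanti⟩ r ⟨_, h1⟩).1
          ((key ⟨_, h1⟩ r).2 (by simp only; omega))
        simp at this
    have h1 := Signature.cnt_eq_mult_add ⟨f, hanti⟩ r
    rw [hc, hc] at h1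
    have h2 : S (r + 1) = S r + n r := Finset.sum_range_succ _ _
    have := hSle (r + 1)
    omega
  · by_contra hc
    have := (key i R).1 (not_lt.1 hc)
    have := hSR R le_rfl
    omega

/-- The counting function of `b` exceeds the counting function of `a` by at most one. -/
def CntStep {N N' : ℕ} (a : Signature N) (b : Signature N') : Prop :=
  ∀ r, a.cnt r ≤ b.cnt r ∧ b.cnt r ≤ a.cnt r + 1

/-- By conjugation, interlacing means that at most one arrow crosses each gap between columns.
Unlike the condition on parts, `CntStep` also makes sense for equal lengths, which is the relation
between horizontal neighbours of the field. -/
theorem interlaces_iff_cntStep {N : ℕ} (a : Signature N) (b : Signature (N + 1)) :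
    Interlaces a b ↔ CntStep a b := by
  constructor
  · intro h r
    constructor
    · by_contra hc
      have hN := a.cnt_le r
      have h1 := (a.le_iff_lt_cnt r ⟨b.cnt r, by omega⟩).2 (not_le.1 hc)
      have h2 := (b.le_iff_lt_cnt r _).1 (h1.trans (h _).2)
      simp at h2
    · by_contra hc
      have hN := b.cnt_le r
      have h1 := (b.le_iff_lt_cnt r (Fin.succ ⟨a.cnt r, by omega⟩)).2 (by simpa using hc)
      have h2 := (a.le_iff_lt_cnt r _).1 (h1.trans (h _).1)
      simp at h2
  · intro h i
    constructor
    · have h1 := (b.le_iff_lt_cnt _ i.succ).1 le_rfl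
      have h2 := (h (b.1 i.succ)).2
      rw [a.le_iff_lt_cnt]
      simp only [Fin.val_succ] at h1
      omega
    · have h1 := (a.le_iff_lt_cnt _ i).1 le_rfl
      have h2 := (h (a.1 i)).1
      rw [b.le_iff_lt_cnt]
      simp only [Fin.val_castSucc]
      omega

theorem zeroSig_cnt_succ (N r : ℕ) : (zeroSig N).cnt (r + 1) = 0 := by
  simp [Signature.cnt, zeroSig]

theorem cntStep_zeroSig (N : ℕ) : CntStep (zeroSig N) (zeroSig (N + 1)) := by
  rintro (_ | r)
  · simp
  · simp [zeroSig_cnt_succ]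

theorem CntStep.refl {N : ℕ} (a : Signature N) : CntStep a a := fun r => by omega

theorem IsMove.cnt_eq {N : ℕ} {a b : Signature N} {i : Fin N} (h : IsMove a b i) (r : ℕ) :
    b.cnt r = a.cnt r + if r = a.1 i + 1 then 1 else 0 := by
  unfold Signature.cnt
  rw [Finset.card_filter, Finset.card_filter]
  have : (if r = a.1 i + 1 then 1 else 0) =
      ∑ j : Fin N, if j = i ∧ r = a.1 i + 1 then 1 else 0 := by
    by_cases hr : r = a.1 i + 1 <;> simp [hr]
  rw [this, ← Finset.sum_add_distrib]
  refine Finset.sum_congr rfl fun j _ => ?_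
  rw [h]
  by_cases hj : j = i
  · subst hj
    simp only [Function.update_self, true_and]
    split_ifs <;> omega
  · simp [hj]

theorem IsMove.eq {N : ℕ} {a b b' : Signature N} {i : Fin N} (h : IsMove a b i)
    (h' : IsMove a b' i) : b = b' :=
  Subtype.ext (h.trans h'.symm)

theorem IsMove.ne {N : ℕ} {a b : Signature N} {i : Fin N} (h : IsMove a b i) : b ≠ a := by
  rintro rfl
  have := congrFun h i
  simp at this

theorem IsMove.index_eq {N : ℕ} {a b : Signature N} {i j : Fin N} (h : IsMove a b i)
    (h' : IsMove a b j) : i = j := by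
  by_contra hij
  have h1 := congrFun h i
  have h2 := congrFun h' i
  rw [Function.update_self] at h1
  rw [Function.update_of_ne hij] at h2
  omega

theorem exists_isMove {N : ℕ} (a : Signature N) (i : Fin N) (h : (i : ℕ) ≤ a.cnt (a.1 i + 1)) :
    ∃ b, IsMove a b i := by
  refine ⟨⟨Function.update a.1 i (a.1 i + 1), ?_⟩, rfl⟩
  intro j k hjk
  by_cases hk : k = i
  · subst hk
    by_cases hj : j = k
    · simp [hj]
    · have hjk' : j < k := lt_of_le_of_ne hjk hj
      simp only [Function.update_self, Function.update_of_ne hj]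
      rw [a.le_iff_lt_cnt]
      have : (j : ℕ) < k := hjk'
      omega
  · rw [Function.update_of_ne hk]
    by_cases hj : j = i
    · subst hj
      simp only [Function.update_self]
      exact (a.2 hjk).trans (Nat.le_succ _)
    · rw [Function.update_of_ne hj]
      exact a.2 hjk

/-! ### Dragging the cross at `s = t = 0` -/

/-- The local transition weights at `s = t = 0` as a function of the ratio `ρ` of the parameters. -/
def stepWeight (ρ : ℝ) : Cross → Cross → ℝ
  | .oooo, .ioio => ρ
  | .oooo, .oiio => 1 - ρ
  | .oooo, .iooi => 0
  | .ioio, .ioio => ρ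
  | .ioio, .oiio => 1 - ρ
  | .ioio, .iooi => 0
  | .oiio, .ioio => 0
  | .oiio, .iooi => 0
  | .oioi, .oiio => 0
  | .oioi, .iooi => 0
  | .iooi, .ioio => 0
  | .iooi, .oioi => 0
  | .iiii, .ioio => ρ
  | .iiii, .oiio => 1 - ρ
  | .iiii, .iooi => 0
  | _, _ => 1

theorem stepWeight_nonneg {ρ : ℝ} (h0 : 0 ≤ ρ) (h1 : ρ ≤ 1) (c d : Cross) :
    0 ≤ stepWeight ρ c d := by
  cases c <;> cases d <;> simp [stepWeight, h0, h1]

/-- The arrow preservation at the two vertices of a column before and after the move. -/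
def Conserves (l g m n : ℕ) (c d : Cross) : Prop :=
  l + c.botRight = g + d.botRight ∧ g + c.topRight = m + d.topRight ∧
      l + c.botLeft = n + d.botLeft ∧ n + c.topLeft = m + d.topLeft

instance (l g m n : ℕ) (c d : Cross) : Decidable (Conserves l g m n c d) :=
  inferInstanceAs (Decidable (_ ∧ _))

/-- At `s = t = 0` the number `g` enters only through `0 ^ g` in the moves from `oiio` to `oioi` and
`iooi`. There the value `g = 0`, where `0 ^ g = 1`, is excluded by arrow conservation. -/
theorem columnWeight_zero_zero {u v : ℝ} (hu : 0 < u) (huv : u < v) (l g m n : ℕ) (c d : Cross) :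
    columnWeight 0 0 v u l g m n c d =
      if Conserves l g m n c d then stepWeight (u / v) c d else 0 := by
  have hv : v ≠ 0 := by linarith
  have hu' : u ≠ 0 := hu.ne'
  have e : columnWeight 0 0 v u l g m n c d =
      if Conserves l g m n c d then pFwd 0 0 v u g c d else 0 := rfl
  rw [e]
  by_cases h : Conserves l g m n c d
  · rw [if_pos h, if_pos h]
    unfold Conserves at h
    clear e
    cases c <;> cases d <;> simp [pFwd, stepWeight, hv, hu', sub_div]
    all_goals
      simp [Cross.botRight, Cross.topRight, Cross.botLeft, Cross.topLeft] at h
      omega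
  · rw [if_neg h, if_neg h]

/-- The weight of dragging the cross through the columns `0, ..., r-1` with multiplicities
`l`, `g`, `m` and `n` of the bottom, the old middle, the top and the new middle signature. -/
def drag (ρ : ℝ) (l g m n : ℕ → ℕ) : ℕ → Cross → ℝ
  | 0, d => if d = Cross.iiii then 1 else 0
  | r + 1, d => ∑ c : Cross, drag ρ l g m n r c *
      if Conserves (l r) (g r) (m r) (n r) c d then stepWeight ρ c d else 0

theorem dragWeight_zero_zero {u v : ℝ} (hu : 0 < u) (huv : u < v) {N : ℕ} (κ lam : Signature N)
    (μ ν : Signature (N + 1)) (r : ℕ) (d : Cross) :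
    dragWeight 0 0 v u κ lam μ ν r d = drag (u / v) lam.mult κ.mult μ.mult ν.mult r d := by
  induction r generalizing d with
  | zero => rfl
  | succ r ih =>
    unfold dragWeight drag
    simp only [ih, columnWeight_zero_zero hu huv]

section Drag

variable {ρ : ℝ} (h0 : 0 ≤ ρ) (h1 : ρ ≤ 1) (l g m n : ℕ → ℕ)

include h0 h1 in
theorem drag_nonneg (r : ℕ) (d : Cross) : 0 ≤ drag ρ l g m n r d := by
  induction r generalizing d with
  | zero => unfold drag; split_ifs <;> simp
  | succ r ih =>
    unfold drag
    refine Finset.sum_nonneg fun c _ => mul_nonneg (ih c) ?_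
    split_ifs
    · exact stepWeight_nonneg h0 h1 c d
    · exact le_rfl

end Drag

theorem drag_congr (ρ : ℝ) {l g m n l' g' m' n' : ℕ → ℕ} {r : ℕ} (hl : ∀ s < r, l s = l' s)
    (hg : ∀ s < r, g s = g' s) (hm : ∀ s < r, m s = m' s) (hn : ∀ s < r, n s = n' s) (d : Cross) :
    drag ρ l g m n r d = drag ρ l' g' m' n' r d := by
  induction r generalizing d with
  | zero => rfl
  | succ r ih =>
    unfold drag
    rw [hl r (by omega), hg r (by omega), hm r (by omega), hn r (by omega)]
    refine Finset.sum_congr rfl fun c _ => ?_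
    rw [ih (fun s hs => hl s (by omega)) (fun s hs => hg s (by omega))
      (fun s hs => hm s (by omega)) (fun s hs => hn s (by omega))]

/-- The states of the cross satisfy the arrow preservation for all columns to its left. -/
theorem drag_ne_zero {ρ : ℝ} {l g m n : ℕ → ℕ} {r : ℕ} {d : Cross}
    (h : drag ρ l g m n r d ≠ 0) :
    (∑ s ∈ Finset.range r, l s) + 1 = (∑ s ∈ Finset.range r, g s) + d.botRight ∧
    (∑ s ∈ Finset.range r, g s) + 1 = (∑ s ∈ Finset.range r, m s) + d.topRight ∧
    (∑ s ∈ Finset.range r, l s) + 1 = (∑ s ∈ Finset.range r, n s) + d.botLeft ∧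
    (∑ s ∈ Finset.range r, n s) + 1 = (∑ s ∈ Finset.range r, m s) + d.topLeft := by
  induction r generalizing d with
  | zero =>
    unfold drag at h
    split_ifs at h with hd
    · subst hd; simp [Cross.botRight, Cross.topRight, Cross.botLeft, Cross.topLeft]
    · exact absurd rfl h
  | succ r ih =>
    unfold drag at h
    obtain ⟨c, -, hc⟩ := Finset.exists_ne_zero_of_sum_ne_zero h
    split_ifs at hc with hcons
    · have := ih (left_ne_zero_of_mul hc)
      simp only [Finset.sum_range_succ]
      unfold Conserves at hcons
      omega
    · simp at hc

theorem drag_succ_ne_zero {ρ : ℝ} {l g m n : ℕ → ℕ} {r : ℕ} {d : Cross}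
    (h : drag ρ l g m n (r + 1) d ≠ 0) : ∃ c, drag ρ l g m n r c ≠ 0 := by
  unfold drag at h
  obtain ⟨c, -, hc⟩ := Finset.exists_ne_zero_of_sum_ne_zero h
  exact ⟨c, left_ne_zero_of_mul hc⟩

theorem exists_drag_ne_zero {ρ : ℝ} {l g m n : ℕ → ℕ} {r : ℕ} {d : Cross}
    (h : drag ρ l g m n r d ≠ 0) {s : ℕ} (hs : s ≤ r) : ∃ c, drag ρ l g m n s c ≠ 0 := by
  induction r, hs using Nat.le_induction generalizing d with
  | base => exact ⟨d, h⟩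
  | succ r hr ih =>
    obtain ⟨c, hc⟩ := drag_succ_ne_zero h
    exact ih hc

theorem Cross.le_one (c : Cross) :
    c.botLeft ≤ 1 ∧ c.topLeft ≤ 1 ∧ c.botRight ≤ 1 ∧ c.topRight ≤ 1 := by
  cases c <;> simp [Cross.botRight, Cross.topRight, Cross.botLeft, Cross.topLeft]

/-- The new multiplicity in a column is determined by the states of the cross. -/
theorem Conserves.exists_iff {l g m : ℕ} {c d : Cross} :
    (∃ n, Conserves l g m n c d) ↔ l + c.botRight = g + d.botRight ∧
      g + c.topRight = m + d.topRight ∧ d.botLeft ≤ l + c.botLeft := by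
  unfold Conserves
  constructor
  · rintro ⟨n, h⟩
    omega
  · rintro ⟨h1, h2, h3⟩
    refine ⟨l + c.botLeft - d.botLeft, ?_⟩
    cases c <;> cases d <;>
      simp only [Cross.botRight, Cross.topRight, Cross.botLeft, Cross.topLeft] at * <;> omega

open ENNReal in
-- The two cross states leave exactly one possible `n`, provided that it is not negative; this is
-- the inequality in the condition.
theorem tsum_conserves (l g m : ℕ) (c d : Cross) (w : ℝ≥0∞) :
    ∑' n, (if Conserves l g m n c d then w else 0) =
      if l + c.botRight = g + d.botRight ∧ g + c.topRight = m + d.topRight ∧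
        d.botLeft ≤ l + c.botLeft then w else 0 := by
  split_ifs with h
  · obtain ⟨n, hn⟩ := Conserves.exists_iff.2 h
    rw [tsum_eq_single n, if_pos hn]
    intro n' hn'
    rw [if_neg]
    intro h'
    apply hn'
    unfold Conserves at hn h'
    omega
  · simp only [← Conserves.exists_iff, not_exists] at h
    simp [h]

/-- The local weights are transition probabilities. -/
theorem sum_stepWeight {ρ : ℝ} (h0 : 0 ≤ ρ) (h1 : ρ ≤ 1) {l g m : ℕ} (c d₀ : Cross)
    (hb : l + c.botRight = g + d₀.botRight) (ht : g + c.topRight = m + d₀.topRight) :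
    ∑ d, (if l + c.botRight = g + d.botRight ∧ g + c.topRight = m + d.topRight ∧
      d.botLeft ≤ l + c.botLeft then ENNReal.ofReal (stepWeight ρ c d) else 0) = 1 := by
  -- The state `d₀` witnesses that the forced right edges are possible. A state with positive weight
  -- never violates the inequality, so the sum is either `1` or `ρ + (1 - ρ)`.
  have e : ENNReal.ofReal ρ + ENNReal.ofReal (1 - ρ) = 1 := by
    rw [← ENNReal.ofReal_add h0 (by linarith)]; simp
  rw [show (Finset.univ : Finset Cross) = {.oooo, .ioio, .oiio, .oioi, .iooi, .iiii} from rfl]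
  cases c <;> cases d₀ <;>
    simp only [Cross.botRight, Cross.topRight, Cross.botLeft, add_zero] at * <;>
    simp [stepWeight, hb, ht, e]
  all_goals first
    | omega
    | subst ht
      simp [e]

/-! ### Total mass -/

/-- Extension of a finite sequence by zeros. -/
def extendZero {R : ℕ} (f : Fin R → ℕ) (r : ℕ) : ℕ := if h : r < R then f ⟨r, h⟩ else 0

/-- The total weight with which the cross is in state `d` after `R` columns. -/
noncomputable def massAt (ρ : ℝ) (l g m : ℕ → ℕ) (R : ℕ) (d : Cross) : ENNReal :=
  ∑' f : Fin R → ℕ, ENNReal.ofReal (drag ρ l g m (extendZero f) R d)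

section Mass

variable {ρ : ℝ} (h0 : 0 ≤ ρ) (h1 : ρ ≤ 1) (l g m : ℕ → ℕ)

include h0 h1

/-- Summing out the new multiplicity of the last column, which the states on its two sides
determine, makes the cross alone a Markov chain. -/
theorem massAt_succ (R : ℕ) (d : Cross) :
    massAt ρ l g m (R + 1) d = ∑ c, massAt ρ l g m R c *
      if l R + c.botRight = g R + d.botRight ∧ g R + c.topRight = m R + d.topRight ∧
        d.botLeft ≤ l R + c.botLeft then ENNReal.ofReal (stepWeight ρ c d) else 0 := by
  unfold massAt
  rw [← (Fin.snocEquiv fun _ : Fin (R + 1) => ℕ).tsum_eq, ENNReal.tsum_prod', ENNReal.tsum_comm]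
  have key : ∀ (f : Fin R → ℕ) (n : ℕ),
      ENNReal.ofReal (drag ρ l g m (extendZero ((Fin.snocEquiv fun _ : Fin (R + 1) => ℕ) (n, f)))
        (R + 1) d) = ∑ c, ENNReal.ofReal (drag ρ l g m (extendZero f) R c) *
          if Conserves (l R) (g R) (m R) n c d then ENNReal.ofReal (stepWeight ρ c d) else 0 := by
    intro f n
    have e1 : extendZero ((Fin.snocEquiv fun _ : Fin (R + 1) => ℕ) (n, f)) R = n := by
      unfold extendZero
      rw [dif_pos (Nat.lt_succ_self R)]
      exact Fin.snoc_last (α := fun _ => ℕ) n f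
    have e2 : ∀ s < R, extendZero ((Fin.snocEquiv fun _ : Fin (R + 1) => ℕ) (n, f)) s =
        extendZero f s := by
      intro s hs
      unfold extendZero
      rw [dif_pos (Nat.lt_succ_of_lt hs), dif_pos hs]
      exact Fin.snoc_castSucc (α := fun _ => ℕ) n f ⟨s, hs⟩
    rw [drag, ENNReal.ofReal_sum_of_nonneg]
    · refine Finset.sum_congr rfl fun c _ => ?_
      rw [e1, ENNReal.ofReal_mul (drag_nonneg h0 h1 _ _ _ _ _ _),
        drag_congr ρ (fun _ _ => rfl) (fun _ _ => rfl) (fun _ _ => rfl) e2]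
      split_ifs <;> simp
    · intro c _
      refine mul_nonneg (drag_nonneg h0 h1 _ _ _ _ _ _) ?_
      split_ifs
      · exact stepWeight_nonneg h0 h1 c d
      · exact le_rfl
  simp only [key]
  simp only [Summable.tsum_finsetSum fun _ _ => ENNReal.summable, ENNReal.tsum_mul_left,
    tsum_conserves, ENNReal.tsum_mul_right]

omit h0 h1 in
theorem massAt_ne_zero {R : ℕ} {d : Cross} (h : massAt ρ l g m R d ≠ 0) :
    (∑ s ∈ Finset.range R, l s) + 1 = (∑ s ∈ Finset.range R, g s) + d.botRight ∧
    (∑ s ∈ Finset.range R, g s) + 1 = (∑ s ∈ Finset.range R, m s) + d.topRight := by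
  have : ∃ f : Fin R → ℕ, drag ρ l g m (extendZero f) R d ≠ 0 := by
    by_contra hc
    push Not at hc
    exact h (by simp [massAt, hc])
  obtain ⟨f, hf⟩ := this
  have := drag_ne_zero hf
  exact ⟨this.1, this.2.1⟩

/-- The weights of all paths of the cross through the first `R` columns add up to one. -/
theorem sum_massAt
    (hv : ∀ r, ∃ d : Cross,
      (∑ s ∈ Finset.range r, l s) + 1 = (∑ s ∈ Finset.range r, g s) + d.botRight ∧
      (∑ s ∈ Finset.range r, g s) + 1 = (∑ s ∈ Finset.range r, m s) + d.topRight) (R : ℕ) :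
    ∑ d, massAt ρ l g m R d = 1 := by
  induction R with
  | zero =>
    simp only [massAt, drag]
    rw [Finset.sum_eq_single Cross.iiii]
    · simp
    · intro b _ hb
      simp [hb]
    · simp
  | succ R ih =>
    simp only [massAt_succ h0 h1 l g m]
    rw [Finset.sum_comm, ← ih]
    refine Finset.sum_congr rfl fun c _ => ?_
    rw [← Finset.mul_sum]
    by_cases hc : massAt ρ l g m R c = 0
    · simp [hc]
    obtain ⟨d₀, hd⟩ := hv (R + 1)
    have := massAt_ne_zero l g m hc
    simp only [Finset.sum_range_succ] at hd
    rw [sum_stepWeight h0 h1 c d₀ (by omega) (by omega), mul_one]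

omit h0 h1 in
theorem sum_cross {α : Type*} [AddCommMonoid α] (f : Cross → α) :
    ∑ c, f c = f .oooo + (f .ioio + (f .oiio + (f .oioi + (f .iooi + f .iiii)))) := by
  rw [show (Finset.univ : Finset Cross) = {.oooo, .ioio, .oiio, .oioi, .iooi, .iiii} from rfl]
  simp

/-- The cross stabilizes in the state `oiio` almost surely. -/
theorem tendsto_massAt (hρ : ρ < 1)
    (hv : ∀ r, ∃ d : Cross,
      (∑ s ∈ Finset.range r, l s) + 1 = (∑ s ∈ Finset.range r, g s) + d.botRight ∧
      (∑ s ∈ Finset.range r, g s) + 1 = (∑ s ∈ Finset.range r, m s) + d.topRight)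
    (R₀ : ℕ)
    (hb : ∀ r, R₀ ≤ r → ∑ s ∈ Finset.range r, l s = ∑ s ∈ Finset.range r, g s)
    (ht : ∀ r, R₀ ≤ r → (∑ s ∈ Finset.range r, g s) + 1 = ∑ s ∈ Finset.range r, m s) :
    Tendsto (fun R => massAt ρ l g m R .oiio) atTop (𝓝 1) := by
  -- Beyond `R₀` the arrow counts force the right edges `(1, 0)`.
  have hz : ∀ r, R₀ ≤ r → ∀ c : Cross, c ≠ .ioio → c ≠ .oiio → massAt ρ l g m r c = 0 := by
    intro r hr c h1 h2
    by_contra hc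
    have h3 := massAt_ne_zero l g m hc
    have h4 := hb r hr
    have h5 := ht r hr
    cases c <;> simp [Cross.botRight, Cross.topRight] at h1 h2 h3 <;> omega
  have htot : ∀ r, R₀ ≤ r → massAt ρ l g m r .ioio + massAt ρ l g m r .oiio = 1 := by
    intro r hr
    rw [← sum_massAt h0 h1 l g m hv r, sum_cross]
    simp [hz r hr]
  -- The state `ioio` is entered only from itself, since `oiio → ioio` has weight `0`, and it
  -- survives a column with weight `ρ`.
  have hgeo : ∀ k, massAt ρ l g m (R₀ + k) .ioio ≤ ENNReal.ofReal ρ ^ k := by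
    intro k
    induction k with
    | zero =>
      rw [pow_zero, ← htot (R₀ + 0) le_self_add]
      exact le_self_add
    | succ k ih =>
      rw [← add_assoc, massAt_succ h0 h1, sum_cross]
      simp only [hz (R₀ + k) le_self_add, ne_eq, reduceCtorEq, not_false_eq_true, zero_mul,
        zero_add, add_zero]
      simp only [stepWeight, ENNReal.ofReal_zero, ite_self, mul_zero, add_zero]
      rw [pow_succ]
      refine mul_le_mul' ih ?_
      split_ifs <;> simp
  have hlim : Tendsto (fun k => massAt ρ l g m (R₀ + k) .ioio) atTop (𝓝 0) := by
    refine tendsto_of_tendsto_of_tendsto_of_le_of_le tendsto_const_nhds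
      (ENNReal.tendsto_pow_atTop_nhds_zero_of_lt_one (r := ENNReal.ofReal ρ) (by simpa using hρ))
      (fun _ => zero_le) hgeo
  rw [← tendsto_add_atTop_iff_nat R₀]
  have e : ∀ k, massAt ρ l g m (k + R₀) .oiio = 1 - massAt ρ l g m (R₀ + k) .ioio := by
    intro k
    have := htot (R₀ + k) le_self_add
    rw [add_comm k, ← this, ENNReal.add_sub_cancel_left]
    exact ne_top_of_le_ne_top ENNReal.one_ne_top (this ▸ le_self_add)
  simp only [e]
  have := ENNReal.Tendsto.sub (tendsto_const_nhds (x := (1 : ENNReal))) hlim (by simp)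
  simpa using this

end Mass

/-! ### Forward transition probabilities at `s = t = 0` -/

/-- The number of columns which contain all arrows of the four signatures. -/
def columnBound {N : ℕ} (κ lam : Signature N) (μ ν : Signature (N + 1)) : ℕ :=
  max (max κ.largest lam.largest) (max μ.largest ν.largest) + 1

/-- The forward transition probability at `s = t = 0`. -/
noncomputable def uZero (ρ : ℝ) {N : ℕ} (κ lam : Signature N) (μ ν : Signature (N + 1)) : ℝ :=
  drag ρ lam.mult κ.mult μ.mult ν.mult (columnBound κ lam μ ν) .oiio

theorem uFwd_eq_uZero {u v : ℝ} (hu : 0 < u) (huv : u < v) {N : ℕ} (κ lam : Signature N)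
    (μ ν : Signature (N + 1)) : uFwd 0 0 v u κ lam μ ν = uZero (u / v) κ lam μ ν :=
  dragWeight_zero_zero hu huv κ lam μ ν _ _

theorem uZero_nonneg {ρ : ℝ} (h0 : 0 ≤ ρ) (h1 : ρ ≤ 1) {N : ℕ} (κ lam : Signature N)
    (μ ν : Signature (N + 1)) : 0 ≤ uZero ρ κ lam μ ν :=
  drag_nonneg h0 h1 _ _ _ _ _ _

theorem lt_columnBound {N : ℕ} (κ lam : Signature N) (μ ν : Signature (N + 1)) :
    κ.largest < columnBound κ lam μ ν ∧ lam.largest < columnBound κ lam μ ν ∧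
      μ.largest < columnBound κ lam μ ν ∧ ν.largest < columnBound κ lam μ ν := by
  unfold columnBound
  omega

/-- In an empty column `oiio` can only come from `oiio`, with weight `1`, so extra columns change
nothing. -/
theorem drag_eq_uZero (ρ : ℝ) {N : ℕ} (κ lam : Signature N) (μ ν : Signature (N + 1)) {R : ℕ}
    (hR : columnBound κ lam μ ν ≤ R) :
    drag ρ lam.mult κ.mult μ.mult ν.mult R .oiio = uZero ρ κ lam μ ν := by
  induction R, hR using Nat.le_induction with
  | base => rfl
  | succ R hR ih =>
    obtain ⟨h1, h2, h3, h4⟩ := lt_columnBound κ lam μ ν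
    rw [← ih, drag, κ.mult_eq_zero (by omega), lam.mult_eq_zero (by omega),
      μ.mult_eq_zero (by omega), ν.mult_eq_zero (by omega), Finset.sum_eq_single .oiio]
    · simp [Conserves, stepWeight]
    · intro c _ hc
      rw [if_neg, mul_zero]
      intro h
      apply hc
      unfold Conserves at h
      cases c <;> simp [Cross.botRight, Cross.topRight, Cross.botLeft] at h ⊢
    · simp

/-- The edges of the cross record the differences of neighbouring counting functions. Since each
edge carries at most one arrow, the signatures interlace along all four sides of the face. -/
theorem uZero_ne_zero {ρ : ℝ} {N : ℕ} {κ lam : Signature N} {μ ν : Signature (N + 1)}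
    (h : uZero ρ κ lam μ ν ≠ 0) :
    CntStep κ lam ∧ CntStep κ μ ∧ CntStep lam ν ∧ CntStep μ ν := by
  have key : ∀ r, (κ.cnt r ≤ lam.cnt r ∧ lam.cnt r ≤ κ.cnt r + 1) ∧
      (κ.cnt r ≤ μ.cnt r ∧ μ.cnt r ≤ κ.cnt r + 1) ∧
      (lam.cnt r ≤ ν.cnt r ∧ ν.cnt r ≤ lam.cnt r + 1) ∧
      (μ.cnt r ≤ ν.cnt r ∧ ν.cnt r ≤ μ.cnt r + 1) := by
    intro r
    rcases le_total r (columnBound κ lam μ ν) with hr | hr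
    · obtain ⟨c, hc⟩ := exists_drag_ne_zero h hr
      have h1 := drag_ne_zero hc
      have h2 := c.le_one
      have := κ.sum_mult_add_cnt r
      have := lam.sum_mult_add_cnt r
      have := μ.sum_mult_add_cnt r
      have := ν.sum_mult_add_cnt r
      omega
    · have := lt_columnBound κ lam μ ν
      rw [κ.cnt_eq_zero (by omega), lam.cnt_eq_zero (by omega), μ.cnt_eq_zero (by omega),
        ν.cnt_eq_zero (by omega)]
      omega
  exact ⟨fun r => (key r).1, fun r => (key r).2.1, fun r => (key r).2.2.1,
    fun r => (key r).2.2.2⟩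

/-- The forward transition probabilities add up to one. -/
theorem tsum_uZero {ρ : ℝ} (h0 : 0 ≤ ρ) (h1 : ρ < 1) {N : ℕ} {κ lam : Signature N}
    {μ : Signature (N + 1)} (hl : CntStep κ lam) (hm : CntStep κ μ) :
    ∑' ν, ENNReal.ofReal (uZero ρ κ lam μ ν) = 1 := by
  set R₀ := max κ.largest (max lam.largest μ.largest) + 1 with hR₀
  have hκ := κ.sum_mult_add_cnt
  have hlam := lam.sum_mult_add_cnt
  have hμ := μ.sum_mult_add_cnt
  have hv : ∀ r, ∃ d : Cross,
      (∑ s ∈ Finset.range r, lam.mult s) + 1 =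
        (∑ s ∈ Finset.range r, κ.mult s) + d.botRight ∧
      (∑ s ∈ Finset.range r, κ.mult s) + 1 =
        (∑ s ∈ Finset.range r, μ.mult s) + d.topRight := by
    intro r
    have a1 := hl r
    have a2 := hm r
    have := hκ r
    have := hlam r
    have := hμ r
    have b1 : lam.cnt r = κ.cnt r ∨ lam.cnt r = κ.cnt r + 1 := by omega
    have b2 : μ.cnt r = κ.cnt r ∨ μ.cnt r = κ.cnt r + 1 := by omega
    rcases b1 with b1 | b1 <;> rcases b2 with b2 | b2
    · exact ⟨.oiio, by simp only [Cross.botRight, Cross.topRight]; omega⟩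
    · exact ⟨.iiii, by simp only [Cross.botRight, Cross.topRight]; omega⟩
    · exact ⟨.oooo, by simp only [Cross.botRight, Cross.topRight]; omega⟩
    · exact ⟨.oioi, by simp only [Cross.botRight, Cross.topRight]; omega⟩
  -- Multiplicities of paths that end in `oiio` after `R` columns sum to `N + 1`, because the bottom
  -- left edge is empty there. So they are the multiplicities of signatures with parts below `R`.
  have hmass : ∀ R, R₀ ≤ R → ∑' ν : {ν : Signature (N + 1) | ν.largest < R},
      ENNReal.ofReal (uZero ρ κ lam μ ν.1) = massAt ρ lam.mult κ.mult μ.mult R .oiio := by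
    intro R hR
    have e : ∀ ν : {ν : Signature (N + 1) | ν.largest < R},
        ENNReal.ofReal (uZero ρ κ lam μ ν.1) = ENNReal.ofReal
          (drag ρ lam.mult κ.mult μ.mult (extendZero fun r : Fin R => ν.1.mult r) R .oiio) := by
      intro ν
      have hν : ν.1.largest < R := ν.2
      rw [← drag_eq_uZero ρ κ lam μ ν.1 (R := R) (by unfold columnBound; omega)]
      congr 1
      refine drag_congr ρ (fun _ _ => rfl) (fun _ _ => rfl) (fun _ _ => rfl) (fun s hs => ?_) _
      simp [extendZero, hs]
    simp only [e]
    refine Function.Injective.tsum_eq (β := Fin R → ℕ)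
      (g := fun (ν : {ν : Signature (N + 1) | ν.largest < R}) (r : Fin R) => ν.1.mult r)
      (f := fun f => ENNReal.ofReal (drag ρ lam.mult κ.mult μ.mult (extendZero f) R .oiio)) ?_ ?_
    · intro ν ν' h
      apply Subtype.ext
      refine Signature.eq_of_mult fun r => ?_
      by_cases hr : r < R
      · exact congrFun h ⟨r, hr⟩
      · have h2 : ν.1.largest < R := ν.2
        have h3 : ν'.1.largest < R := ν'.2
        rw [ν.1.mult_eq_zero (by omega), ν'.1.mult_eq_zero (by omega)]
    · intro f hf
      have hf' : drag ρ lam.mult κ.mult μ.mult (extendZero f) R .oiio ≠ 0 := by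
        intro h
        simp [h] at hf
      have h3 := (drag_ne_zero hf').2.2.1
      have h4 := hlam R
      rw [lam.cnt_eq_zero (by omega)] at h4
      simp only [Cross.botLeft] at h3
      obtain ⟨ν, hν, hνR⟩ := Signature.exists_of_mult (N := N + 1) (extendZero f) R
        (fun r hr => by simp [extendZero, not_lt.2 hr]) (by omega)
      refine ⟨⟨ν, (ν.largest_lt_iff (by omega)).2 hνR⟩, ?_⟩
      funext r
      simp [hν, extendZero]
  apply le_antisymm
  -- Upper bound: finitely many `ν` fit below a common `R`, and the total mass after `R` columns is
  -- one.
  · rw [ENNReal.tsum_eq_iSup_sum]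
    refine iSup_le fun s => ?_
    set R := max R₀ (s.sup (fun ν => ν.largest) + 1) with hR
    have hs : ∀ ν ∈ s, ν.largest < R := by
      intro ν hν
      have := Finset.le_sup (f := fun ν : Signature (N + 1) => ν.largest) hν
      omega
    calc ∑ ν ∈ s, ENNReal.ofReal (uZero ρ κ lam μ ν)
        = ∑ ν ∈ s, {ν : Signature (N + 1) | ν.largest < R}.indicator
            (fun ν => ENNReal.ofReal (uZero ρ κ lam μ ν)) ν := by
          refine Finset.sum_congr rfl fun ν hν => ?_
          rw [Set.indicator_of_mem (show ν ∈ {ν : Signature (N + 1) | ν.largest < R} from hs ν hν)]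
      _ ≤ _ := ENNReal.sum_le_tsum s
      _ = massAt ρ lam.mult κ.mult μ.mult R .oiio := by
          rw [← tsum_subtype, hmass R (le_max_left _ _)]
      _ ≤ ∑ d, massAt ρ lam.mult κ.mult μ.mult R d :=
          Finset.single_le_sum (f := fun d => massAt ρ lam.mult κ.mult μ.mult R d)
            (fun _ _ => zero_le) (Finset.mem_univ _)
      _ = 1 := sum_massAt h0 h1.le _ _ _ hv R
  -- Lower bound: the mass that has stabilized by column `R` tends to one.
  · have hlim := tendsto_massAt h0 h1.le lam.mult κ.mult μ.mult h1 hv R₀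
      (fun r hr => by
        have := hκ r
        have := hlam r
        rw [κ.cnt_eq_zero (by omega)] at *
        rw [lam.cnt_eq_zero (by omega)] at *
        omega)
      (fun r hr => by
        have := hκ r
        have := hμ r
        rw [κ.cnt_eq_zero (by omega)] at *
        rw [μ.cnt_eq_zero (by omega)] at *
        omega)
    refine le_of_tendsto hlim ?_
    filter_upwards [eventually_ge_atTop R₀] with R hR
    rw [← hmass R hR]
    exact ENNReal.tsum_comp_le_tsum_of_injective Subtype.val_injective _

/-- A path of the cross gives a lower bound for the transition probability. -/
theorem prod_stepWeight_le_uZero {ρ : ℝ} (h0 : 0 ≤ ρ) (h1 : ρ ≤ 1) {N : ℕ}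
    (κ lam : Signature N) (μ ν : Signature (N + 1)) (c : ℕ → Cross) (hc0 : c 0 = .iiii)
    (hc : ∀ r, Conserves (lam.mult r) (κ.mult r) (μ.mult r) (ν.mult r) (c r) (c (r + 1)))
    (hcR : ∀ r, columnBound κ lam μ ν ≤ r → c r = .oiio) :
    ∏ r ∈ Finset.range (columnBound κ lam μ ν), stepWeight ρ (c r) (c (r + 1)) ≤
      uZero ρ κ lam μ ν := by
  have key : ∀ R, ∏ r ∈ Finset.range R, stepWeight ρ (c r) (c (r + 1)) ≤
      drag ρ lam.mult κ.mult μ.mult ν.mult R (c R) := by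
    intro R
    induction R with
    | zero => simp [drag, hc0]
    | succ R ih =>
      rw [Finset.prod_range_succ, drag]
      refine (mul_le_mul_of_nonneg_right ih (stepWeight_nonneg h0 h1 _ _)).trans ?_
      have := Finset.single_le_sum (f := fun c' => drag ρ lam.mult κ.mult μ.mult ν.mult R c' *
        if Conserves (lam.mult R) (κ.mult R) (μ.mult R) (ν.mult R) c' (c (R + 1)) then
          stepWeight ρ c' (c (R + 1)) else 0) (s := Finset.univ) (fun c' _ => by
            refine mul_nonneg (drag_nonneg h0 h1 _ _ _ _ _ _) ?_
            split_ifs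
            · exact stepWeight_nonneg h0 h1 _ _
            · exact le_rfl) (Finset.mem_univ (c R))
      simpa [hc R] using this
  have := key (columnBound κ lam μ ν)
  rwa [hcR _ le_rfl] at this

/-! ### Sampling the field -/

/-- The forward transition probabilities as a probability mass function. -/
noncomputable def uPMF (ρ : Set.Ico (0 : ℝ) 1) {N : ℕ} {κ lam : Signature N}
    {μ : Signature (N + 1)} (h : CntStep κ lam ∧ CntStep κ μ) : PMF (Signature (N + 1)) :=
  ⟨fun ν => ENNReal.ofReal (uZero ρ κ lam μ ν),
    tsum_uZero ρ.2.1 ρ.2.2 h.1 h.2 ▸ ENNReal.summable.hasSum⟩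

open Classical in
/-- The forward transition probabilities as a probability mass function (with an arbitrary value
for signatures which cannot appear around a face of the field). -/
noncomputable def samplePMF (ρ : Set.Ico (0 : ℝ) 1) {N : ℕ} (κ lam : Signature N)
    (μ : Signature (N + 1)) : PMF (Signature (N + 1)) :=
  if h : CntStep κ lam ∧ CntStep κ μ then uPMF ρ h else PMF.pure (zeroSig (N + 1))

theorem samplePMF_apply (ρ : Set.Ico (0 : ℝ) 1) {N : ℕ} {κ lam : Signature N}
    {μ : Signature (N + 1)} (h : CntStep κ lam ∧ CntStep κ μ) (ν : Signature (N + 1)) :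
    samplePMF ρ κ lam μ ν = ENNReal.ofReal (uZero ρ κ lam μ ν) := by
  unfold samplePMF
  rw [dif_pos h]
  rfl

/-- A point of the quadrant with possible values of the field at three corners of a face. -/
abbrev SampleIndex : Type := Σ q : ℕ × ℕ, Signature q.2 × Signature q.2 × Signature (q.2 + 1)

/-- For every face and all values of the field at three of its corners a value at the fourth. -/
abbrev SampleSpace : Type := ∀ i : SampleIndex, Signature (i.1.2 + 1)

/-- The values at the fourth corners are sampled independently. -/
noncomputable def sampleMeasure (ρ : Set.Ico (0 : ℝ) 1) : Measure SampleSpace :=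
  Measure.infinitePi fun i : SampleIndex =>
    (samplePMF ρ i.2.1 i.2.2.1 i.2.2.2).toMeasure

instance (ρ : Set.Ico (0 : ℝ) 1) : IsProbabilityMeasure (sampleMeasure ρ) := by
  unfold sampleMeasure
  infer_instance

/-- The field computed from the independent samples. -/
def sampleField : (x y : ℕ) → SampleSpace → Signature y
  | _, 0, _ => zeroSig 0
  | 0, y + 1, _ => zeroSig (y + 1)
  | x + 1, y + 1, ω =>
      ω ⟨(x, y), sampleField x y ω, sampleField (x + 1) y ω, sampleField x (y + 1) ω⟩
termination_by x y => x + y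

theorem sampleField_zero (y : ℕ) (ω : SampleSpace) : sampleField 0 y ω = zeroSig y := by
  cases y <;> simp [sampleField]

theorem sampleField_succ (x y : ℕ) (ω : SampleSpace) : sampleField (x + 1) (y + 1) ω =
    ω ⟨(x, y), sampleField x y ω, sampleField (x + 1) y ω, sampleField x (y + 1) ω⟩ := by
  rw [sampleField]

theorem measurable_sampleField (x y : ℕ) : Measurable (sampleField x y) := by
  induction h : x + y using Nat.strong_induction_on generalizing x y with
  | _ n ih =>
    subst h
    match x, y with
    | _, 0 => exact measurable_of_subsingleton_codomain _
    | 0, y + 1 =>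
      have : sampleField 0 (y + 1) = fun _ => zeroSig (y + 1) :=
        funext fun ω => sampleField_zero _ ω
      rw [this]
      exact measurable_const
    | x + 1, y + 1 =>
      have hA := ih (x + y) (by omega) x y rfl
      have hB := ih (x + 1 + y) (by omega) (x + 1) y rfl
      have hC := ih (x + (y + 1)) (by omega) x (y + 1) rfl
      refine measurable_to_countable' fun ν => ?_
      have : sampleField (x + 1) (y + 1) ⁻¹' {ν} =
          ⋃ t : Signature y × Signature y × Signature (y + 1),
            ((sampleField x y ⁻¹' {t.1} ∩ sampleField (x + 1) y ⁻¹' {t.2.1}) ∩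
              sampleField x (y + 1) ⁻¹' {t.2.2}) ∩ {ω | ω ⟨(x, y), t⟩ = ν} := by
        ext ω
        simp only [Set.mem_preimage, Set.mem_singleton_iff, sampleField_succ, Set.mem_iUnion,
          Set.mem_inter_iff, Set.mem_ofPred_eq, Prod.exists]
        constructor
        · intro h
          exact ⟨_, _, _, ⟨⟨rfl, rfl⟩, rfl⟩, h⟩
        · rintro ⟨a, b, c, ⟨⟨rfl, rfl⟩, rfl⟩, h⟩
          exact h
      rw [this]
      refine MeasurableSet.iUnion fun t => ?_
      refine (((hA (measurableSet_singleton _)).inter (hB (measurableSet_singleton _))).inter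
        (hC (measurableSet_singleton _))).inter ?_
      exact (measurable_pi_apply (X := fun i : SampleIndex => Signature (i.1.2 + 1))
        (⟨(x, y), t⟩ : SampleIndex)) (measurableSet_singleton ν)

section Cylinder

variable (D : Finset (ℕ × ℕ)) (hD : ∀ x y x' y', (x, y) ∈ D → x' ≤ x → y' ≤ y → (x', y') ∈ D)
  (a : (x y : ℕ) → Signature y) (ha : ∀ y, a 0 y = zeroSig y)

/-- The sample used at the face `q` if the field has the values `a`. -/
def faceIndex (q : ℕ × ℕ) : SampleIndex :=
  ⟨q, a q.1 q.2, a (q.1 + 1) q.2, a q.1 (q.2 + 1)⟩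

-- By induction on the coordinate sum, the corners that a face looks up lie on the boundary or
-- belong to earlier faces of `D`. Thus an event of the field becomes a condition on distinct
-- independent coordinates.
include hD ha in
theorem sampleField_eq_iff (ω : SampleSpace) :
    (∀ q ∈ D, sampleField (q.1 + 1) (q.2 + 1) ω = a (q.1 + 1) (q.2 + 1)) ↔
      ∀ q ∈ D, ω (faceIndex a q) = a (q.1 + 1) (q.2 + 1) := by
  have hcov : ∀ (x y : ℕ), (x, y) ∈ D →
      (∀ q ∈ D, q.1 + q.2 < x + y →
        sampleField (q.1 + 1) (q.2 + 1) ω = a (q.1 + 1) (q.2 + 1)) →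
      sampleField (x + 1) (y + 1) ω = ω (faceIndex a (x, y)) := by
    intro x y hxy h
    have h1 : sampleField x y ω = a x y := by
      match x, y with
      | _, 0 => exact Subsingleton.elim _ _
      | 0, y + 1 => rw [sampleField_zero, ha]
      | x + 1, y + 1 => exact h (x, y) (hD _ _ _ _ hxy (by omega) (by omega)) (by simp only; omega)
    have h2 : sampleField (x + 1) y ω = a (x + 1) y := by
      match y with
      | 0 => exact Subsingleton.elim _ _
      | y + 1 => exact h (x, y) (hD _ _ _ _ hxy (by omega) (by omega)) (by simp only; omega)
    have h3 : sampleField x (y + 1) ω = a x (y + 1) := by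
      match x with
      | 0 => rw [sampleField_zero, ha]
      | x + 1 => exact h (x, y) (hD _ _ _ _ hxy (by omega) (by omega)) (by simp only; omega)
    rw [sampleField_succ, h1, h2, h3]
    rfl
  constructor
  · rintro h ⟨x, y⟩ hq
    rw [← hcov x y hq fun q hq _ => h q hq]
    exact h _ hq
  · intro h
    suffices ∀ n, ∀ q ∈ D, q.1 + q.2 = n →
        sampleField (q.1 + 1) (q.2 + 1) ω = a (q.1 + 1) (q.2 + 1) from
      fun q hq => this _ q hq rfl
    intro n
    induction n using Nat.strong_induction_on with
    | _ n ih =>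
      rintro ⟨x, y⟩ hq hn
      rw [hcov x y hq fun q hq hlt => ih _ (by simp only at hn; omega) q hq rfl]
      exact h _ hq

-- The default value in `samplePMF` does no harm. At a face with minimal coordinate sum whose three
-- given corners do not interlace, the right product vanishes. If the left one did not vanish, the
-- earlier faces would have positive weight, and their interlacing together with the boundary values
-- would contradict the choice of the face.
include hD ha in
theorem prod_samplePMF (ρ : Set.Ico (0 : ℝ) 1) :
    ∏ q ∈ D, samplePMF ρ (a q.1 q.2) (a (q.1 + 1) q.2) (a q.1 (q.2 + 1))
        (a (q.1 + 1) (q.2 + 1)) =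
      ∏ q ∈ D, ENNReal.ofReal (uZero ρ (a q.1 q.2) (a (q.1 + 1) q.2) (a q.1 (q.2 + 1))
        (a (q.1 + 1) (q.2 + 1))) := by
  by_cases hall : ∀ q ∈ D, CntStep (a q.1 q.2) (a (q.1 + 1) q.2) ∧
      CntStep (a q.1 q.2) (a q.1 (q.2 + 1))
  · exact Finset.prod_congr rfl fun q hq => samplePMF_apply ρ (hall q hq) _
  · have hex : ∃ n, ∃ q ∈ D, q.1 + q.2 = n ∧ ¬ (CntStep (a q.1 q.2) (a (q.1 + 1) q.2) ∧
        CntStep (a q.1 q.2) (a q.1 (q.2 + 1))) := by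
      push Not at hall
      obtain ⟨q, hq, h⟩ := hall
      exact ⟨_, q, hq, rfl, fun h' => h h'.1 h'.2⟩
    classical
    obtain ⟨⟨x, y⟩, hq, hn, hbad⟩ := Nat.find_spec hex
    have hmin : ∀ q ∈ D, q.1 + q.2 < x + y → CntStep (a q.1 q.2) (a (q.1 + 1) q.2) ∧
        CntStep (a q.1 q.2) (a q.1 (q.2 + 1)) := by
      intro q hq' hlt
      by_contra hc
      exact Nat.find_min hex (by rw [← hn]; exact hlt) ⟨q, hq', rfl, hc⟩
    have hR : ∏ q ∈ D, ENNReal.ofReal (uZero ρ (a q.1 q.2) (a (q.1 + 1) q.2) (a q.1 (q.2 + 1))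
        (a (q.1 + 1) (q.2 + 1))) = 0 := by
      refine Finset.prod_eq_zero hq ?_
      by_contra hc
      have : uZero ρ (a x y) (a (x + 1) y) (a x (y + 1)) (a (x + 1) (y + 1)) ≠ 0 := by
        intro h
        simp [h] at hc
      have := uZero_ne_zero this
      exact hbad ⟨this.1, this.2.1⟩
    rw [hR]
    by_contra hL
    rw [← ne_eq, Finset.prod_ne_zero_iff] at hL
    have hprev : ∀ q ∈ D, q.1 + q.2 < x + y →
        CntStep (a (q.1 + 1) q.2) (a (q.1 + 1) (q.2 + 1)) ∧
          CntStep (a q.1 (q.2 + 1)) (a (q.1 + 1) (q.2 + 1)) := by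
      intro q hq' hlt
      have h1 := hL q hq'
      rw [samplePMF_apply ρ (hmin q hq' hlt)] at h1
      have : uZero ρ (a q.1 q.2) (a (q.1 + 1) q.2) (a q.1 (q.2 + 1)) (a (q.1 + 1) (q.2 + 1))
          ≠ 0 := by
        intro h
        simp [h] at h1
      exact (uZero_ne_zero this).2.2
    refine hbad ⟨?_, ?_⟩
    · match y with
      | 0 =>
        simp only
        rw [Subsingleton.elim (a (x + 1) 0) (a x 0)]
        exact CntStep.refl _
      | y + 1 =>
        exact (hprev (x, y) (hD _ _ _ _ hq (by omega) (by omega)) (by simp only; omega)).2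
    · match x with
      | 0 =>
        simp only [ha]
        exact cntStep_zeroSig y
      | x + 1 =>
        exact (hprev (x, y) (hD _ _ _ _ hq (by omega) (by omega)) (by simp only; omega)).1

include hD ha in
/-- The law of the field on a set of faces which is closed downwards. -/
theorem sampleMeasure_cylinder (ρ : Set.Ico (0 : ℝ) 1) :
    (sampleMeasure ρ).real
        {ω | ∀ q ∈ D, sampleField (q.1 + 1) (q.2 + 1) ω = a (q.1 + 1) (q.2 + 1)} =
      ∏ q ∈ D, uZero ρ (a q.1 q.2) (a (q.1 + 1) q.2) (a q.1 (q.2 + 1))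
        (a (q.1 + 1) (q.2 + 1)) := by
  have hinj : Function.Injective (faceIndex a) := fun q q' h => congrArg Sigma.fst h
  have hset : {ω : SampleSpace | ∀ q ∈ D,
      sampleField (q.1 + 1) (q.2 + 1) ω = a (q.1 + 1) (q.2 + 1)} =
      Set.pi (↑(D.map ⟨faceIndex a, hinj⟩) : Set SampleIndex)
        fun i => ({a (i.1.1 + 1) (i.1.2 + 1)} : Set (Signature (i.1.2 + 1))) := by
    ext ω
    rw [Set.mem_ofPred_eq, sampleField_eq_iff D hD a ha]
    simp only [Set.mem_pi, Finset.mem_coe, Finset.mem_map, Function.Embedding.coeFn_mk,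
      Set.mem_singleton_iff]
    constructor
    · rintro h i ⟨q, hq, rfl⟩
      exact h q hq
    · intro h q hq
      exact h _ ⟨q, hq, rfl⟩
  rw [hset, Measure.real, sampleMeasure, Measure.infinitePi_pi _
    (fun i _ => measurableSet_singleton _), Finset.prod_map]
  have : ∀ q ∈ D, (samplePMF ρ (a q.1 q.2) (a (q.1 + 1) q.2) (a q.1 (q.2 + 1))).toMeasure
      {a (q.1 + 1) (q.2 + 1)} = samplePMF ρ (a q.1 q.2) (a (q.1 + 1) q.2) (a q.1 (q.2 + 1))
        (a (q.1 + 1) (q.2 + 1)) := fun q _ =>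
    PMF.toMeasure_apply_singleton _ _ (measurableSet_singleton _)
  refine (congrArg ENNReal.toReal
    ((Finset.prod_congr rfl this).trans (prod_samplePMF D hD a ha ρ))).trans ?_
  rw [ENNReal.toReal_prod]
  exact Finset.prod_congr rfl fun q _ =>
    ENNReal.toReal_ofReal (uZero_nonneg ρ.2.1 ρ.2.2.le _ _ _ _)

end Cylinder

/-- The faces whose corner closest to the origin has coordinate sum less than `n`. -/
def triangle (n : ℕ) : Finset (ℕ × ℕ) :=
  (Finset.range n ×ˢ Finset.range n).filter fun q => q.1 + q.2 < n

theorem mem_triangle {n : ℕ} {q : ℕ × ℕ} : q ∈ triangle n ↔ q.1 + q.2 < n := by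
  simp only [triangle, Finset.mem_filter, Finset.mem_product, Finset.mem_range]
  omega

theorem prod_triangle_succ {α : Type*} [CommMonoid α] (n : ℕ) (f : ℕ × ℕ → α) :
    ∏ q ∈ triangle (n + 1), f q =
      (∏ q ∈ triangle n, f q) * ∏ q ∈ Finset.HasAntidiagonal.antidiagonal n, f q := by
  rw [← Finset.prod_union]
  · refine Finset.prod_congr ?_ fun _ _ => rfl
    ext q
    simp only [Finset.mem_union, mem_triangle, Finset.HasAntidiagonal.mem_antidiagonal]
    omega
  · rw [Finset.disjoint_left]
    intro q
    simp only [mem_triangle, Finset.HasAntidiagonal.mem_antidiagonal]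
    omega

theorem sampleField_triangle_iff (n : ℕ) (a : (x y : ℕ) → Signature y)
    (ha : ∀ y, a 0 y = zeroSig y) (ω : SampleSpace) :
    (∀ x y, x + y ≤ n + 1 → sampleField x y ω = a x y) ↔
      ∀ q ∈ triangle n, sampleField (q.1 + 1) (q.2 + 1) ω = a (q.1 + 1) (q.2 + 1) := by
  constructor
  · intro h q hq
    rw [mem_triangle] at hq
    exact h _ _ (by omega)
  · intro h x y hxy
    match x, y with
    | _, 0 => exact Subsingleton.elim _ _
    | 0, y + 1 => rw [sampleField_zero, ha]
    | x + 1, y + 1 => exact h (x, y) (mem_triangle.2 (by simp only; omega))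

theorem isYangBaxterField_sampleField {u v : ℝ} (hu : 0 < u) (huv : u < v)
    (ρ : Set.Ico (0 : ℝ) 1) (hρ : (ρ : ℝ) = u / v) :
    IsYangBaxterField 0 0 (fun _ => v) (fun _ => u) (sampleMeasure ρ) sampleField where
  measurable := measurable_sampleField
  boundary y := Eventually.of_forall fun ω => sampleField_zero y ω
  sample n a ha := by
    simp only [sampleField_triangle_iff _ a ha, uFwd_eq_uZero hu huv, ← hρ]
    have hlow : ∀ n x y x' y', (x, y) ∈ triangle n → x' ≤ x → y' ≤ y → (x', y') ∈ triangle n := by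
      intro n x y x' y' h h1 h2
      rw [mem_triangle] at h ⊢
      simp only at h ⊢
      omega
    rw [sampleMeasure_cylinder _ (hlow _) a ha, sampleMeasure_cylinder _ (hlow _) a ha,
      prod_triangle_succ]

/-! ### The law of a Yang-Baxter field -/

section Law

variable {t s : ℝ} {v u : ℕ → ℝ} {Ω : Type*} [MeasurableSpace Ω] {P : Measure Ω}
  [IsProbabilityMeasure P] {Λ : (x y : ℕ) → Ω → Signature y}
  {Ω' : Type*} [MeasurableSpace Ω'] {P' : Measure Ω'}
  [IsProbabilityMeasure P'] {Λ' : (x y : ℕ) → Ω' → Signature y}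

theorem IsYangBaxterField.triangle_law (h : IsYangBaxterField t s v u P Λ) (n : ℕ)
    (a : (x y : ℕ) → Signature y) (ha : ∀ y, a 0 y = zeroSig y) :
    P.real {ω | ∀ x y, x + y ≤ n + 1 → Λ x y ω = a x y} =
      ∏ q ∈ triangle n, uFwd t s (v (q.1 + 1)) (u (q.2 + 1)) (a q.1 q.2) (a (q.1 + 1) q.2)
        (a q.1 (q.2 + 1)) (a (q.1 + 1) (q.2 + 1)) := by
  induction n with
  | zero =>
    have : P.real {ω | ∀ x y, x + y ≤ 0 + 1 → Λ x y ω = a x y} = P.real Set.univ := by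
      refine measureReal_congr ?_
      filter_upwards [h.boundary 1] with ω hω
      refine propext ⟨fun _ => trivial, fun _ x y hxy => ?_⟩
      match x, y with
      | _, 0 => exact Subsingleton.elim _ _
      | 0, 1 => rw [hω, ha]
      | 0, y + 2 => omega
      | x + 1, y + 1 => omega
    rw [this]
    simp [triangle]
  | succ n ih => rw [h.sample n a ha, ih, prod_triangle_succ]

/-- The values of the field at the points with coordinate sum at most `n`. -/
def triangleValues (Λ : (x y : ℕ) → Ω → Signature y) (n : ℕ) (ω : Ω) :
    ∀ p : {p : ℕ × ℕ // p.1 + p.2 ≤ n}, Signature p.1.2 :=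
  fun p => Λ p.1.1 p.1.2 ω

theorem finite_triangle_points (n : ℕ) : Finite {p : ℕ × ℕ // p.1 + p.2 ≤ n} :=
  Finite.of_injective (β := Finset.range (n + 1) ×ˢ Finset.range (n + 1) |>.attach)
    (fun p => ⟨⟨p.1, by have := p.2; simp; omega⟩, Finset.mem_attach _ _⟩) fun p q h => by
      simpa [Subtype.ext_iff] using h

/-- Extension of values on a triangle to the whole quadrant. -/
def extendValues {n : ℕ} (z : ∀ p : {p : ℕ × ℕ // p.1 + p.2 ≤ n}, Signature p.1.2) (x y : ℕ) :
    Signature y :=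
  if h : x + y ≤ n then z ⟨(x, y), h⟩ else zeroSig y

open Classical in
theorem IsYangBaxterField.triangleValues_singleton (h : IsYangBaxterField t s v u P Λ) (n : ℕ)
    (z : ∀ p : {p : ℕ × ℕ // p.1 + p.2 ≤ n + 1}, Signature p.1.2) :
    P.real (triangleValues Λ (n + 1) ⁻¹' {z}) =
      if ∀ y, extendValues z 0 y = zeroSig y then
        ∏ q ∈ triangle n, uFwd t s (v (q.1 + 1)) (u (q.2 + 1)) (extendValues z q.1 q.2)
          (extendValues z (q.1 + 1) q.2) (extendValues z q.1 (q.2 + 1))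
          (extendValues z (q.1 + 1) (q.2 + 1))
      else 0 := by
  have hset : triangleValues Λ (n + 1) ⁻¹' {z} =
      {ω | ∀ x y, x + y ≤ n + 1 → Λ x y ω = extendValues z x y} := by
    ext ω
    simp only [Set.mem_preimage, Set.mem_singleton_iff, Set.mem_ofPred_eq]
    constructor
    · rintro rfl x y hxy
      rw [extendValues, dif_pos hxy]
      rfl
    · intro h
      funext p
      have := h p.1.1 p.1.2 p.2
      rw [extendValues, dif_pos p.2] at this
      exact this
  rw [hset]
  split_ifs with hz
  · exact h.triangle_law n _ hz
  · push Not at hz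
    obtain ⟨y, hy⟩ := hz
    rw [measureReal_eq_zero_iff, ← nonpos_iff_eq_zero]
    refine (measure_mono fun ω hω => ?_).trans_eq (h.boundary y)
    intro hω'
    apply hy
    by_cases hyn : 0 + y ≤ n + 1
    · rw [← hω 0 y hyn]
      exact hω'
    · rw [extendValues, dif_neg hyn]

/-- Two Yang-Baxter fields with the same parameters have the same law. -/
theorem IsYangBaxterField.measure_eq (h : IsYangBaxterField t s v u P Λ)
    (h' : IsYangBaxterField t s v u P' Λ') (n : ℕ)
    (A : Set (∀ p : {p : ℕ × ℕ // p.1 + p.2 ≤ n + 1}, Signature p.1.2)) :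
    P.real (triangleValues Λ (n + 1) ⁻¹' A) = P'.real (triangleValues Λ' (n + 1) ⁻¹' A) := by
  have := finite_triangle_points (n + 1)
  have hm : Measurable (triangleValues Λ (n + 1)) := measurable_pi_lambda _ fun p =>
    h.measurable _ _
  have hm' : Measurable (triangleValues Λ' (n + 1)) := measurable_pi_lambda _ fun p =>
    h'.measurable _ _
  have hA : MeasurableSet A := A.to_countable.measurableSet
  rw [Measure.real, Measure.real, ← Measure.map_apply hm hA, ← Measure.map_apply hm' hA]
  congr 2
  refine Measure.ext_of_singleton fun z => ?_
  rw [Measure.map_apply hm (measurableSet_singleton z),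
    Measure.map_apply hm' (measurableSet_singleton z), ← measureReal_eq_measureReal_iff,
    h.triangleValues_singleton, h'.triangleValues_singleton]

/-- The law of the values at the points `(x, y)` with `x ≤ X` and `y ≤ M`. -/
theorem IsYangBaxterField.rectangle_law {u v : ℝ} (hu : 0 < u) (huv : u < v)
    (h : IsYangBaxterField 0 0 (fun _ => v) (fun _ => u) P Λ) (X M : ℕ)
    (a : (x y : ℕ) → Signature y) (ha : ∀ y, a 0 y = zeroSig y) :
    P.real {ω | ∀ x ≤ X, ∀ y ≤ M, Λ x y ω = a x y} =
      ∏ x ∈ Finset.range X, ∏ y ∈ Finset.range M,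
        uZero (u / v) (a x y) (a (x + 1) y) (a x (y + 1)) (a (x + 1) (y + 1)) := by
  have hv : 0 < v := hu.trans huv
  obtain ⟨ρ, hρ⟩ : ∃ ρ : Set.Ico (0 : ℝ) 1, (ρ : ℝ) = u / v :=
    ⟨⟨u / v, by positivity, (div_lt_one hv).2 huv⟩, rfl⟩
  -- The definition of the field only speaks of triangles. Instead of summing out the points outside
  -- the rectangle, the event is transferred to the sampled field, whose law is known on every
  -- downward closed set of faces.
  have h' := isYangBaxterField_sampleField hu huv ρ hρ
  have e : ∀ ω, (∀ x ≤ X, ∀ y ≤ M, Λ x y ω = a x y) ↔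
      triangleValues Λ (X + M + 1) ω ∈ {z | ∀ x ≤ X, ∀ y ≤ M, extendValues z x y = a x y} := by
    intro ω
    refine forall₂_congr fun x hx => forall₂_congr fun y hy => ?_
    rw [extendValues, dif_pos (by omega)]
    rfl
  have e' : ∀ ω, triangleValues sampleField (X + M + 1) ω ∈
      {z | ∀ x ≤ X, ∀ y ≤ M, extendValues z x y = a x y} ↔
        ∀ q ∈ Finset.range X ×ˢ Finset.range M,
          sampleField (q.1 + 1) (q.2 + 1) ω = a (q.1 + 1) (q.2 + 1) := by
    intro ω
    have : ∀ x ≤ X, ∀ y ≤ M, extendValues (triangleValues sampleField (X + M + 1) ω) x y =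
        sampleField x y ω := by
      intro x hx y hy
      rw [extendValues, dif_pos (by omega)]
      rfl
    constructor
    · intro hz q hq
      rw [Finset.mem_product, Finset.mem_range, Finset.mem_range] at hq
      rw [← this _ (by omega) _ (by omega)]
      exact hz _ (by omega) _ (by omega)
    · intro hq x hx y hy
      rw [this x hx y hy]
      match x, y with
      | _, 0 => exact Subsingleton.elim _ _
      | 0, y + 1 => rw [sampleField_zero, ha]
      | x + 1, y + 1 =>
        exact hq (x, y) (by rw [Finset.mem_product, Finset.mem_range, Finset.mem_range]; omega)
  simp only [e]
  refine (h.measure_eq h' (X + M) _).trans ?_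
  rw [← Finset.prod_product', ← hρ]
  have := sampleMeasure_cylinder (Finset.range X ×ˢ Finset.range M) (fun x y x' y' hq hx hy => by
    rw [Finset.mem_product, Finset.mem_range, Finset.mem_range] at hq ⊢
    simp only at hq ⊢
    omega) a ha ρ
  rw [← this]
  congr 1
  ext ω
  exact e' ω

end Law

/-! ### Finite-dimensional distributions of Markov chains -/

open Classical in
/-- The `m`-step transition probabilities. -/
noncomputable def kernelPow {S : Type*} (K : S → S → ENNReal) : ℕ → S → S → ENNReal
  | 0, a, b => if a = b then 1 else 0
  | m + 1, a, b => ∑' c, kernelPow K m a c * K c b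

section Markov

variable {Ω S : Type*} [MeasurableSpace Ω] {P : Measure Ω} [Countable S]
  {Ev : ℕ → S → Set Ω} {K : S → S → ENNReal}

/-- The event that the chain is in `T i` at the times `i < j` and in `g i` at the times
`i = j, ..., x`. -/
def pathEvent (Ev : ℕ → S → Set Ω) (T : ℕ → Set S) (j x : ℕ) (g : ℕ → S) : Set Ω :=
  {ω | (∀ i < j, ∃ s ∈ T i, ω ∈ Ev i s) ∧ ∀ i, j ≤ i → i ≤ x → ω ∈ Ev i (g i)}

omit [MeasurableSpace Ω] [Countable S] in
theorem pathEvent_succ (T : ℕ → Set S) {j x : ℕ} (hj : j < x) (g : ℕ → S) :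
    pathEvent Ev T (j + 1) x g = ⋃ s : T j, pathEvent Ev T j x (Function.update g j s.1) := by
  ext ω
  simp only [pathEvent, Set.mem_ofPred_eq, Set.mem_iUnion]
  constructor
  · rintro ⟨h1, h2⟩
    obtain ⟨s, hs, hω⟩ := h1 j (by omega)
    refine ⟨⟨s, hs⟩, fun i hi => h1 i (by omega), fun i hi hx => ?_⟩
    by_cases hij : i = j
    · subst hij; simpa using hω
    · rw [Function.update_of_ne hij]
      exact h2 i (by omega) hx
  · rintro ⟨s, h1, h2⟩
    refine ⟨fun i hi => ?_, fun i hi hx => ?_⟩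
    · by_cases hij : i = j
      · subst hij
        exact ⟨s.1, s.2, by simpa using h2 i le_rfl (by omega)⟩
      · exact h1 i (by omega)
    · have := h2 i (by omega) hx
      rwa [Function.update_of_ne (by omega)] at this

theorem measurableSet_pathEvent (hmeas : ∀ x s, MeasurableSet (Ev x s)) (T : ℕ → Set S)
    (j x : ℕ) (g : ℕ → S) : MeasurableSet (pathEvent Ev T j x g) := by
  have : pathEvent Ev T j x g = (⋂ i, ⋂ (_ : i < j), ⋃ s : T i, Ev i s.1) ∩
      ⋂ i, ⋂ (_ : j ≤ i), ⋂ (_ : i ≤ x), Ev i (g i) := by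
    ext ω
    simp [pathEvent]
  rw [this]
  exact (MeasurableSet.iInter fun i => MeasurableSet.iInter fun _ =>
    MeasurableSet.iUnion fun s => hmeas _ _).inter
    (MeasurableSet.iInter fun i => MeasurableSet.iInter fun _ => MeasurableSet.iInter fun _ =>
      hmeas _ _)

theorem measure_pathEvent_succ (hmeas : ∀ x s, MeasurableSet (Ev x s))
    (hdisj : ∀ x s s' ω, ω ∈ Ev x s → ω ∈ Ev x s' → s = s') (T : ℕ → Set S) {j x : ℕ}
    (hj : j < x) (g : ℕ → S) :
    P (pathEvent Ev T (j + 1) x g) =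
      ∑' s : T j, P (pathEvent Ev T j x (Function.update g j s.1)) := by
  rw [pathEvent_succ T hj, measure_iUnion]
  · intro s s' hss
    rw [Function.onFun, Set.disjoint_left]
    intro ω h1 h2
    apply hss
    apply Subtype.ext
    refine hdisj j _ _ ω ?_ ?_
    · simpa using h1.2 j le_rfl hj.le
    · simpa using h2.2 j le_rfl hj.le
  · exact fun s => measurableSet_pathEvent hmeas _ _ _ _

/-- For `j = 0` the whole trajectory is prescribed. Relaxing the condition at a time before `x` sums
over disjoint events and does not affect the factor `K (g x) (g (x + 1))`. -/
theorem measure_pathEvent_step (hmeas : ∀ x s, MeasurableSet (Ev x s))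
    (hdisj : ∀ x s s' ω, ω ∈ Ev x s → ω ∈ Ev x s' → s = s')
    (hstep : ∀ (x : ℕ) (g : ℕ → S), P {ω | ∀ i ≤ x + 1, ω ∈ Ev i (g i)} =
      P {ω | ∀ i ≤ x, ω ∈ Ev i (g i)} * K (g x) (g (x + 1)))
    (T : ℕ → Set S) {j x : ℕ} (hj : j ≤ x) (g : ℕ → S) :
    P (pathEvent Ev T j (x + 1) g) = P (pathEvent Ev T j x g) * K (g x) (g (x + 1)) := by
  induction j generalizing g with
  | zero => simpa [pathEvent] using hstep x g
  | succ j ih =>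
    rw [measure_pathEvent_succ hmeas hdisj T (by omega),
      measure_pathEvent_succ hmeas hdisj T (by omega), ← ENNReal.tsum_mul_right]
    refine tsum_congr fun s => ?_
    rw [ih (by omega), Function.update_of_ne (by omega), Function.update_of_ne (by omega)]

variable {t : ℕ → ℕ} {a : ℕ → S}

/-- The Markov property for events at finitely many times. -/
theorem measure_event_step (hmeas : ∀ x s, MeasurableSet (Ev x s))
    (hdisj : ∀ x s s' ω, ω ∈ Ev x s → ω ∈ Ev x s' → s = s')
    (hcover : ∀ x, ∀ᵐ ω ∂P, ∃ s, ω ∈ Ev x s)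
    (hstep : ∀ (x : ℕ) (g : ℕ → S), P {ω | ∀ i ≤ x + 1, ω ∈ Ev i (g i)} =
      P {ω | ∀ i ≤ x, ω ∈ Ev i (g i)} * K (g x) (g (x + 1)))
    (n x : ℕ) (hx : ∀ l ≤ n, t l ≤ x) (b : S) :
    P {ω | (∀ l ≤ n, ω ∈ Ev (t l) (a l)) ∧ ω ∈ Ev (x + 1) b} =
      ∑' c, P {ω | (∀ l ≤ n, ω ∈ Ev (t l) (a l)) ∧ ω ∈ Ev x c} * K c b := by
  set G : Set Ω := {ω | ∀ l ≤ n, ω ∈ Ev (t l) (a l)} with hG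
  have hGm : MeasurableSet G := by
    have : G = ⋂ l, ⋂ (_ : l ≤ n), Ev (t l) (a l) := by ext ω; simp [hG]
    rw [this]
    exact MeasurableSet.iInter fun l => MeasurableSet.iInter fun _ => hmeas _ _
  have h1 : P (G ∩ Ev (x + 1) b) = ∑' c, P ((G ∩ Ev x c) ∩ Ev (x + 1) b) := by
    rw [← measure_iUnion]
    · refine measure_congr ?_
      filter_upwards [hcover x] with ω hω
      obtain ⟨s, hs⟩ := hω
      refine propext ⟨fun h => ?_, fun h => ?_⟩
      · exact Set.mem_iUnion.2 ⟨s, ⟨h.1, hs⟩, h.2⟩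
      · obtain ⟨c, hc⟩ := Set.mem_iUnion.1 h
        exact ⟨hc.1.1, hc.2⟩
    · intro c c' hcc
      rw [Function.onFun, Set.disjoint_left]
      intro ω h1 h2
      exact hcc (hdisj x _ _ ω h1.1.2 h2.1.2)
    · exact fun c => (hGm.inter (hmeas _ _)).inter (hmeas _ _)
  refine h1.trans (tsum_congr fun c => ?_)
  -- `T i` collects the states allowed at time `i`; it is everything if `i` is none of the observed
  -- times, and empty if two observations contradict each other.
  set T : ℕ → Set S := fun i => {s | ∀ l ≤ n, t l = i → s = a l} with hT
  have key : ∀ᵐ ω ∂P, ω ∈ G ∩ Ev x c ↔ c ∈ T x ∧ ω ∈ pathEvent Ev T x x fun _ => c := by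
    filter_upwards [ae_all_iff.2 hcover] with ω hω
    constructor
    · rintro ⟨h, hc⟩
      refine ⟨fun l hl hlx => ?_, fun i hi => ?_, fun i hi hix => ?_⟩
      · exact hdisj x _ _ ω hc (hlx ▸ h l hl)
      · obtain ⟨s, hs⟩ := hω i
        exact ⟨s, fun l hl hli => hdisj i _ _ ω hs (hli ▸ h l hl), hs⟩
      · obtain rfl : i = x := by omega
        exact hc
    · rintro ⟨hcT, h2, h3⟩
      refine ⟨fun l hl => ?_, h3 x le_rfl le_rfl⟩
      rcases (hx l hl).lt_or_eq with hlt | heq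
      · obtain ⟨s, hs, hsω⟩ := h2 _ hlt
        rw [← hs l hl rfl]
        exact hsω
      · rw [← hcT l hl heq, heq]
        exact h3 x le_rfl le_rfl
  by_cases hcT : c ∈ T x
  -- Only the values at `x` and `x + 1` of this trajectory matter.
  · have e1 : P (G ∩ Ev x c) = P (pathEvent Ev T x x fun i => if i = x then c else b) := by
      refine measure_congr ?_
      filter_upwards [key] with ω hω
      refine propext (hω.trans ?_)
      simp only [hcT, true_and]
      refine and_congr_right fun _ => forall_congr' fun i => forall₂_congr fun h h' => ?_
      change ω ∈ Ev i c ↔ ω ∈ Ev i (if i = x then c else b)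
      rw [if_pos (le_antisymm h' h)]
    have e2 : P ((G ∩ Ev x c) ∩ Ev (x + 1) b) =
        P (pathEvent Ev T x (x + 1) fun i => if i = x then c else b) := by
      refine measure_congr ?_
      filter_upwards [key] with ω hω
      refine propext ((and_congr_left fun _ => hω).trans ?_)
      simp only [hcT, true_and]
      constructor
      · rintro ⟨⟨h1, h2⟩, h3⟩
        refine ⟨h1, fun i hi hix => ?_⟩
        by_cases hi' : i = x
        · subst hi'
          simpa using h2 i le_rfl le_rfl
        · obtain rfl : i = x + 1 := by omega
          simpa using h3
      · rintro ⟨h1, h2⟩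
        refine ⟨⟨h1, fun i hi hix => ?_⟩, ?_⟩
        · simpa [le_antisymm hix hi] using h2 x le_rfl (by omega)
        · simpa using h2 (x + 1) (by omega) le_rfl
    rw [e2, measure_pathEvent_step hmeas hdisj hstep T le_rfl, ← e1]
    simp only [if_true, Nat.succ_ne_self, if_false]
    rfl
  · have e : P (G ∩ Ev x c) = 0 := by
      rw [measure_eq_zero_iff_ae_notMem]
      filter_upwards [key] with ω hω h
      exact hcT (hω.1 h).1
    have e2 : P ((G ∩ Ev x c) ∩ Ev (x + 1) b) = 0 := measure_mono_null Set.inter_subset_left e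
    rw [e2]
    exact (by rw [show P {ω | (∀ l ≤ n, ω ∈ Ev (t l) (a l)) ∧ ω ∈ Ev x c} = 0 from e, zero_mul])

/-- The finite-dimensional distributions of a Markov chain. -/
theorem measure_event_eq_prod (hmeas : ∀ x s, MeasurableSet (Ev x s))
    (hdisj : ∀ x s s' ω, ω ∈ Ev x s → ω ∈ Ev x s' → s = s')
    (hcover : ∀ x, ∀ᵐ ω ∂P, ∃ s, ω ∈ Ev x s)
    (hstep : ∀ (x : ℕ) (g : ℕ → S), P {ω | ∀ i ≤ x + 1, ω ∈ Ev i (g i)} =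
      P {ω | ∀ i ≤ x, ω ∈ Ev i (g i)} * K (g x) (g (x + 1)))
    (ht : Monotone t) (h0 : P (Ev (t 0) (a 0)) = 1) (n : ℕ) :
    P {ω | ∀ l ≤ n, ω ∈ Ev (t l) (a l)} =
      ∏ j ∈ Finset.range n, kernelPow K (t (j + 1) - t j) (a j) (a (j + 1)) := by
  classical
  induction n with
  | zero => simpa using h0
  | succ n ih =>
    have key : ∀ m b, P {ω | (∀ l ≤ n, ω ∈ Ev (t l) (a l)) ∧ ω ∈ Ev (t n + m) b} =
        P {ω | ∀ l ≤ n, ω ∈ Ev (t l) (a l)} * kernelPow K m (a n) b := by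
      intro m
      induction m with
      | zero =>
        intro b
        rw [kernelPow, add_zero]
        by_cases hb : a n = b
        · subst hb
          rw [if_pos rfl, mul_one]
          congr 1
          ext ω
          exact ⟨fun h => h.1, fun h => ⟨h, h n le_rfl⟩⟩
        · rw [if_neg hb, mul_zero]
          rw [← measure_empty (μ := P)]
          congr 1
          ext ω
          simp only [Set.mem_ofPred_eq, Set.mem_empty_iff_false, iff_false]
          rintro ⟨h1, h2⟩
          exact hb (hdisj _ _ _ ω (h1 n le_rfl) h2)
      | succ m ihm =>
        intro b
        rw [← add_assoc, measure_event_step hmeas hdisj hcover hstep n (t n + m)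
          (fun l hl => (ht hl).trans le_self_add), kernelPow, ← ENNReal.tsum_mul_left]
        refine tsum_congr fun c => ?_
        rw [ihm, mul_assoc]
    rw [Finset.prod_range_succ, ← ih, ← key, Nat.add_sub_cancel' (ht (Nat.le_succ n))]
    congr 1
    ext ω
    simp only [Set.mem_ofPred_eq]
    constructor
    · exact fun h => ⟨fun l hl => h l (by omega), h _ le_rfl⟩
    · rintro ⟨h1, h2⟩ l hl
      rcases hl.lt_or_eq with h | rfl
      · exact h1 l (by omega)
      · exact h2

end Markov

/-! ### The rows of the field as a Markov chain on interlacing arrays -/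

/-- The transition probabilities from one column of the quadrant to the next one. -/
noncomputable def arrayKernel (ρ : ℝ) {M : ℕ} (a b : InterlacingArray M) : ℝ :=
  ∏ k : Fin M, uZero ρ (a.level k k.2.le) (b.level k k.2.le) (a.level (k + 1) k.2)
    (b.level (k + 1) k.2)

theorem arrayKernel_nonneg {ρ : ℝ} (h0 : 0 ≤ ρ) (h1 : ρ ≤ 1) {M : ℕ}
    (a b : InterlacingArray M) : 0 ≤ arrayKernel ρ a b :=
  Finset.prod_nonneg fun _ _ => uZero_nonneg h0 h1 _ _ _ _

instance (M : ℕ) : Countable (InterlacingArray M) := by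
  refine Function.Injective.countable (β := ∀ k : Fin (M + 1), Signature k)
    (f := fun a k => a.level k (Nat.lt_succ_iff.1 k.2)) fun a b h => ?_
  ext k hk : 3
  exact congrFun h ⟨k, Nat.lt_succ_of_le hk⟩

/-- The signatures of an array, extended by packed signatures. -/
def InterlacingArray.extend {M : ℕ} (a : InterlacingArray M) (y : ℕ) : Signature y :=
  if h : y ≤ M then a.level y h else zeroSig y

theorem InterlacingArray.extend_eq {M : ℕ} (a : InterlacingArray M) {y : ℕ} (h : y ≤ M) :
    a.extend y = a.level y h := dif_pos h

section Rows

variable {u v : ℝ} (hu : 0 < u) (huv : u < v) {Ω : Type*} [MeasurableSpace Ω] {P : Measure Ω}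
  [IsProbabilityMeasure P] {Λ : (x y : ℕ) → Ω → Signature y}

-- Only countably many patterns of values on a triangle violate interlacing. Each is null because
-- the rectangle law contains the factor of the face whose fourth corner is `(x, k + 1)`; in column
-- `0` no such pattern exists. This makes `InterlacingArray` a state space for the columns.
include hu huv in
theorem IsYangBaxterField.ae_interlaces
    (h : IsYangBaxterField 0 0 (fun _ => v) (fun _ => u) P Λ) (x k : ℕ) :
    ∀ᵐ ω ∂P, Interlaces (Λ x k ω) (Λ x (k + 1) ω) := by
  have := finite_triangle_points (x + k + 1)
  have hnull : ∀ z : {z : ∀ p : {p : ℕ × ℕ // p.1 + p.2 ≤ x + k + 1}, Signature p.1.2 //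
      (∀ y, extendValues z 0 y = zeroSig y) ∧
        ¬ Interlaces (extendValues z x k) (extendValues z x (k + 1))},
      ∀ᵐ ω ∂P, ¬ ∀ x' ≤ x, ∀ y ≤ k + 1, Λ x' y ω = extendValues z.1 x' y := by
    intro z
    rw [ae_iff]
    simp only [not_not]
    rw [← measureReal_eq_zero_iff, h.rectangle_law hu huv _ _ _ z.2.1]
    match x, z with
    | 0, z =>
      exfalso
      apply z.2.2
      rw [interlaces_iff_cntStep, z.2.1, z.2.1]
      exact cntStep_zeroSig k
    | x + 1, z =>
      refine Finset.prod_eq_zero (Finset.mem_range.2 (Nat.lt_succ_self x)) ?_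
      refine Finset.prod_eq_zero (Finset.mem_range.2 (Nat.lt_succ_self k)) ?_
      by_contra hc
      exact z.2.2 ((interlaces_iff_cntStep _ _).2 (uZero_ne_zero hc).2.2.1)
  filter_upwards [ae_all_iff.2 hnull, ae_all_iff.2 h.boundary] with ω hω hb
  by_contra hc
  have e : ∀ x' y, x' + y ≤ x + k + 1 →
      extendValues (triangleValues Λ (x + k + 1) ω) x' y = Λ x' y ω := by
    intro x' y hxy
    rw [extendValues, dif_pos hxy]
    rfl
  refine hω ⟨triangleValues Λ (x + k + 1) ω, fun y => ?_, ?_⟩ fun x' hx y hy =>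
    (e x' y (by omega)).symm
  · by_cases hy : 0 + y ≤ x + k + 1
    · rw [e _ _ hy, hb]
    · rw [extendValues, dif_neg hy]
  · rw [e _ _ (by omega), e _ _ (by omega)]
    exact hc

/-- The event that the signatures in column `x` form a given array. -/
def columnEvent {M : ℕ} (Λ : (x y : ℕ) → Ω → Signature y) (x : ℕ) (a : InterlacingArray M) :
    Set Ω :=
  {ω | ∀ (k : ℕ) (hk : k ≤ M), Λ x k ω = a.level k hk}

include hu huv in
theorem IsYangBaxterField.measure_columnEvents
    (h : IsYangBaxterField 0 0 (fun _ => v) (fun _ => u) P Λ) {M : ℕ} {t : ℕ → ℕ}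
    (ht : Monotone t) (ht0 : t 0 = 0) {a : ℕ → InterlacingArray M} (ha : a 0 = packed M) (n : ℕ) :
    P {ω | ∀ l ≤ n, ω ∈ columnEvent Λ (t l) (a l)} =
      ∏ j ∈ Finset.range n,
        kernelPow (fun a b => ENNReal.ofReal (arrayKernel (u / v) a b)) (t (j + 1) - t j)
          (a j) (a (j + 1)) := by
  have hv : 0 < v := hu.trans huv
  have h0 : 0 ≤ u / v := by positivity
  have h1 : u / v ≤ 1 := ((div_lt_one hv).2 huv).le
  have hinit : ∀ᵐ ω ∂P, ω ∈ columnEvent Λ 0 (packed M) := by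
    filter_upwards [ae_all_iff.2 h.boundary] with ω hω k hk
    exact hω k
  refine measure_event_eq_prod ?_ ?_ ?_ ?_ ht ?_ n
  · intro x a
    have : columnEvent Λ x a = ⋂ k, ⋂ (hk : k ≤ M), Λ x k ⁻¹' {a.level k hk} := by
      ext ω
      simp [columnEvent]
    rw [this]
    exact MeasurableSet.iInter fun k => MeasurableSet.iInter fun hk =>
      h.measurable x k (measurableSet_singleton _)
  · intro x s s' ω hs hs'
    ext k hk : 3
    rw [← hs k hk, hs' k hk]
  · intro x
    filter_upwards [ae_all_iff.2 fun k => h.ae_interlaces hu huv x k] with ω hω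
    exact ⟨⟨fun k _ => Λ x k ω, fun k _ => hω k⟩, fun k hk => rfl⟩
  · intro x g
    by_cases hg : g 0 = packed M
    · have hlaw : ∀ X, P {ω | ∀ i ≤ X, ω ∈ columnEvent Λ i (g i)} =
          ∏ x ∈ Finset.range X, ENNReal.ofReal (arrayKernel (u / v) (g x) (g (x + 1))) := by
        intro X
        have e : {ω | ∀ i ≤ X, ω ∈ columnEvent Λ i (g i)} =
            {ω | ∀ x ≤ X, ∀ y ≤ M, Λ x y ω = (g x).extend y} := by
          ext ω
          refine forall₂_congr fun x hx => forall₂_congr fun k hk => ?_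
          rw [InterlacingArray.extend_eq _ hk]
        rw [e, ← ENNReal.ofReal_toReal (measure_ne_top P _)]
        have := h.rectangle_law hu huv X M (fun x y => (g x).extend y) (fun y => by
          simp only [hg]
          unfold InterlacingArray.extend
          split_ifs <;> rfl)
        rw [Measure.real] at this
        rw [this, ENNReal.ofReal_prod_of_nonneg]
        · refine Finset.prod_congr rfl fun x _ => ?_
          rw [arrayKernel, Finset.prod_range]
          congr 1
          refine Finset.prod_congr rfl fun k _ => ?_
          rw [InterlacingArray.extend_eq _ k.2.le, InterlacingArray.extend_eq _ k.2.le,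
            InterlacingArray.extend_eq _ k.2, InterlacingArray.extend_eq _ k.2]
        · exact fun x _ => Finset.prod_nonneg fun y _ => uZero_nonneg h0 h1 _ _ _ _
      rw [hlaw, hlaw, Finset.prod_range_succ]
    -- A trajectory that does not start from the packed array has probability zero.
    · have hz : ∀ X, P {ω | ∀ i ≤ X, ω ∈ columnEvent Λ i (g i)} = 0 := by
        intro X
        rw [measure_eq_zero_iff_ae_notMem]
        filter_upwards [hinit] with ω hω hc
        apply hg
        ext k hk : 3
        rw [← hω k hk, hc 0 (Nat.zero_le _) k hk]
      rw [hz, hz, zero_mul]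
  · rw [ht0, ha, ← measure_univ (μ := P)]
    refine measure_congr ?_
    filter_upwards [hinit] with ω hω
    exact propext ⟨fun _ => trivial, fun _ => hω⟩

end Rows

/-! ### Lower bounds for the transition probabilities -/

/-- The state of the cross, given the numbers of arrows of the four signatures in the columns
to the right of it. -/
def crossAt (K L M V : ℕ) : Cross :=
  if L = K then
    if M = K then
      if V = K then .oiio else .ioio
    else .iiii
  else
    if M = K then .oooo
    else if V = K + 1 then .oioi else .iooi

/-- The right edges depend on `L - K` and `M - K` only. `V` is free only if `L = M`, and then it
selects one of two states. -/
theorem crossAt_edges {K L M V : ℕ} (h1 : K ≤ L ∧ L ≤ K + 1) (h2 : K ≤ M ∧ M ≤ K + 1)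
    (h3 : L ≤ V ∧ V ≤ L + 1) (h4 : M ≤ V ∧ V ≤ M + 1) :
    (crossAt K L M V).botRight + L = 1 + K ∧ (crossAt K L M V).topRight + K = M ∧
      (crossAt K L M V).botLeft + L = V ∧ (crossAt K L M V).topLeft + V = 1 + M := by
  unfold crossAt
  split_ifs <;> simp only [Cross.botRight, Cross.topRight, Cross.botLeft, Cross.topLeft] <;> omega

theorem prod_crossAt_le_uZero {ρ : ℝ} (h0 : 0 ≤ ρ) (h1 : ρ ≤ 1) {N : ℕ}
    {κ lam : Signature N} {μ ν : Signature (N + 1)} (hκl : CntStep κ lam) (hκm : CntStep κ μ)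
    (hln : CntStep lam ν) (hmn : CntStep μ ν) :
    ∏ r ∈ Finset.range (columnBound κ lam μ ν), stepWeight ρ
        (crossAt (κ.cnt r) (lam.cnt r) (μ.cnt r) (ν.cnt r))
        (crossAt (κ.cnt (r + 1)) (lam.cnt (r + 1)) (μ.cnt (r + 1)) (ν.cnt (r + 1))) ≤
      uZero ρ κ lam μ ν := by
  refine prod_stepWeight_le_uZero h0 h1 κ lam μ ν
    (fun r => crossAt (κ.cnt r) (lam.cnt r) (μ.cnt r) (ν.cnt r)) ?_ (fun r => ?_) (fun r hr => ?_)
  · simp [crossAt]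
  · have a1 := crossAt_edges (hκl r) (hκm r) (hln r) (hmn r)
    have a2 := crossAt_edges (hκl (r + 1)) (hκm (r + 1)) (hln (r + 1)) (hmn (r + 1))
    have b1 := κ.cnt_eq_mult_add r
    have b2 := lam.cnt_eq_mult_add r
    have b3 := μ.cnt_eq_mult_add r
    have b4 := ν.cnt_eq_mult_add r
    unfold Conserves
    omega
  · have := lt_columnBound κ lam μ ν
    simp only [κ.cnt_eq_zero (show _ < r by omega), lam.cnt_eq_zero (show _ < r by omega),
      μ.cnt_eq_zero (show _ < r by omega), ν.cnt_eq_zero (show _ < r by omega)]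
    simp [crossAt]

theorem pow_le_prod_ite {σ : ℝ} (h0 : 0 ≤ σ) (h1 : σ ≤ 1) (s : Finset ℕ) (p : ℕ → Prop)
    [DecidablePred p] (n : ℕ) (hn : (s.filter p).card ≤ n) :
    σ ^ n ≤ ∏ r ∈ s, if p r then σ else 1 := by
  rw [Finset.prod_ite, Finset.prod_const, Finset.prod_const_one, mul_one]
  exact pow_le_pow_of_le_one h0 h1 hn

theorem Signature.card_columns_le {N : ℕ} (a : Signature N) (R : ℕ) :
    ((Finset.range R).filter fun r => a.cnt (r + 1) < a.cnt r).card ≤ N := by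
  rw [Finset.card_filter]
  calc _ ≤ ∑ r ∈ Finset.range R, a.mult r := by
        refine Finset.sum_le_sum fun r _ => ?_
        have := a.cnt_eq_mult_add r
        split_ifs <;> omega
    _ ≤ N := by
        have := a.sum_mult_add_cnt R
        omega

/-- Factors `1 - ρ` are charged only to columns that contain an arrow of `ν`, at most `N + 1` of
them; `w` holds the remaining factors. -/
theorem pow_mul_le_uZero {ρ : ℝ} (h0 : 0 ≤ ρ) (h1 : ρ ≤ 1) {N : ℕ}
    {κ lam : Signature N} {μ ν : Signature (N + 1)} (hκl : CntStep κ lam) (hκm : CntStep κ μ)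
    (hln : CntStep lam ν) (hmn : CntStep μ ν) (w : ℕ → ℝ) (hw : ∀ r, 0 ≤ w r)
    (h : ∀ r, (if ν.cnt (r + 1) < ν.cnt r then 1 - ρ else 1) * w r ≤ stepWeight ρ
        (crossAt (κ.cnt r) (lam.cnt r) (μ.cnt r) (ν.cnt r))
        (crossAt (κ.cnt (r + 1)) (lam.cnt (r + 1)) (μ.cnt (r + 1)) (ν.cnt (r + 1)))) :
    (1 - ρ) ^ (N + 1) * ∏ r ∈ Finset.range (columnBound κ lam μ ν), w r ≤
      uZero ρ κ lam μ ν := by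
  have hσ : 0 ≤ 1 - ρ := by linarith
  refine le_trans ?_ (prod_crossAt_le_uZero h0 h1 hκl hκm hln hmn)
  calc _ ≤ (∏ r ∈ Finset.range (columnBound κ lam μ ν),
          if ν.cnt (r + 1) < ν.cnt r then 1 - ρ else 1) *
        ∏ r ∈ Finset.range (columnBound κ lam μ ν), w r :=
        mul_le_mul_of_nonneg_right
          (pow_le_prod_ite hσ (by linarith) _ _ _ (ν.card_columns_le _))
          (Finset.prod_nonneg fun r _ => hw r)
    _ = _ := Finset.prod_mul_distrib.symm
    _ ≤ _ := by
        refine Finset.prod_le_prod (fun r _ => mul_nonneg ?_ (hw r)) fun r _ => h r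
        split_ifs <;> linarith

/-! ### Blocking rules and the independent jumps of one level -/

/-- The particle `μ_i` is neither blocked from below nor specially blocked. -/
def Free {k : ℕ} (lam : Signature k) (μ : Signature (k + 1)) (i : Fin (k + 1)) : Prop :=
  ¬ (BlockedBelow lam μ i ∨ SpeciallyBlocked lam μ i)

theorem jumpRate_of_free {u : ℝ} {k : ℕ} {lam : Signature k} {μ : Signature (k + 1)}
    {i : Fin (k + 1)} (h : Free lam μ i) : jumpRate u lam μ i = u := if_neg h

theorem jumpRate_of_not_free {u : ℝ} {k : ℕ} {lam : Signature k} {μ : Signature (k + 1)}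
    {i : Fin (k + 1)} (h : ¬ Free lam μ i) : jumpRate u lam μ i = 0 := if_pos (not_not.1 h)

/-- The lower level leaves room for the jump exactly if `i` of its parts exceed `μ_i`, and absence
of special blocking means that `μ` has one arrow more in the columns from `μ_i` on. With the lower
level at rest, the cross then enters column `μ_i` in state `iiii` and, if nothing jumps, leaves it
in `oiio`: this is where the coin is tossed. -/
theorem Free.cnt {k : ℕ} {lam : Signature k} {μ : Signature (k + 1)}
    (hi : CntStep lam μ) {i : Fin (k + 1)} (h : Free lam μ i) :
    μ.cnt (μ.1 i + 1) = i ∧ lam.cnt (μ.1 i + 1) = i ∧ μ.cnt (μ.1 i) = lam.cnt (μ.1 i) + 1 := by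
  unfold Free at h
  rw [not_or] at h
  obtain ⟨hb, hs⟩ := h
  have a1 := (μ.le_iff_lt_cnt (μ.1 i + 1) i).not.1 (by omega)
  have a2 := hi (μ.1 i + 1)
  have a3 : (i : ℕ) ≤ lam.cnt (μ.1 i + 1) := by
    by_contra hc
    have hi0 : (i : ℕ) ≠ 0 := by omega
    have hik := i.2
    apply hb
    refine ⟨⟨i - 1, by omega⟩, Fin.ext (by simp; omega), ?_⟩
    set j : Fin k := ⟨i - 1, by omega⟩ with hj
    have h1 := (lam.le_iff_lt_cnt (μ.1 i + 1) j).not.2 (by simp [hj]; omega)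
    have h2 : μ.1 i ≤ lam.1 j := by
      rw [lam.le_iff_lt_cnt]
      have h3 := (μ.le_iff_lt_cnt (μ.1 i) i).1 le_rfl
      have h4 := hi (μ.1 i)
      simp [hj]
      omega
    omega
  refine ⟨by omega, by omega, ?_⟩
  by_contra hc
  have a4 := hi (μ.1 i)
  have a5 := (μ.le_iff_lt_cnt (μ.1 i) i).1 le_rfl
  have a6 := lam.cnt_le (μ.1 i)
  apply hs
  refine ⟨⟨lam.cnt (μ.1 i) - 1, by omega⟩, ?_, fun l hil hlj => ?_, ?_⟩
  · rw [Fin.le_def]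
    simp
    omega
  · rw [Fin.le_def] at hil hlj
    simp only [Fin.val_castSucc] at hil hlj
    have b1 := μ.le_iff_lt_cnt (μ.1 i) l.castSucc
    have b2 := μ.le_iff_lt_cnt (μ.1 i + 1) l.castSucc
    have b3 := lam.le_iff_lt_cnt (μ.1 i) l
    have b4 := lam.le_iff_lt_cnt (μ.1 i + 1) l
    simp only [Fin.val_castSucc] at b1 b2
    omega
  · rw [← not_le, μ.le_iff_lt_cnt]
    simp
    omega

theorem free_of_cnt {k : ℕ} {lam : Signature k} {μ : Signature (k + 1)} {i : Fin (k + 1)} {r : ℕ}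
    (hr : μ.1 i = r) (h1 : lam.cnt (r + 1) = i) (h2 : μ.cnt r = lam.cnt r + 1) :
    Free lam μ i := by
  subst hr
  rintro (⟨j, rfl, hj⟩ | ⟨j, hij, hl, hj⟩)
  · have := (lam.le_iff_lt_cnt (μ.1 j.succ + 1) j).2 (by simp at h1; omega)
    omega
  · have a1 := (lam.le_iff_lt_cnt (μ.1 i) j).1 (hl j hij le_rfl).2.ge
    have a2 := (μ.le_iff_lt_cnt (μ.1 i) j.succ).not.1 (by omega)
    simp only [Fin.val_succ] at a2
    omega

open Classical in
/-- No jump. -/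
theorem pow_card_free_le_uZero {ρ : ℝ} (h0 : 0 ≤ ρ) (h1 : ρ ≤ 1) {N : ℕ}
    {κ : Signature N} {μ : Signature (N + 1)} (hκm : CntStep κ μ) :
    (1 - ρ) ^ (Finset.univ.filter fun i => Free κ μ i).card ≤ uZero ρ κ κ μ μ := by
  have hσ : 0 ≤ 1 - ρ := by linarith
  refine le_trans ?_
    (prod_crossAt_le_uZero h0 h1 (CntStep.refl κ) hκm hκm (CntStep.refl μ))
  refine (pow_le_prod_ite hσ (by linarith) (Finset.range (columnBound κ κ μ μ))
    (fun r => μ.cnt r = κ.cnt r + 1 ∧ μ.cnt (r + 1) = κ.cnt (r + 1)) _ ?_).trans ?_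
  -- Each column crossed from `iiii` to `oiio` belongs to its own free particle, the one with index
  -- `κ.cnt (r + 1)`, so the exponent is exact enough for the first order term.
  · have hval : ∀ r, μ.cnt r = κ.cnt r + 1 → μ.cnt (r + 1) = κ.cnt (r + 1) →
        ∀ i : Fin (N + 1), (i : ℕ) = κ.cnt (r + 1) → μ.1 i = r := by
      intro r e1 e2 i hi
      have a1 := μ.le_iff_lt_cnt r i
      have a2 := μ.le_iff_lt_cnt (r + 1) i
      have a3 := κ.cnt_antitone (Nat.le_succ r)
      simp only [Nat.succ_eq_add_one] at a3
      omega
    refine Finset.card_le_card_of_injOn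
      (fun r => (⟨κ.cnt (r + 1), Nat.lt_succ_of_le (κ.cnt_le _)⟩ : Fin (N + 1))) ?_ ?_
    · intro r hr
      simp only [Finset.coe_filter, Finset.mem_range, Set.mem_ofPred_eq] at hr
      simp only [Finset.coe_filter, Finset.mem_univ, true_and, Set.mem_ofPred_eq]
      exact free_of_cnt (hval r hr.2.1 hr.2.2 ⟨_, Nat.lt_succ_of_le (κ.cnt_le _)⟩ rfl) rfl hr.2.1
    · intro r hr r' hr' h
      simp only [Finset.coe_filter, Finset.mem_range, Set.mem_ofPred_eq] at hr hr'
      rw [← hval r hr.2.1 hr.2.2 ⟨_, Nat.lt_succ_of_le (κ.cnt_le _)⟩ rfl,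
        ← hval r' hr'.2.1 hr'.2.2 ⟨_, Nat.lt_succ_of_le (κ.cnt_le _)⟩ rfl]
      exact congrArg μ.1 h
  · refine Finset.prod_le_prod (fun r _ => by split_ifs <;> linarith) fun r _ => ?_
    have a1 := hκm r
    have a2 := hκm (r + 1)
    unfold crossAt
    split_ifs <;> first | omega | simp [stepWeight]

theorem Free.cntStep {N : ℕ} {κ : Signature N} {μ ν : Signature (N + 1)} {i : Fin (N + 1)}
    (hi : Free κ μ i) (hκm : CntStep κ μ) (hν : IsMove μ ν i) : CntStep κ ν := by
  obtain ⟨c1, c2, c3⟩ := hi.cnt hκm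
  intro r
  have := hκm r
  rw [hν.cnt_eq]
  split_ifs with hr
  · subst hr; omega
  · omega

/-- A free particle jumps. -/
theorem mul_pow_le_uZero_of_free {ρ : ℝ} (h0 : 0 ≤ ρ) (h1 : ρ ≤ 1) {N : ℕ}
    {κ : Signature N} {μ ν : Signature (N + 1)} (hκm : CntStep κ μ) {i : Fin (N + 1)}
    (hi : Free κ μ i) (hν : IsMove μ ν i) :
    ρ * (1 - ρ) ^ (N + 1) ≤ uZero ρ κ κ μ ν := by
  obtain ⟨c1, c2, c3⟩ := hi.cnt hκm
  have hV := hν.cnt_eq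
  have hκn := hi.cntStep hκm hν
  have hmn : CntStep μ ν := by
    intro r
    rw [hV]
    split_ifs <;> omega
  -- The factor `ρ` is the transition from `iiii` to `ioio` at column `μ_i`; everywhere else the
  -- weight is `1` or `1 - ρ`.
  refine le_trans ?_ (pow_mul_le_uZero h0 h1 (CntStep.refl κ) hκm hκn hmn
    (fun r => if r = μ.1 i then ρ else 1) (fun r => by split_ifs <;> linarith) fun r => ?_)
  · rw [mul_comm]
    refine mul_le_mul_of_nonneg_left ?_ (pow_nonneg (by linarith) _)
    rw [Finset.prod_ite_eq']
    split_ifs <;> linarith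
  · have a1 := hκm r
    have a2 := hκm (r + 1)
    have a3 := κ.cnt_antitone (Nat.le_succ r)
    have a4 := hV r
    have a5 := hV (r + 1)
    simp only [Nat.succ_eq_add_one] at a3
    by_cases hr : r = μ.1 i
    · subst hr
      rw [if_neg (by omega)] at a4
      rw [if_pos rfl] at a5
      rw [if_pos rfl]
      have e1 : crossAt (κ.cnt (μ.1 i)) (κ.cnt (μ.1 i)) (μ.cnt (μ.1 i)) (ν.cnt (μ.1 i)) =
          .iiii := by
        unfold crossAt
        split_ifs <;> first | omega | rfl
      have e2 : crossAt (κ.cnt (μ.1 i + 1)) (κ.cnt (μ.1 i + 1)) (μ.cnt (μ.1 i + 1))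
          (ν.cnt (μ.1 i + 1)) = .ioio := by
        unfold crossAt
        split_ifs <;> first | omega | rfl
      rw [e1, e2]
      simp only [stepWeight]
      split_ifs <;> nlinarith
    · rw [if_neg hr, mul_one]
      rw [if_neg (by omega)] at a5
      by_cases hr' : r = μ.1 i + 1
      · subst hr'
        rw [if_pos rfl] at a4
        unfold crossAt
        split_ifs <;> first | omega | simp [stepWeight, h0]
      · rw [if_neg hr'] at a4
        unfold crossAt
        split_ifs <;> first | omega | simp [stepWeight, h0]

/-! ### Mandatory and special pushing as deterministic moves of the cross -/

section Propagation

variable {N : ℕ} {κ lam : Signature N} {μ ν : Signature (N + 1)} {i : Fin N}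

theorem IsMove.val_eq (hm : IsMove κ lam i) : lam.1 i = κ.1 i + 1 := by
  have := congrFun hm i
  rwa [Function.update_self] at this

theorem IsMove.cnt_val (hm : IsMove κ lam i) :
    κ.cnt (lam.1 i) = i ∧ lam.cnt (lam.1 i) = i + 1 := by
  have a1 := hm.cnt_eq (lam.1 i)
  rw [if_pos hm.val_eq] at a1
  have a2 := (lam.le_iff_lt_cnt (lam.1 i) i).1 le_rfl
  have a3 := (κ.le_iff_lt_cnt (lam.1 i) i).not.1 (by have := hm.val_eq; omega)
  omega

theorem IsMove.cnt_of_ne (hm : IsMove κ lam i) {r : ℕ} (hr : r ≠ lam.1 i) :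
    lam.cnt r = κ.cnt r := by
  rw [hm.cnt_eq, if_neg (by rw [← hm.val_eq]; exact hr), add_zero]

theorem IsMove.cntStep (hm : IsMove κ lam i) : CntStep κ lam := by
  intro r
  rw [hm.cnt_eq]
  split_ifs <;> omega

/-- Before the move interlacing gives `μ_i ≥ κ_i = lam_i - 1`, so the push is mandatory exactly if
`μ_i` has not reached `lam_i`. -/
theorem mandatory_iff (hκm : CntStep κ μ) (hm : IsMove κ lam i) :
    lam.1 i = μ.1 i.castSucc + 1 ↔ μ.cnt (lam.1 i) = i := by
  have a1 := hm.cnt_val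
  have a2 := hm.val_eq
  have a3 := hκm (lam.1 i)
  have a4 := μ.le_iff_lt_cnt (lam.1 i) i.castSucc
  have a5 := μ.le_iff_lt_cnt (κ.1 i) i.castSucc
  have a6 := (κ.le_iff_lt_cnt (κ.1 i) i).1 le_rfl
  have a7 := hκm (κ.1 i)
  simp only [Fin.val_castSucc] at a4 a5
  omega

theorem SpecialPush.cnt (hκm : CntStep κ μ) (hm : IsMove κ lam i) {j : Fin N}
    (h : SpecialPush lam μ i j) :
    μ.cnt (lam.1 i) = i + 1 ∧ μ.cnt (lam.1 i + 1) = j ∧ κ.cnt (lam.1 i + 1) = j ∧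
      μ.1 j.castSucc = lam.1 i := by
  obtain ⟨hji, hl, hlt⟩ := h
  have b1 := (hl j le_rfl hji)
  have b2 := (hl i hji le_rfl)
  have a1 := hm.cnt_val
  have a3 := hκm (lam.1 i)
  have a4 := (μ.le_iff_lt_cnt (lam.1 i) i.castSucc).1 b2.1.ge
  have a5 := (μ.le_iff_lt_cnt (lam.1 i + 1) j.castSucc).not.1 (by omega)
  have a6 := hκm (lam.1 i + 1)
  have a7 := hm.cnt_of_ne (r := lam.1 i + 1) (by omega)
  have a8 : (j : ℕ) ≤ lam.cnt (lam.1 i + 1) := by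
    by_contra hc
    have hj := j.2
    have h1 := hlt ⟨lam.cnt (lam.1 i + 1), by omega⟩ (by rw [Fin.lt_def]; simp only; omega)
    have h2 := (lam.le_iff_lt_cnt (lam.1 i + 1) ⟨lam.cnt (lam.1 i + 1), by omega⟩).1 (by omega)
    simp at h2
  simp only [Fin.val_castSucc] at a4 a5
  refine ⟨by omega, by omega, by omega, b1.1⟩

/-- The pushed index is that of the first part of `lam` located at `lam_i`. Equality of the counts
beyond this column makes the parts of `μ` with indices from there to `i` sit at the same site. -/
theorem exists_specialPush (hm : IsMove κ lam i) (h1 : μ.cnt (lam.1 i) = i + 1)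
    (h2 : μ.cnt (lam.1 i + 1) = κ.cnt (lam.1 i + 1)) : ∃ j, SpecialPush lam μ i j := by
  have a1 := hm.cnt_val
  have a2 := hm.cnt_of_ne (r := lam.1 i + 1) (by omega)
  have a3 := κ.cnt_antitone (Nat.le_succ (lam.1 i))
  simp only [Nat.succ_eq_add_one] at a3
  have hi := i.2
  have hval : ∀ l : Fin N, (l : ℕ) ≤ i → κ.cnt (lam.1 i + 1) ≤ l → lam.1 l = lam.1 i := by
    intro l hli hjl
    have b1 := lam.le_iff_lt_cnt (lam.1 i) l
    have b2 := lam.le_iff_lt_cnt (lam.1 i + 1) l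
    omega
  refine ⟨⟨κ.cnt (lam.1 i + 1), by omega⟩, ?_, fun l hjl hli => ⟨?_, ?_⟩, fun l hl => ?_⟩
  · rw [Fin.le_def]
    simp only
    omega
  · rw [Fin.le_def] at hjl hli
    simp only at hjl
    have b1 := μ.le_iff_lt_cnt (lam.1 i) l.castSucc
    have b2 := μ.le_iff_lt_cnt (lam.1 i + 1) l.castSucc
    simp only [Fin.val_castSucc] at b1 b2
    omega
  · exact hval l hli hjl
  · rw [hval _ (by simp only; omega) le_rfl]
    rw [Fin.lt_def] at hl
    simp only at hl
    have := (lam.le_iff_lt_cnt (lam.1 i + 1) l).2 (by omega)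
    omega

/-- The counting function after the update. -/
theorem Propagates.cnt_cases (hκm : CntStep κ μ) (hm : IsMove κ lam i)
    (hp : Propagates κ lam μ ν) :
    (μ.cnt (lam.1 i) = i ∧ ∀ r, ν.cnt r = μ.cnt r + if r = lam.1 i then 1 else 0) ∨
    (μ.cnt (lam.1 i) = i + 1 ∧ μ.cnt (lam.1 i + 1) = κ.cnt (lam.1 i + 1) ∧
      ∀ r, ν.cnt r = μ.cnt r + if r = lam.1 i + 1 then 1 else 0) ∨
    (μ.cnt (lam.1 i) = i + 1 ∧ μ.cnt (lam.1 i + 1) ≠ κ.cnt (lam.1 i + 1) ∧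
      ∀ r, ν.cnt r = μ.cnt r) := by
  rcases hp with ⟨h, -⟩ | ⟨i', hm', hp⟩
  · exact absurd h hm.ne
  obtain rfl := hm.index_eq hm'
  rcases hp with ⟨h, hν⟩ | ⟨j, h, hν⟩ | ⟨h, h', rfl⟩
  · left
    refine ⟨(mandatory_iff hκm hm).1 h, fun r => ?_⟩
    rw [hν.cnt_eq, h]
  · right; left
    obtain ⟨b1, b2, b3, b4⟩ := h.cnt hκm hm
    refine ⟨b1, by omega, fun r => ?_⟩
    rw [hν.cnt_eq, b4]
  · right; right
    have a1 := hm.cnt_val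
    have a3 := hκm (lam.1 i)
    rw [Ne, mandatory_iff hκm hm] at h
    have : ν.cnt (lam.1 i) = i + 1 := by omega
    exact ⟨this, fun h2 => h' (exists_specialPush hm this h2), fun r => rfl⟩

theorem Propagates.cntStep (hκm : CntStep κ μ) (hm : IsMove κ lam i)
    (hp : Propagates κ lam μ ν) : CntStep lam ν ∧ CntStep μ ν := by
  have a1 := hm.cnt_val
  constructor
  · intro r
    have a2 := hκm r
    have a3 := hm.cnt_of_ne (r := r)
    rcases hp.cnt_cases hκm hm with ⟨b1, b2⟩ | ⟨b1, b2, b3⟩ | ⟨b1, b2, b3⟩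
    · rw [b2]
      split_ifs with hr
      · subst hr; omega
      · rw [a3 hr]; omega
    · rw [b3]
      split_ifs with hr
      · subst hr; rw [a3 (by omega)]; omega
      · by_cases hr' : r = lam.1 i
        · subst hr'; omega
        · rw [a3 hr']; omega
    · rw [b3]
      by_cases hr' : r = lam.1 i
      · subst hr'; omega
      · rw [a3 hr']; omega
  · intro r
    rcases hp.cnt_cases hκm hm with ⟨b1, b2⟩ | ⟨b1, b2, b3⟩ | ⟨b1, b2, b3⟩
    · rw [b2]; split_ifs <;> omega
    · rw [b3]; split_ifs <;> omega
    · rw [b3]; omega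

/-- The update exists. -/
theorem exists_propagates (hκm : CntStep κ μ) (hm : IsMove κ lam i) :
    ∃ ν, Propagates κ lam μ ν := by
  by_cases h : lam.1 i = μ.1 i.castSucc + 1
  · have h' := (mandatory_iff hκm hm).1 h
    obtain ⟨ν, hν⟩ := exists_isMove μ i.castSucc (by rw [← h, h']; exact le_rfl)
    exact ⟨ν, Or.inr ⟨i, hm, Or.inl ⟨h, hν⟩⟩⟩
  by_cases hs : ∃ j, SpecialPush lam μ i j
  · obtain ⟨j, hj⟩ := hs
    obtain ⟨b1, b2, b3, b4⟩ := hj.cnt hκm hm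
    obtain ⟨ν, hν⟩ := exists_isMove μ j.castSucc (by rw [b4, b2]; exact le_rfl)
    exact ⟨ν, Or.inr ⟨i, hm, Or.inr (Or.inl ⟨j, hj, hν⟩)⟩⟩
  · exact ⟨μ, Or.inr ⟨i, hm, Or.inr (Or.inr ⟨h, hs, rfl⟩)⟩⟩

theorem SpecialPush.unique {j j' : Fin N} (h : SpecialPush lam μ i j)
    (h' : SpecialPush lam μ i j') : j = j' := by
  rcases lt_trichotomy j j' with hlt | heq | hlt
  · have := h'.2.2 j hlt
    have h1 := (h.2.1 j le_rfl h.1).2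
    have h2 := (h'.2.1 j' le_rfl h'.1).2
    omega
  · exact heq
  · have := h.2.2 j' hlt
    have h1 := (h.2.1 j le_rfl h.1).2
    have h2 := (h'.2.1 j' le_rfl h'.1).2
    omega

/-- The update is unique. -/
theorem Propagates.unique {ν' : Signature (N + 1)} (h : Propagates κ lam μ ν)
    (h' : Propagates κ lam μ ν') : ν = ν' := by
  rcases h with ⟨h, rfl⟩ | ⟨i, hm, h⟩ <;> rcases h' with ⟨h', rfl⟩ | ⟨i', hm', h'⟩
  · rfl
  · exact absurd h hm'.ne
  · exact absurd h' hm.ne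
  obtain rfl := hm.index_eq hm'
  have hsm : ∀ j, SpecialPush lam μ i j → lam.1 i ≠ μ.1 i.castSucc + 1 := by
    intro j hj
    have := (hj.2.1 i hj.1 le_rfl).1
    omega
  rcases h with ⟨h, hν⟩ | ⟨j, h, hν⟩ | ⟨h1, h2, rfl⟩ <;>
    rcases h' with ⟨h', hν'⟩ | ⟨j', h', hν'⟩ | ⟨h1', h2', rfl⟩
  · exact hν.eq hν'
  · exact absurd h (hsm j' h')
  · exact absurd h h1'
  · exact absurd h' (hsm j h)
  · obtain rfl := h.unique h'
    exact hν.eq hν'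
  · exact absurd ⟨j, h⟩ h2'
  · exact absurd h' h1
  · exact absurd ⟨j', h'⟩ h2
  · rfl

/-- The move on the level below propagates. -/
theorem pow_le_uZero_of_move {ρ : ℝ} (h0 : 0 ≤ ρ) (h1 : ρ ≤ 1) (hκm : CntStep κ μ)
    (hm : IsMove κ lam i) (hp : Propagates κ lam μ ν) :
    (1 - ρ) ^ (N + 1) ≤ uZero ρ κ lam μ ν := by
  obtain ⟨hln, hmn⟩ := hp.cntStep hκm hm
  have a1 := hm.cnt_val
  refine le_trans ?_ (pow_mul_le_uZero h0 h1 hm.cntStep hκm hln hmn (fun _ => 1)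
    (fun _ => zero_le_one) fun r => ?_)
  · simp
  rw [mul_one]
  have a2 := hκm r
  have a2' := hκm (r + 1)
  have a4 := κ.cnt_antitone (Nat.le_succ r)
  have a5 := κ.cnt_antitone (Nat.le_succ (lam.1 i))
  simp only [Nat.succ_eq_add_one] at a4 a5
  have hrest : ∀ r, r ≠ lam.1 i → ν.cnt r = μ.cnt r →
      crossAt (κ.cnt r) (lam.cnt r) (μ.cnt r) (ν.cnt r) =
        if μ.cnt r = κ.cnt r then .oiio else .iiii := by
    intro r hr hν
    unfold crossAt
    rw [if_pos (hm.cnt_of_ne hr), hν]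
    split_ifs <;> rfl
  rcases hp.cnt_cases hκm hm with ⟨b1, b2⟩ | ⟨b1, b2, b3⟩ | ⟨b1, b2, b3⟩
  -- Mandatory push: the cross visits `oooo` just before column `lam_i`.
  · have hst : ∀ r, crossAt (κ.cnt r) (lam.cnt r) (μ.cnt r) (ν.cnt r) =
        if r = lam.1 i then .oooo else if μ.cnt r = κ.cnt r then .oiio else .iiii := by
      intro r
      by_cases hr : r = lam.1 i
      · subst hr
        unfold crossAt
        rw [if_neg (by omega), if_pos (by omega), if_pos rfl]
      · rw [if_neg hr, hrest r hr (by rw [b2, if_neg hr, add_zero])]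
    have b4 := b2 r
    have b5 := b2 (r + 1)
    rw [hst, hst]
    clear hst hrest b2
    split_ifs at b4 b5 ⊢ <;> first | (subst r; omega) | omega | simp [stepWeight, h0]
  -- Special push: the cross passes from `oioi` to `ioio`, which has weight `1`, whereas `oioi →
  -- oiio` has weight `0`.
  · have hst : ∀ r, crossAt (κ.cnt r) (lam.cnt r) (μ.cnt r) (ν.cnt r) =
        if r = lam.1 i then .oioi else if r = lam.1 i + 1 then .ioio else
          if μ.cnt r = κ.cnt r then .oiio else .iiii := by
      intro r
      have b4 := b3 r
      by_cases hr : r = lam.1 i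
      · subst hr
        rw [if_neg (by omega)] at b4
        unfold crossAt
        rw [if_neg (by omega), if_neg (by omega), if_pos (by omega), if_pos rfl]
      · rw [if_neg hr]
        by_cases hr' : r = lam.1 i + 1
        · rw [if_pos hr'] at b4 ⊢
          subst hr'
          have := hm.cnt_of_ne hr
          unfold crossAt
          rw [if_pos (by omega), if_pos (by omega), if_neg (by omega)]
        · rw [if_neg hr'] at b4 ⊢
          rw [hrest r hr (by omega)]
    have b4 := b3 r
    have b5 := b3 (r + 1)
    rw [hst, hst]
    clear hst hrest b3
    split_ifs at b4 b5 ⊢ <;> first | (subst r; omega) | omega | simp [stepWeight, h0]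
  -- No push: the cross passes from `oioi` to `iiii`, again with weight `1`.
  · have hst : ∀ r, crossAt (κ.cnt r) (lam.cnt r) (μ.cnt r) (ν.cnt r) =
        if r = lam.1 i then .oioi else if μ.cnt r = κ.cnt r then .oiio else .iiii := by
      intro r
      have b4 := b3 r
      by_cases hr : r = lam.1 i
      · subst hr
        unfold crossAt
        rw [if_neg (by omega), if_neg (by omega), if_pos (by omega), if_pos rfl]
      · rw [if_neg hr]
        rw [hrest r hr b4]
    have b4 := b3 r
    have b5 := b3 (r + 1)
    rw [hst, hst]
    clear hst hrest b3
    split_ifs <;> first | (subst r; omega) | omega | simp [stepWeight, h0]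

end Propagation

/-! ### Jumps of arrays -/

variable {M : ℕ}

/-- The array `b` is obtained from `a` by a jump of the `i`-th particle on level `k + 1`
and the propagation of this jump to the levels above. -/
def JumpsTo (a b : InterlacingArray M) (k : Fin M) (i : Fin (k + 1)) : Prop :=
  (∀ (l : ℕ) (hl : l ≤ M), l ≤ k → b.level l hl = a.level l hl) ∧
    IsMove (a.level (k + 1) k.2) (b.level (k + 1) k.2) i ∧
    ∀ l : Fin M, k < l → Propagates (a.level l l.2.le) (b.level l l.2.le)
      (a.level (l + 1) l.2) (b.level (l + 1) l.2)

open Classical in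
theorem clockRate_eq (u : ℝ) (a b : InterlacingArray M) (k : Fin M) (i : Fin (k + 1)) :
    clockRate u a b k i = if JumpsTo a b k i then
      jumpRate u (a.level k k.2.le) (a.level (k + 1) k.2) i else 0 := by
  unfold clockRate
  by_cases h : (∀ (l : ℕ) (hl : l ≤ M), l ≤ k → b.level l hl = a.level l hl) ∧
      IsMove (a.level (k + 1) k.2) (b.level (k + 1) k.2) i
  · rw [if_pos h]
    by_cases h' : ∀ l : Fin M, k < l → Propagates (a.level l l.2.le) (b.level l l.2.le)
      (a.level (l + 1) l.2) (b.level (l + 1) l.2)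
    · rw [if_pos ⟨h.1, h.2, h'⟩, Finset.prod_eq_one, mul_one]
      intro l hl
      exact if_pos (h' l (Finset.mem_filter.1 hl).2)
    · rw [if_neg fun hj => h' hj.2.2]
      push Not at h'
      obtain ⟨l, hl, hn⟩ := h'
      rw [Finset.prod_eq_zero (Finset.mem_filter.2 ⟨Finset.mem_univ l, hl⟩) (if_neg hn), mul_zero]
  · rw [if_neg h, if_neg fun hj => h ⟨hj.1, hj.2.1⟩]

theorem InterlacingArray.cntStep (a : InterlacingArray M) (k : ℕ) (hk : k + 1 ≤ M) :
    CntStep (a.level k (Nat.le_of_succ_le hk)) (a.level (k + 1) hk) :=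
  (interlaces_iff_cntStep _ _).1 (a.interlaces k hk)

theorem JumpsTo.ne {a b : InterlacingArray M} {k : Fin M} {i : Fin (k + 1)}
    (h : JumpsTo a b k i) : a ≠ b := by
  rintro rfl
  exact h.2.1.ne rfl

theorem JumpsTo.unique {a b b' : InterlacingArray M} {k : Fin M} {i : Fin (k + 1)}
    (h : JumpsTo a b k i) (h' : JumpsTo a b' k i) : b = b' := by
  ext l hl : 3
  induction l with
  | zero => exact Subsingleton.elim _ _
  | succ l ih =>
    rcases lt_trichotomy l (k : ℕ) with hlt | heq | hlt
    · rw [h.1 _ hl hlt, h'.1 _ hl hlt]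
    · subst heq
      exact h.2.1.eq h'.2.1
    · have h1 := h.2.2 ⟨l, hl⟩ hlt
      have h2 := h'.2.2 ⟨l, hl⟩ hlt
      simp only [← ih (Nat.le_of_succ_le hl)] at h2
      exact h1.unique h2

/-- The lowest changed level and the particle moved there reveal the clock, so at most one clock
contributes to each entry of `jumpKernel`. -/
theorem JumpsTo.index_eq {a b : InterlacingArray M} {k k' : Fin M} {i : Fin (k + 1)}
    {i' : Fin (k' + 1)} (h : JumpsTo a b k i) (h' : JumpsTo a b k' i') :
    (⟨k, i⟩ : Σ k : Fin M, Fin (k + 1)) = ⟨k', i'⟩ := by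
  rcases lt_trichotomy k k' with hlt | heq | hlt
  · exact absurd (h'.1 (k + 1) k.2 hlt) h.2.1.ne
  · subst heq
    rw [h.2.1.index_eq h'.2.1]
  · exact absurd (h.1 (k' + 1) k'.2 hlt) h'.2.1.ne

/-- The levels are built upwards. The last clause is the induction invariant: the current top level
is unchanged or has made a single move, which is what the next propagation requires. -/
theorem exists_jumpsTo_aux (a : InterlacingArray M) (k : Fin M) (i : Fin (k + 1))
    (hi : Free (a.level k k.2.le) (a.level (k + 1) k.2) i) (m : ℕ) (hkm : (k : ℕ) + 1 ≤ m)
    (hm : m ≤ M) :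
    ∃ lev : ∀ l, Signature l, (∀ l ≤ (k : ℕ), lev l = a.extend l) ∧
      IsMove (a.extend (k + 1)) (lev (k + 1)) i ∧
      (∀ l < m, Interlaces (lev l) (lev (l + 1))) ∧
      (∀ l, (k : ℕ) < l → l < m →
        Propagates (a.extend l) (lev l) (a.extend (l + 1)) (lev (l + 1))) ∧
      ((∃ j, IsMove (a.extend m) (lev m) j) ∨ lev m = a.extend m) := by
  have hA : ∀ l, l + 1 ≤ M → CntStep (a.extend l) (a.extend (l + 1)) := by
    intro l hl
    rw [a.extend_eq hl, a.extend_eq (Nat.le_of_succ_le hl)]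
    exact a.cntStep l hl
  rw [← a.extend_eq, ← a.extend_eq] at hi
  induction m, hkm using Nat.le_induction with
  | base =>
    obtain ⟨ν, hν⟩ := exists_isMove (a.extend (k + 1)) i (hi.cnt (hA k k.2)).1.ge
    have hne : ∀ l, l < (k : ℕ) + 1 → Function.update a.extend ((k : ℕ) + 1) ν l = a.extend l :=
      fun l hl => Function.update_of_ne (by omega) _ _
    refine ⟨Function.update a.extend (k + 1) ν, fun l hl => hne l (by omega), ?_, fun l hl => ?_,
      fun l h1 h2 => by omega, Or.inl ⟨i, ?_⟩⟩
    · rwa [Function.update_self]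
    · rw [hne l hl, interlaces_iff_cntStep]
      rcases (Nat.lt_succ_iff.1 hl).lt_or_eq with h | rfl
      · rw [hne _ (by omega)]
        exact hA l (by omega)
      · rw [Function.update_self]
        exact hi.cntStep (hA _ hm) hν
    · rwa [Function.update_self]
  | succ m hkm ih =>
    obtain ⟨lev, h1, h2, h3, h4, h5⟩ := ih (by omega)
    have : ∃ ν, Propagates (a.extend m) (lev m) (a.extend (m + 1)) ν ∧ CntStep (lev m) ν ∧
        ((∃ j, IsMove (a.extend (m + 1)) ν j) ∨ ν = a.extend (m + 1)) := by
      rcases h5 with ⟨j, hj⟩ | h5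
      · obtain ⟨ν, hν⟩ := exists_propagates (hA m hm) hj
        refine ⟨ν, hν, (hν.cntStep (hA m hm) hj).1, ?_⟩
        rcases hν with ⟨_, h⟩ | ⟨_, _, ⟨_, h⟩ | ⟨j, _, h⟩ | ⟨_, _, h⟩⟩
        · exact Or.inr h
        · exact Or.inl ⟨_, h⟩
        · exact Or.inl ⟨_, h⟩
        · exact Or.inr h
      · refine ⟨a.extend (m + 1), Or.inl ⟨h5, rfl⟩, ?_, Or.inr rfl⟩
        rw [h5]
        exact hA m hm
    obtain ⟨ν, hν, hstep, hmove⟩ := this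
    have hne : ∀ l, l ≤ m → Function.update lev (m + 1) ν l = lev l :=
      fun l hl => Function.update_of_ne (by omega) _ _
    refine ⟨Function.update lev (m + 1) ν, fun l hl => ?_, ?_, fun l hl => ?_,
      fun l hl hlm => ?_, ?_⟩
    · rw [hne l (by omega), h1 l hl]
    · rwa [hne _ hkm]
    · rw [hne l (by omega)]
      rcases (Nat.lt_succ_iff.1 hl).lt_or_eq with h | rfl
      · rw [hne _ h]
        exact h3 l h
      · rw [Function.update_self, interlaces_iff_cntStep]
        exact hstep
    · rw [hne l (by omega)]
      rcases (Nat.lt_succ_iff.1 hlm).lt_or_eq with h | rfl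
      · rw [hne _ h]
        exact h4 l hl h
      · rwa [Function.update_self]
    · rwa [Function.update_self]

/-- A jump of a free particle can be propagated to all levels above. -/
theorem exists_jumpsTo (a : InterlacingArray M) (k : Fin M) (i : Fin (k + 1))
    (hi : Free (a.level k k.2.le) (a.level (k + 1) k.2) i) : ∃ b, JumpsTo a b k i := by
  obtain ⟨lev, h1, h2, h3, h4, -⟩ := exists_jumpsTo_aux a k i hi M k.2 le_rfl
  refine ⟨⟨fun l _ => lev l, fun l hl => h3 l hl⟩, fun l hl hlk => ?_, ?_, fun l hl => ?_⟩
  · rw [← a.extend_eq hl]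
    exact h1 l hlk
  · rw [← a.extend_eq k.2]
    exact h2
  · rw [← a.extend_eq l.2.le, ← a.extend_eq l.2]
    exact h4 l hl l.2

theorem hasSum_clockRate (u : ℝ) (a : InterlacingArray M) (k : Fin M) (i : Fin (k + 1)) :
    HasSum (fun b => clockRate u a b k i)
      (jumpRate u (a.level k k.2.le) (a.level (k + 1) k.2) i) := by
  classical
  simp only [clockRate_eq]
  by_cases hi : Free (a.level k k.2.le) (a.level (k + 1) k.2) i
  · obtain ⟨b, hb⟩ := exists_jumpsTo a k i hi
    convert hasSum_single b ?_ using 1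
    · rw [if_pos hb]
    · intro b' hb'
      rw [if_neg]
      exact fun h => hb' (h.unique hb)
  · simp [jumpRate_of_not_free hi, hasSum_zero]

/-! ### Total rates and the generator -/

/-- The total jump rate of an array. -/
noncomputable def exitRate (u : ℝ) (a : InterlacingArray M) : ℝ :=
  ∑ k : Fin M, ∑ i : Fin (k + 1), jumpRate u (a.level k k.2.le) (a.level (k + 1) k.2) i

/-- The rates of the jumps without the diagonal. -/
noncomputable def jumpKernel (u : ℝ) (a b : InterlacingArray M) : ℝ :=
  ∑ k : Fin M, ∑ i : Fin (k + 1), clockRate u a b k i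

theorem hasSum_jumpKernel (u : ℝ) (a : InterlacingArray M) :
    HasSum (jumpKernel u a) (exitRate u a) :=
  hasSum_sum fun k _ => hasSum_sum fun i _ => hasSum_clockRate u a k i

open Classical in
theorem generator_eq (u : ℝ) (a b : InterlacingArray M) :
    generator u M a b = jumpKernel u a b - if a = b then exitRate u a else 0 := by
  unfold generator
  split_ifs with h
  · subst h
    have : jumpKernel u a a = 0 := by
      refine Finset.sum_eq_zero fun k _ => Finset.sum_eq_zero fun i _ => ?_
      rw [clockRate_eq, if_neg fun hj => hj.ne rfl]
    rw [this, zero_sub]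
    rfl
  · rw [sub_zero]
    rfl

theorem jumpRate_nonneg {u : ℝ} (hu : 0 ≤ u) {k : ℕ} (lam : Signature k) (μ : Signature (k + 1))
    (i : Fin (k + 1)) : 0 ≤ jumpRate u lam μ i := by
  unfold jumpRate
  split_ifs <;> simp [hu]

theorem jumpRate_le {u : ℝ} (hu : 0 ≤ u) {k : ℕ} (lam : Signature k) (μ : Signature (k + 1))
    (i : Fin (k + 1)) : jumpRate u lam μ i ≤ u := by
  unfold jumpRate
  split_ifs <;> simp [hu]

theorem clockRate_nonneg {u : ℝ} (hu : 0 ≤ u) (a b : InterlacingArray M) (k : Fin M)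
    (i : Fin (k + 1)) : 0 ≤ clockRate u a b k i := by
  rw [clockRate_eq]
  split_ifs
  · exact jumpRate_nonneg hu _ _ _
  · exact le_rfl

theorem jumpKernel_nonneg {u : ℝ} (hu : 0 ≤ u) (a b : InterlacingArray M) :
    0 ≤ jumpKernel u a b :=
  Finset.sum_nonneg fun k _ => Finset.sum_nonneg fun i _ => clockRate_nonneg hu a b k i

theorem exitRate_nonneg {u : ℝ} (hu : 0 ≤ u) (a : InterlacingArray M) : 0 ≤ exitRate u a :=
  Finset.sum_nonneg fun _ _ => Finset.sum_nonneg fun _ _ => jumpRate_nonneg hu _ _ _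

theorem exitRate_le {u : ℝ} (hu : 0 ≤ u) (a : InterlacingArray M) : exitRate u a ≤ u * M ^ 2 := by
  calc exitRate u a ≤ ∑ k : Fin M, ∑ _i : Fin (k + 1), u :=
        Finset.sum_le_sum fun _ _ => Finset.sum_le_sum fun _ _ => jumpRate_le hu _ _ _
    _ ≤ ∑ _k : Fin M, (M : ℝ) * u := by
        refine Finset.sum_le_sum fun k _ => ?_
        rw [Finset.sum_const, Finset.card_univ, Fintype.card_fin, nsmul_eq_mul]
        refine mul_le_mul_of_nonneg_right ?_ hu
        exact_mod_cast k.2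
    _ = _ := by
        rw [Finset.sum_const, Finset.card_univ, Fintype.card_fin, nsmul_eq_mul]
        ring

/-! ### Comparison of the kernel with the generator -/

/-- Bernoulli's inequality for the product of the no-jump bounds. The number of free particles is
the exit rate divided by `u`, so the first order term is sharp, as the later comparison of total
masses demands. -/
theorem one_sub_exitRate_le_arrayKernel {u ρ : ℝ} (hu : 0 < u) (h0 : 0 ≤ ρ) (h1 : ρ ≤ 1)
    (a : InterlacingArray M) : 1 - ρ / u * exitRate u a ≤ arrayKernel ρ a a := by
  classical
  set F : Fin M → ℕ := fun k => (Finset.univ.filter fun i : Fin (k + 1) =>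
    Free (a.level k k.2.le) (a.level (k + 1) k.2) i).card with hF
  have hexit : exitRate u a = u * (∑ k, F k : ℕ) := by
    unfold exitRate
    rw [Nat.cast_sum, Finset.mul_sum]
    refine Finset.sum_congr rfl fun k _ => ?_
    simp only [hF]
    rw [Finset.card_filter, Nat.cast_sum, Finset.mul_sum]
    refine Finset.sum_congr rfl fun i _ => ?_
    split_ifs with h
    · simp [jumpRate_of_free h]
    · simp [jumpRate_of_not_free h]
  have hprod : (1 - ρ) ^ (∑ k, F k) ≤ arrayKernel ρ a a := by
    rw [← Finset.prod_pow_eq_pow_sum]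
    refine Finset.prod_le_prod (fun k _ => pow_nonneg (by linarith) _) fun k _ => ?_
    exact pow_card_free_le_uZero h0 h1 (a.cntStep k k.2)
  refine le_trans ?_ hprod
  have := one_add_mul_le_pow (a := -ρ) (by linarith) (∑ k, F k)
  rw [hexit]
  have e : ρ / u * (u * (∑ k, F k : ℕ)) = (∑ k, F k : ℕ) * ρ := by field_simp
  rw [e]
  have e2 : (1 : ℝ) + -ρ = 1 - ρ := by ring
  rw [e2] at this
  linarith

theorem le_arrayKernel_of_jumpsTo {ρ : ℝ} (h0 : 0 ≤ ρ) (h1 : ρ ≤ 1)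
    {a b : InterlacingArray M} {k : Fin M} {i : Fin (k + 1)} (h : JumpsTo a b k i)
    (hi : Free (a.level k k.2.le) (a.level (k + 1) k.2) i) :
    ρ * (1 - M ^ 2 * ρ) ≤ arrayKernel ρ a b := by
  have hσ : 0 ≤ 1 - ρ := by linarith
  have hstay : ∀ l : Fin M, (1 - ρ) ^ M ≤ uZero ρ (a.level l l.2.le) (a.level l l.2.le)
      (a.level (l + 1) l.2) (a.level (l + 1) l.2) := by
    intro l
    classical
    refine le_trans (pow_le_pow_of_le_one hσ (by linarith) ?_)
      (pow_card_free_le_uZero h0 h1 (a.cntStep l l.2))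
    refine (Finset.card_le_univ _).trans ?_
    simp
  have hfac : ∀ l : Fin M, (if l = k then ρ else 1) * (1 - ρ) ^ M ≤
      uZero ρ (a.level l l.2.le) (b.level l l.2.le) (a.level (l + 1) l.2)
        (b.level (l + 1) l.2) := by
    intro l
    have hpow : (1 - ρ) ^ M ≤ (1 - ρ) ^ ((l : ℕ) + 1) :=
      pow_le_pow_of_le_one hσ (by linarith) l.2
    rcases lt_trichotomy l k with hlt | rfl | hlt
    · rw [if_neg hlt.ne, one_mul, h.1 l l.2.le hlt.le, h.1 (l + 1) l.2 hlt]
      exact hstay l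
    · rw [if_pos rfl, h.1 l l.2.le le_rfl]
      exact (mul_le_mul_of_nonneg_left hpow h0).trans
        (mul_pow_le_uZero_of_free h0 h1 (a.cntStep l l.2) hi h.2.1)
    · rw [if_neg hlt.ne', one_mul]
      have hp := h.2.2 l hlt
      rcases id hp with ⟨e1, e2⟩ | ⟨j, hj, -⟩
      · rw [e1, e2]
        exact hstay l
      · exact hpow.trans (pow_le_uZero_of_move h0 h1 (a.cntStep l l.2) hj hp)
  -- Each of the `M` levels costs at most `(1 - ρ) ^ M`; the inequality is Bernoulli's.
  calc ρ * (1 - M ^ 2 * ρ) ≤ ρ * (1 - ρ) ^ (M * M) := by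
        refine mul_le_mul_of_nonneg_left ?_ h0
        have := one_add_mul_le_pow (a := -ρ) (by linarith) (M * M)
        rw [show (1 : ℝ) + -ρ = 1 - ρ by ring] at this
        refine le_trans (le_of_eq ?_) this
        push_cast
        ring
    _ = ∏ l : Fin M, (if l = k then ρ else 1) * (1 - ρ) ^ M := by
        rw [Finset.prod_mul_distrib, Finset.prod_ite_eq', if_pos (Finset.mem_univ k),
          Finset.prod_const, Finset.card_univ, Fintype.card_fin, pow_mul]
    _ ≤ _ := Finset.prod_le_prod (fun l _ => by positivity) fun l _ => hfac l

theorem le_arrayKernel {u ρ : ℝ} (hu : 0 < u) (h0 : 0 ≤ ρ) (h1 : ρ ≤ 1)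
    (a b : InterlacingArray M) :
    ρ / u * jumpKernel u a b * (1 - M ^ 2 * ρ) ≤ arrayKernel ρ a b := by
  classical
  by_cases h : ∃ (k : Fin M) (i : Fin (k + 1)), JumpsTo a b k i ∧
      Free (a.level k k.2.le) (a.level (k + 1) k.2) i
  · obtain ⟨k, i, hj, hi⟩ := h
    have : jumpKernel u a b = u := by
      unfold jumpKernel
      rw [Finset.sum_sigma', Finset.sum_eq_single ⟨k, i⟩]
      · rw [clockRate_eq, if_pos hj, jumpRate_of_free hi]
      · rintro ⟨k', i'⟩ - hne
        rw [clockRate_eq, if_neg]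
        exact fun hj' => hne (hj'.index_eq hj)
      · simp
    rw [this, div_mul_cancel₀ _ hu.ne']
    exact le_arrayKernel_of_jumpsTo h0 h1 hj hi
  · have : jumpKernel u a b = 0 := by
      refine Finset.sum_eq_zero fun k _ => Finset.sum_eq_zero fun i _ => ?_
      rw [clockRate_eq]
      split_ifs with hj
      · exact jumpRate_of_not_free fun hi => h ⟨k, i, hj, hi⟩
      · rfl
    rw [this, mul_zero, zero_mul]
    exact arrayKernel_nonneg h0 h1 a b

/-! ### Total mass of the array kernel and the second order error -/

/-- The lower levels of an array. -/
def InterlacingArray.restrict (a : InterlacingArray (M + 1)) : InterlacingArray M where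
  level k hk := a.level k (hk.trans (Nat.le_succ M))
  interlaces k hk := a.interlaces k (hk.trans (Nat.le_succ M))

theorem arrayKernel_succ (ρ : ℝ) (a b : InterlacingArray (M + 1)) :
    arrayKernel ρ a b = arrayKernel ρ a.restrict b.restrict *
      uZero ρ (a.restrict.level M le_rfl) (b.restrict.level M le_rfl) (a.level (M + 1) le_rfl)
        (b.level (M + 1) le_rfl) := by
  unfold arrayKernel
  rw [Fin.prod_univ_castSucc]
  rfl

theorem tsum_uZero_le {ρ : ℝ} (h0 : 0 ≤ ρ) (h1 : ρ < 1) {N : ℕ} (κ lam : Signature N)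
    (μ : Signature (N + 1)) : ∑' ν, ENNReal.ofReal (uZero ρ κ lam μ ν) ≤ 1 := by
  by_cases h : CntStep κ lam ∧ CntStep κ μ
  · exact (tsum_uZero h0 h1 h.1 h.2).le
  · have : ∀ ν, uZero ρ κ lam μ ν = 0 := by
      intro ν
      by_contra hc
      have := uZero_ne_zero hc
      exact h ⟨this.1, this.2.1⟩
    simp [this]

/-- The top level is summed first. Arrays embed into pairs of a lower array and an arbitrary top
signature, so the inequality comes without checking that the mass sits on interlacing pairs. -/
theorem tsum_arrayKernel_le {ρ : ℝ} (h0 : 0 ≤ ρ) (h1 : ρ < 1) (a : InterlacingArray M) :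
    ∑' b, ENNReal.ofReal (arrayKernel ρ a b) ≤ 1 := by
  induction M with
  | zero =>
    have : Subsingleton (InterlacingArray 0) := ⟨fun b c => by
      ext l hl : 3
      obtain rfl := Nat.le_zero.1 hl
      exact Subsingleton.elim _ _⟩
    rw [tsum_eq_single a fun b hb => absurd (Subsingleton.elim b a) hb]
    simp [arrayKernel]
  | succ M ih =>
    have hinj : Function.Injective fun b : InterlacingArray (M + 1) =>
        (b.restrict, b.level (M + 1) le_rfl) := by
      intro b c h
      ext l hl : 3
      rcases hl.lt_or_eq with hlt | rfl
      · exact congrArg (fun p => p.1.level l (Nat.lt_succ_iff.1 hlt)) h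
      · exact congrArg Prod.snd h
    set G : InterlacingArray M × Signature (M + 1) → ENNReal := fun p =>
      ENNReal.ofReal (arrayKernel ρ a.restrict p.1) *
        ENNReal.ofReal (uZero ρ (a.restrict.level M le_rfl) (p.1.level M le_rfl)
          (a.level (M + 1) le_rfl) p.2) with hG
    calc ∑' b, ENNReal.ofReal (arrayKernel ρ a b)
        = ∑' b : InterlacingArray (M + 1), G (b.restrict, b.level (M + 1) le_rfl) := by
          refine tsum_congr fun b => ?_
          rw [arrayKernel_succ, ENNReal.ofReal_mul (arrayKernel_nonneg h0 h1.le _ _)]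
      _ ≤ ∑' p, G p := ENNReal.tsum_comp_le_tsum_of_injective hinj G
      _ = ∑' b : InterlacingArray M, ENNReal.ofReal (arrayKernel ρ a.restrict b) *
            ∑' ν, ENNReal.ofReal (uZero ρ (a.restrict.level M le_rfl) (b.level M le_rfl)
                (a.level (M + 1) le_rfl) ν) := by
          rw [ENNReal.tsum_prod']
          simp only [hG, ENNReal.tsum_mul_left]
      _ ≤ ∑' b : InterlacingArray M, ENNReal.ofReal (arrayKernel ρ a.restrict b) * 1 :=
          ENNReal.tsum_le_tsum fun b => mul_le_mul_right (tsum_uZero_le h0 h1 _ _ _) _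
      _ ≤ 1 := by simpa using ih a.restrict

theorem summable_arrayKernel {ρ : ℝ} (h0 : 0 ≤ ρ) (h1 : ρ < 1) (a : InterlacingArray M) :
    Summable (arrayKernel ρ a) ∧ ∑' b, arrayKernel ρ a b ≤ 1 := by
  have h := tsum_arrayKernel_le h0 h1 a
  have hs : Summable (arrayKernel ρ a) := by
    have := ENNReal.summable_toReal (h.trans_lt ENNReal.one_lt_top).ne
    simpa only [ENNReal.toReal_ofReal (arrayKernel_nonneg h0 h1.le a _)] using this
  refine ⟨hs, ?_⟩
  rw [← ENNReal.ofReal_tsum_of_nonneg (fun b => arrayKernel_nonneg h0 h1.le a b) hs] at h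
  rwa [ENNReal.ofReal_le_one] at h

open Classical in
/-- The kernel is the identity plus the generator up to terms of second order. -/
theorem tsum_abs_arrayKernel_sub_le {u ρ : ℝ} (hu : 0 < u) (h0 : 0 ≤ ρ) (h1 : ρ < 1)
    (a : InterlacingArray M) :
    Summable (fun b => |arrayKernel ρ a b -
      ((if a = b then 1 else 0) + ρ / u * generator u M a b)|) ∧
    ∑' b, |arrayKernel ρ a b - ((if a = b then 1 else 0) + ρ / u * generator u M a b)| ≤
      2 * M ^ 4 * ρ ^ 2 := by
  obtain ⟨hs, hle⟩ := summable_arrayKernel h0 h1 a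
  set y : InterlacingArray M → ℝ :=
    fun b => (if a = b then 1 else 0) + ρ / u * generator u M a b with hy
  have hy' : ∀ b, y b = (if a = b then 1 - ρ / u * exitRate u a else 0) +
      ρ / u * jumpKernel u a b := by
    intro b
    simp only [hy, generator_eq]
    split_ifs <;> ring
  have hj := hasSum_jumpKernel u a
  have hd : HasSum (fun b => if a = b then 1 - ρ / u * exitRate u a else 0)
      (1 - ρ / u * exitRate u a) := by
    simpa [eq_comm] using hasSum_ite_eq a (1 - ρ / u * exitRate u a)
  have hysum : HasSum y 1 := by
    have := hd.add (hj.mul_left (ρ / u))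
    simp only [← hy'] at this
    simpa using this
  -- The loss in the off-diagonal lower bound `le_arrayKernel`; on the diagonal it vanishes.
  set ε : InterlacingArray M → ℝ := fun b => M ^ 2 * ρ * (ρ / u) * jumpKernel u a b with hε
  have hε0 : ∀ b, 0 ≤ ε b := fun b =>
    mul_nonneg (by positivity) (jumpKernel_nonneg hu.le a b)
  have hεsum : HasSum ε (M ^ 2 * ρ * (ρ / u) * exitRate u a) := hj.mul_left _
  have hlow : ∀ b, y b - ε b ≤ arrayKernel ρ a b := by
    intro b
    rw [hy']
    by_cases hab : a = b
    · subst hab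
      have hz : jumpKernel u a a = 0 := by
        have := generator_eq u a a
        simp only [generator, if_true] at this
        change -exitRate u a = _ at this
        linarith
      simp only [hε, hz, if_true]
      have := one_sub_exitRate_le_arrayKernel hu h0 h1.le a
      linarith
    · have := le_arrayKernel hu h0 h1.le a b
      rw [if_neg hab]
      simp only [hε]
      linarith
  -- A lower bound controls the absolute value: `|x| ≤ x + 2 * ε` if `-ε ≤ x`. Summation cancels
  -- `arrayKernel` against `y`, as the former has mass at most `1` and the latter exactly `1`.
  have hbound : ∀ b, |arrayKernel ρ a b - y b| ≤ arrayKernel ρ a b - y b + 2 * ε b := by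
    intro b
    have := hlow b
    have := hε0 b
    rw [abs_le]
    constructor <;> linarith
  have hB : HasSum (fun b => arrayKernel ρ a b - y b + 2 * ε b)
      (∑' b, arrayKernel ρ a b - 1 + 2 * (M ^ 2 * ρ * (ρ / u) * exitRate u a)) :=
    (hs.hasSum.sub hysum).add (hεsum.mul_left 2)
  have hS : Summable fun b => |arrayKernel ρ a b - y b| :=
    Summable.of_nonneg_of_le (fun _ => abs_nonneg _) hbound hB.summable
  refine ⟨hS, (hS.tsum_le_tsum hbound hB.summable).trans ?_⟩
  rw [hB.tsum_eq]
  have he := exitRate_le hu.le a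
  have : M ^ 2 * ρ * (ρ / u) * exitRate u a ≤ M ^ 2 * ρ * (ρ / u) * (u * M ^ 2) :=
    mul_le_mul_of_nonneg_left he (by positivity)
  have e : (M : ℝ) ^ 2 * ρ * (ρ / u) * (u * M ^ 2) = M ^ 4 * ρ ^ 2 := by
    field_simp
  linarith

/-! ### Powers of operators and the exponential -/

section Exponential

variable {A : Type*} [NormedRing A] [NormedAlgebra ℝ A] [CompleteSpace A]

theorem exp_add_smul (x : A) (s t : ℝ) :
    NormedSpace.exp ((s + t) • x) = NormedSpace.exp (s • x) * NormedSpace.exp (t • x) := by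
  let _ := NormedAlgebra.restrictScalars ℚ ℝ A
  rw [add_smul, NormedSpace.exp_add_of_commute]
  exact ((Commute.refl x).smul_left s).smul_right t

theorem exp_natCast_mul_smul (x : A) (h : ℝ) (m : ℕ) :
    NormedSpace.exp ((m * h) • x) = NormedSpace.exp (h • x) ^ m := by
  let _ := NormedAlgebra.restrictScalars ℚ ℝ A
  rw [← NormedSpace.exp_nsmul, mul_smul, Nat.cast_smul_eq_nsmul]

theorem continuous_exp_smul (x : A) : Continuous fun t : ℝ => NormedSpace.exp (t • x) :=
  continuous_iff_continuousAt.2 fun t => (hasDerivAt_exp_smul_const x t).continuousAt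

-- Telescoping. Only `x` has to be a contraction; for `y`, later an exponential, bounded powers
-- suffice.
omit [NormedAlgebra ℝ A] [CompleteSpace A] in
theorem norm_pow_sub_pow_le {x y : A} (hx : ‖x‖ ≤ 1) (L : ℝ) (m : ℕ)
    (hy : ∀ i < m, ‖y ^ i‖ ≤ L) : ‖x ^ m - y ^ m‖ ≤ m * (‖x - y‖ * L) := by
  induction m with
  | zero => simp
  | succ m ih =>
    have e : x ^ (m + 1) - y ^ (m + 1) = x * (x ^ m - y ^ m) + (x - y) * y ^ m := by
      rw [pow_succ' x, pow_succ' y]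
      noncomm_ring
    rw [e]
    have h1 := ih fun i hi => hy i (by omega)
    have h2 := hy m (Nat.lt_succ_self m)
    calc _ ≤ ‖x * (x ^ m - y ^ m)‖ + ‖(x - y) * y ^ m‖ := norm_add_le _ _
      _ ≤ 1 * ‖x ^ m - y ^ m‖ + ‖x - y‖ * L :=
          add_le_add ((norm_mul_le _ _).trans (mul_le_mul_of_nonneg_right hx (norm_nonneg _)))
            ((norm_mul_le _ _).trans (mul_le_mul_of_nonneg_left h2 (norm_nonneg _)))
      _ ≤ _ := by
          push_cast
          linarith

/-- Powers of contractions `1 + Q / v + o(1 / v)` converge to the exponential of `Q`. -/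
theorem tendsto_pow_exp {T : ℝ → A} {Q : A} (hT : ∀ᶠ v in atTop, ‖T v‖ ≤ 1)
    (hQ : Tendsto (fun v : ℝ => v • (T v - 1)) atTop (𝓝 Q)) {m : ℝ → ℕ} {τ : ℝ}
    (hm : Tendsto (fun v : ℝ => (m v : ℝ) / v) atTop (𝓝 τ)) :
    Tendsto (fun v => T v ^ m v) atTop (𝓝 (NormedSpace.exp (τ • Q))) := by
  -- The extra `1` gives room, since `m v / v < τ + 1` eventually.
  obtain ⟨L, hL⟩ := (isCompact_Icc (a := (0 : ℝ)) (b := τ + 1)).exists_bound_of_continuousOn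
    (continuous_exp_smul Q).continuousOn
  have hexp : Tendsto (fun v : ℝ => NormedSpace.exp (((m v : ℝ) / v) • Q)) atTop
      (𝓝 (NormedSpace.exp (τ • Q))) := (continuous_exp_smul Q).continuousAt.tendsto.comp hm
  have hslope : Tendsto (fun v : ℝ => v • (NormedSpace.exp (v⁻¹ • Q) - 1)) atTop (𝓝 Q) := by
    have h0 := (hasDerivAt_exp_smul_const Q (0 : ℝ)).tendsto_slope_zero_right.comp
      tendsto_inv_atTop_nhdsGT_zero
    simpa [Function.comp_def, NormedSpace.exp_zero] using h0
  have hdiff : Tendsto (fun v : ℝ => ‖v • (T v - NormedSpace.exp (v⁻¹ • Q))‖) atTop (𝓝 0) := by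
    have := (hQ.sub hslope).norm
    simp only [sub_self, norm_zero, ← smul_sub, sub_sub_sub_cancel_right] at this
    exact this
  have hbound : ∀ᶠ v : ℝ in atTop,
      ‖T v ^ m v - NormedSpace.exp (((m v : ℝ) / v) • Q)‖ ≤
        (m v : ℝ) / v * (‖v • (T v - NormedSpace.exp (v⁻¹ • Q))‖ * L) := by
    filter_upwards [hT, eventually_gt_atTop 0, hm.eventually (gt_mem_nhds (lt_add_one τ))]
      with v hv hv0 hmv
    have e : NormedSpace.exp (((m v : ℝ) / v) • Q) = NormedSpace.exp (v⁻¹ • Q) ^ m v := by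
      rw [div_eq_mul_inv, exp_natCast_mul_smul]
    rw [e, norm_smul, Real.norm_of_nonneg hv0.le]
    refine (norm_pow_sub_pow_le hv L (m v) fun i hi => ?_).trans (le_of_eq ?_)
    · rw [← exp_natCast_mul_smul]
      refine hL _ ⟨by positivity, le_trans ?_ hmv.le⟩
      rw [div_eq_mul_inv]
      refine mul_le_mul_of_nonneg_right ?_ (by positivity)
      exact_mod_cast hi.le
    · field_simp
  have hzero : Tendsto (fun v => T v ^ m v - NormedSpace.exp (((m v : ℝ) / v) • Q)) atTop
      (𝓝 0) := by
    refine squeeze_zero_norm' hbound ?_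
    have := hm.mul (hdiff.mul_const L)
    simpa using this
  simpa using hzero.add hexp

end Exponential

/-! ### Kernels as operators on summable sequences -/

section Kernel

variable {S : Type*}

/-- The space of absolutely summable functions. -/
abbrev L1 (S : Type*) : Type _ := lp (fun _ : S => ℝ) 1

theorem memL1 {f : S → ℝ} (hf : Summable fun b => |f b|) : Memℓp f 1 :=
  memℓp_gen (by simpa using hf)

theorem norm_L1 (f : L1 S) : ‖f‖ = ∑' b, |f b| := by
  rw [lp.norm_eq_tsum_rpow (by simp)]
  simp

theorem summable_abs_L1 (f : L1 S) : Summable fun b => |f b| := by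
  have := (lp.memℓp f).summable (by simp)
  simpa using this

open Classical in
/-- The point mass at `a`. -/
noncomputable def pointMass (a : S) : L1 S := lp.single 1 a 1

open Classical in
theorem pointMass_apply (a b : S) : pointMass a b = if a = b then 1 else 0 := by
  unfold pointMass
  by_cases h : a = b
  · subst h
    rw [if_pos rfl, lp.single_apply_self]
  · rw [if_neg h, lp.single_apply_ne _ _ _ (Ne.symm h)]

theorem hasSum_pointMass (f : L1 S) : HasSum (fun a => f a • pointMass a) f := by
  classical
  have := lp.hasSum_single (p := 1) (by simp) f
  convert this using 2 with a
  unfold pointMass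
  rw [← lp.single_smul]
  simp

theorem hasSum_map (T : L1 S →L[ℝ] L1 S) (f : L1 S) :
    HasSum (fun a => f a • T (pointMass a)) (T f) := by
  have := (hasSum_pointMass f).mapL T
  simpa using this

theorem hasSum_map_apply (T : L1 S →L[ℝ] L1 S) (f : L1 S) (b : S) :
    HasSum (fun a => f a * T (pointMass a) b) (T f b) := by
  have h := (hasSum_map T f).mapL (lp.evalCLM ℝ (fun _ : S => ℝ) 1 b)
  simp only [map_smul, smul_eq_mul] at h
  exact h

/-- An operator on `ℓ¹` is determined by the images of point masses, which are the rows of its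
kernel. Operators thus act on distributions, and uniform `ℓ¹` bounds on rows are norm bounds. -/
theorem opNorm_le (T : L1 S →L[ℝ] L1 S) {C : ℝ} (hC : 0 ≤ C)
    (hT : ∀ a, ‖T (pointMass a)‖ ≤ C) : ‖T‖ ≤ C := by
  refine ContinuousLinearMap.opNorm_le_bound _ hC fun f => ?_
  rw [← (hasSum_map T f).tsum_eq, norm_L1 f]
  refine tsum_of_norm_bounded ((summable_abs_L1 f).hasSum.mul_left C) fun a => ?_
  rw [norm_smul, Real.norm_eq_abs, mul_comm]
  exact mul_le_mul_of_nonneg_right (hT a) (abs_nonneg _)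

/-- The operator with a given kernel. -/
theorem exists_operator (K : S → S → ℝ) (C : ℝ)
    (hK : ∀ a, Summable (fun b => |K a b|) ∧ ∑' b, |K a b| ≤ C) :
    ∃ T : L1 S →L[ℝ] L1 S, ∀ a b, T (pointMass a) b = K a b := by
  classical
  set row : S → L1 S := fun a => ⟨K a, memL1 (hK a).1⟩ with hrow
  have hnorm : ∀ a, ‖row a‖ ≤ C := fun a => by
    rw [norm_L1]
    exact (hK a).2
  have hsum : ∀ f : L1 S, Summable fun a => f a • row a := by
    intro f
    refine Summable.of_norm_bounded ((summable_abs_L1 f).mul_right C) fun a => ?_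
    rw [norm_smul, Real.norm_eq_abs]
    exact mul_le_mul_of_nonneg_left (hnorm a) (abs_nonneg _)
  let T₀ : L1 S →ₗ[ℝ] L1 S :=
    { toFun := fun f => ∑' a, f a • row a
      map_add' := fun f g => by
        rw [← (hsum f).tsum_add (hsum g)]
        refine tsum_congr fun a => ?_
        rw [← add_smul]
        rfl
      map_smul' := fun c f => by
        rw [RingHom.id_apply, ← (hsum f).tsum_const_smul c]
        refine tsum_congr fun a => ?_
        rw [smul_smul]
        rfl }
  refine ⟨T₀.mkContinuous C fun f => ?_, fun a b => ?_⟩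
  · rw [norm_L1 f]
    refine tsum_of_norm_bounded ((summable_abs_L1 f).hasSum.mul_left C) fun a => ?_
    rw [norm_smul, Real.norm_eq_abs, mul_comm]
    exact mul_le_mul_of_nonneg_right (hnorm a) (abs_nonneg _)
  · have : T₀ (pointMass a) = row a := by
      change ∑' c, pointMass a c • row c = row a
      rw [tsum_eq_single a]
      · rw [pointMass_apply, if_pos rfl, one_smul]
      · intro c hc
        rw [pointMass_apply, if_neg (Ne.symm hc), zero_smul]
    rw [LinearMap.mkContinuous_apply, this]

/-- Powers of the operator with a nonnegative kernel. -/
theorem kernelPow_eq {K : S → S → ℝ} (hK : ∀ a b, 0 ≤ K a b) {T : L1 S →L[ℝ] L1 S}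
    (hT : ∀ a b, T (pointMass a) b = K a b) (m : ℕ) (a b : S) :
    0 ≤ (T ^ m) (pointMass a) b ∧
      kernelPow (fun a b => ENNReal.ofReal (K a b)) m a b =
        ENNReal.ofReal ((T ^ m) (pointMass a) b) := by
  classical
  induction m generalizing b with
  | zero =>
    rw [pow_zero, one_apply_eq_self, pointMass_apply, kernelPow]
    split_ifs <;> simp
  | succ m ih =>
    have h := hasSum_map_apply T ((T ^ m) (pointMass a)) b
    simp only [hT] at h
    have hnn : ∀ c, 0 ≤ (T ^ m) (pointMass a) c * K c b := fun c => mul_nonneg (ih c).1 (hK c b)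
    have e : (T ^ (m + 1)) (pointMass a) = T ((T ^ m) (pointMass a)) := by
      rw [pow_succ']
      rfl
    rw [e, kernelPow]
    refine ⟨h.nonneg hnn, ?_⟩
    rw [← h.tsum_eq, ENNReal.ofReal_tsum_of_nonneg hnn h.summable]
    refine tsum_congr fun c => ?_
    rw [(ih c).2, ENNReal.ofReal_mul (ih c).1]

/-- The transition function generated by a bounded operator. -/
noncomputable def semigroupKernel (Q : L1 S →L[ℝ] L1 S) (τ : ℝ) (a b : S) : ℝ :=
  NormedSpace.exp (τ • Q) (pointMass a) b

/-- Rows of `q` with sum zero make the exponential preserve total mass, and the other axioms are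
those of a semigroup. Positivity is a hypothesis because it is inherited from the discrete chains.
-/
theorem isTransitionFunction_semigroupKernel {q : S → S → ℝ} {Q : L1 S →L[ℝ] L1 S}
    (hQ : ∀ a b, Q (pointMass a) b = q a b) (hq : ∀ a, HasSum (q a) 0)
    (hnn : ∀ τ, 0 ≤ τ → ∀ a b, 0 ≤ semigroupKernel Q τ a b) :
    IsTransitionFunction q (semigroupKernel Q) where
  nonneg := hnn
  total τ hτ a := by
    set mass : L1 S →L[ℝ] ℝ := lp.tsumCLM ℝ S ℝ with hmass
    have hmass' : ∀ f : L1 S, mass f = ∑' b, f b := fun f => rfl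
    have hsum : ∀ f : L1 S, HasSum (fun b => f b) (mass f) := fun f =>
      (summable_abs_L1 f).of_abs.hasSum
    have hzero : ∀ f, mass (Q f) = 0 := by
      intro f
      have h1 := (hasSum_map Q f).mapL mass
      have h2 : ∀ a, mass (f a • Q (pointMass a)) = 0 := by
        intro a
        have : mass (Q (pointMass a)) = 0 := by
          rw [hmass', ← (hq a).tsum_eq]
          exact tsum_congr fun b => hQ a b
        rw [map_smul, this, smul_zero]
      simp only [h2] at h1
      exact h1.unique hasSum_zero
    -- The derivative is `mass` of an element of the range of `Q`, hence zero.
    have hder : ∀ t, HasDerivAt (fun t : ℝ => mass (NormedSpace.exp (t • Q) (pointMass a))) 0 t := by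
      intro t
      have h1 := hasDerivAt_exp_smul_const' (𝕂 := ℝ) Q t
      have h2 := (h1.clm_apply (hasDerivAt_const t (pointMass a)))
      have h3 := (mass.hasFDerivAt (x := NormedSpace.exp (t • Q) (pointMass a))).comp_hasDerivAt t h2
      have e : mass ((Q * NormedSpace.exp (t • Q)) (pointMass a) +
          NormedSpace.exp (t • Q) 0) = 0 := by
        rw [map_zero, add_zero]
        exact hzero _
      rw [← e]
      exact h3
    have hconst := is_const_of_deriv_eq_zero (fun t => (hder t).differentiableAt)
      (fun t => (hder t).deriv) τ 0
    have h0 : mass (NormedSpace.exp ((0 : ℝ) • Q) (pointMass a)) = 1 := by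
      classical
      rw [zero_smul, NormedSpace.exp_zero, one_apply_eq_self, hmass', tsum_eq_single a]
      · rw [pointMass_apply, if_pos rfl]
      · intro b hb
        rw [pointMass_apply, if_neg (Ne.symm hb)]
    have := hsum (NormedSpace.exp (τ • Q) (pointMass a))
    rw [hconst, h0] at this
    exact this
  start a b := by
    unfold semigroupKernel
    rw [zero_smul, NormedSpace.exp_zero, one_apply_eq_self, pointMass_apply]
  chapman_kolmogorov σ τ _ _ a b := by
    have := hasSum_map_apply (NormedSpace.exp (τ • Q)) (NormedSpace.exp (σ • Q) (pointMass a)) b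
    have e : NormedSpace.exp (τ • Q) (NormedSpace.exp (σ • Q) (pointMass a)) =
        NormedSpace.exp ((σ + τ) • Q) (pointMass a) := by
      rw [add_comm σ τ]
      exact (DFunLike.congr_fun (exp_add_smul Q τ σ) (pointMass a)).symm
    rw [e] at this
    exact this
  rates a b := by
    have h1 := hasDerivAt_exp_smul_const (𝕂 := ℝ) Q 0
    have h2 := (h1.clm_apply (hasDerivAt_const (0 : ℝ) (pointMass a)))
    have h3 := ((lp.evalCLM ℝ (fun _ : S => ℝ) 1 b).hasFDerivAt
      (x := NormedSpace.exp ((0 : ℝ) • Q) (pointMass a))).comp_hasDerivAt 0 h2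
    refine HasDerivAt.hasDerivWithinAt ?_
    have e : (NormedSpace.exp ((0 : ℝ) • Q) * Q) (pointMass a) +
        NormedSpace.exp ((0 : ℝ) • Q) 0 = Q (pointMass a) := by
      rw [map_zero, add_zero, zero_smul, NormedSpace.exp_zero, one_mul]
    rw [← hQ, ← e]
    exact h3

end Kernel

/-! ### The continuous time limit -/

section Limit

variable {M : ℕ}

theorem hasSum_generator (u : ℝ) (a : InterlacingArray M) : HasSum (generator u M a) 0 := by
  classical
  have h : HasSum (fun b => if a = b then exitRate u a else 0) (exitRate u a) := by
    simpa only [eq_comm] using hasSum_ite_eq a (exitRate u a)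
  have := (hasSum_jumpKernel u a).sub h
  rw [sub_self] at this
  exact this.congr_fun fun b => generator_eq u a b

theorem summable_abs_generator {u : ℝ} (hu : 0 ≤ u) (a : InterlacingArray M) :
    Summable (fun b => |generator u M a b|) ∧ ∑' b, |generator u M a b| ≤ 2 * (u * M ^ 2) := by
  classical
  have h : HasSum (fun b => if a = b then exitRate u a else 0) (exitRate u a) := by
    simpa only [eq_comm] using hasSum_ite_eq a (exitRate u a)
  have hs := (hasSum_jumpKernel u a).add h
  have hle : ∀ b, |generator u M a b| ≤ jumpKernel u a b + if a = b then exitRate u a else 0 := by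
    intro b
    rw [generator_eq]
    refine (abs_sub _ _).trans (le_of_eq ?_)
    rw [abs_of_nonneg (jumpKernel_nonneg hu a b), abs_of_nonneg]
    split_ifs
    exacts [exitRate_nonneg hu a, le_rfl]
  have hsum := hs.summable.of_nonneg_of_le (fun b => abs_nonneg _) hle
  refine ⟨hsum, (hsum.tsum_le_tsum hle hs.summable).trans ?_⟩
  rw [hs.tsum_eq]
  linarith [exitRate_le hu a]

/-- The operators of the field with parameters `v` converge, after rescaling, to the operator of
the jump rates. -/
theorem exists_operators {u : ℝ} (hu : 0 < u) (M : ℕ) :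
    ∃ (Q : L1 (InterlacingArray M) →L[ℝ] L1 (InterlacingArray M))
      (T : ℝ → L1 (InterlacingArray M) →L[ℝ] L1 (InterlacingArray M)),
      (∀ a b, Q (pointMass a) b = generator u M a b) ∧
      (∀ v, u < v → ∀ a b, T v (pointMass a) b = arrayKernel (u / v) a b) ∧
      (∀ᶠ v in atTop, ‖T v‖ ≤ 1) ∧
      Tendsto (fun v : ℝ => v • (T v - 1)) atTop (𝓝 Q) := by
  classical
  obtain ⟨Q, hQ⟩ := exists_operator (generator u M) _ (summable_abs_generator hu.le)
  have hρ : ∀ v, u < v → 0 ≤ u / v ∧ u / v < 1 := fun v hv =>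
    ⟨div_nonneg hu.le (hu.trans hv).le, (div_lt_one (hu.trans hv)).2 hv⟩
  have habs : ∀ v, u < v → ∀ a : InterlacingArray M,
      Summable (fun b => |arrayKernel (u / v) a b|) ∧ ∑' b, |arrayKernel (u / v) a b| ≤ 1 := by
    intro v hv a
    have h := summable_arrayKernel (hρ v hv).1 (hρ v hv).2 a
    simpa only [abs_of_nonneg (arrayKernel_nonneg (hρ v hv).1 (hρ v hv).2.le a _)] using h
  -- For `v ≤ u` there is no field and `T v` is set to `0`; only large `v` matter.
  have hex : ∀ v, ∃ T : L1 (InterlacingArray M) →L[ℝ] L1 (InterlacingArray M),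
      u < v → ∀ a b, T (pointMass a) b = arrayKernel (u / v) a b := by
    intro v
    by_cases hv : u < v
    · obtain ⟨T, hT⟩ := exists_operator (arrayKernel (u / v)) 1 (habs v hv)
      exact ⟨T, fun _ => hT⟩
    · exact ⟨0, fun h => absurd h hv⟩
  choose T hT using hex
  refine ⟨Q, T, hQ, hT, ?_, ?_⟩
  · filter_upwards [eventually_gt_atTop u] with v hv
    refine opNorm_le _ zero_le_one fun a => ?_
    rw [norm_L1]
    simp only [hT v hv]
    exact (habs v hv a).2
  · rw [tendsto_iff_norm_sub_tendsto_zero]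
    have hlim : Tendsto (fun v : ℝ => 2 * (M : ℝ) ^ 4 * u ^ 2 / v) atTop (𝓝 0) :=
      tendsto_const_nhds.div_atTop tendsto_id
    refine squeeze_zero' (Eventually.of_forall fun _ => norm_nonneg _) ?_ hlim
    filter_upwards [eventually_gt_atTop u] with v hv
    have hv0 : 0 < v := hu.trans hv
    refine opNorm_le _ (by positivity) fun a => ?_
    have happ : ∀ b, (v • (T v - 1) - Q) (pointMass a) b =
        v * (arrayKernel (u / v) a b -
          ((if a = b then 1 else 0) + u / v / u * generator u M a b)) := by
      intro b
      have e : (v • (T v - 1) - Q) (pointMass a) b =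
          v * (T v (pointMass a) b - pointMass a b) - Q (pointMass a) b := rfl
      rw [e, hT v hv, hQ, pointMass_apply]
      field_simp
      ring
    rw [norm_L1]
    simp only [happ, abs_mul, abs_of_pos hv0]
    rw [tsum_mul_left]
    calc _ ≤ v * (2 * M ^ 4 * (u / v) ^ 2) := mul_le_mul_of_nonneg_left
          (tsum_abs_arrayKernel_sub_le hu (hρ v hv).1 (hρ v hv).2 a).2 hv0.le
      _ = _ := by field_simp

theorem tendsto_apply_apply {S : Type*} {T : ℝ → L1 S →L[ℝ] L1 S} {R : L1 S →L[ℝ] L1 S}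
    (h : Tendsto T atTop (𝓝 R)) (f : L1 S) (b : S) :
    Tendsto (fun v => T v f b) atTop (𝓝 (R f b)) :=
  ((lp.evalCLM ℝ (fun _ : S => ℝ) 1 b).continuous.tendsto _).comp
    (((ContinuousLinearMap.apply ℝ (L1 S) f).continuous.tendsto R).comp h)

end Limit

/-! ### Finite-dimensional distributions as powers of operators -/

section Columns

variable {u v : ℝ} {Ω : Type*} [MeasurableSpace Ω] {P : Measure Ω}
  [IsProbabilityMeasure P] {Λ : (x y : ℕ) → Ω → Signature y}

/-- The condition at time `t 0 = 0` holds almost surely by the boundary values, so it may be added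
to the event, which makes the Markov chain formula applicable. -/
theorem IsYangBaxterField.measureReal_columns (hu : 0 < u) (huv : u < v)
    (h : IsYangBaxterField 0 0 (fun _ => v) (fun _ => u) P Λ) {M : ℕ}
    {T : L1 (InterlacingArray M) →L[ℝ] L1 (InterlacingArray M)}
    (hT : ∀ a b, T (pointMass a) b = arrayKernel (u / v) a b) {t : ℕ → ℕ}
    (ht : Monotone t) (ht0 : t 0 = 0) {a : ℕ → InterlacingArray M} (ha : a 0 = packed M) (n : ℕ) :
    P.real {ω | ∀ j < n, ∀ (k : ℕ) (hk : k ≤ M), Λ (t (j + 1)) k ω = (a (j + 1)).level k hk} =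
      ∏ j ∈ Finset.range n, (T ^ (t (j + 1) - t j)) (pointMass (a j)) (a (j + 1)) := by
  have hv : 0 < v := hu.trans huv
  have hK : ∀ a b : InterlacingArray M, 0 ≤ arrayKernel (u / v) a b :=
    arrayKernel_nonneg (by positivity) ((div_le_one hv).2 huv.le)
  have hset : P {ω | ∀ j < n, ∀ (k : ℕ) (hk : k ≤ M),
      Λ (t (j + 1)) k ω = (a (j + 1)).level k hk} =
      P {ω | ∀ l ≤ n, ω ∈ columnEvent Λ (t l) (a l)} := by
    refine measure_congr ?_
    filter_upwards [ae_all_iff.2 h.boundary] with ω hω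
    refine propext ⟨fun hj l hl => ?_, fun hl j hj => hl (j + 1) hj⟩
    cases l with
    | zero =>
      intro k hk
      rw [ht0, hω, ha]
      rfl
    | succ l => exact hj l hl
  rw [Measure.real, hset, h.measure_columnEvents hu huv ht ht0 ha, ENNReal.toReal_prod]
  refine Finset.prod_congr rfl fun j _ => ?_
  obtain ⟨h1, h2⟩ := kernelPow_eq hK hT (t (j + 1) - t j) (a j) (a (j + 1))
  rw [h2, ENNReal.toReal_ofReal h1]

end Columns

end YangBaxter

/-! ### The main theorem -/

theorem mainTheorem11 (u : ℝ) (hu : 0 < u) :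
    (∀ v : ℝ, u < v →
      ∃ (Ω : Type) (_ : MeasurableSpace Ω) (P : Measure Ω)
        (Λ : (x y : ℕ) → Ω → YangBaxter.Signature y),
        IsProbabilityMeasure P ∧
          YangBaxter.IsYangBaxterField 0 0 (fun _ => v) (fun _ => u) P Λ) ∧
    ∀ M : ℕ, ∃ p : ℝ → YangBaxter.InterlacingArray M → YangBaxter.InterlacingArray M → ℝ,
      YangBaxter.IsTransitionFunction (YangBaxter.generator u M) p ∧
      ∀ (Ω : ℝ → Type*) [∀ v, MeasurableSpace (Ω v)] (P : ∀ v, Measure (Ω v))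
        [∀ v, IsProbabilityMeasure (P v)]
        (Λ : ∀ v : ℝ, (x y : ℕ) → Ω v → YangBaxter.Signature y),
        (∀ v, u < v →
          YangBaxter.IsYangBaxterField 0 0 (fun _ => v) (fun _ => u) (P v) (Λ v)) →
        ∀ (n : ℕ) (τ : ℕ → ℝ), Monotone τ → τ 0 = 0 →
        ∀ a : ℕ → YangBaxter.InterlacingArray M, a 0 = YangBaxter.packed M →
          Tendsto
            (fun v : ℝ => (P v).real
              {ω | ∀ j < n, ∀ (k : ℕ) (hk : k ≤ M),
                Λ v ⌊τ (j + 1) * v⌋₊ k ω = (a (j + 1)).level k hk})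
            atTop
            (𝓝 (∏ j ∈ Finset.range n, p (τ (j + 1) - τ j) (a j) (a (j + 1)))) := by
  refine ⟨fun v hv => ?_, fun M => ?_⟩
  · exact ⟨YangBaxter.SampleSpace, inferInstance,
      YangBaxter.sampleMeasure
        ⟨u / v, div_nonneg hu.le (hu.trans hv).le, (div_lt_one (hu.trans hv)).2 hv⟩,
      YangBaxter.sampleField, inferInstance,
      YangBaxter.isYangBaxterField_sampleField hu hv _ rfl⟩
  obtain ⟨Q, T, hQ, hT, hnorm, hlim⟩ := YangBaxter.exists_operators hu M
  have hpow : ∀ {m : ℝ → ℕ} {τ : ℝ}, Tendsto (fun v : ℝ => (m v : ℝ) / v) atTop (𝓝 τ) →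
      ∀ a b, Tendsto (fun v => (T v ^ m v) (YangBaxter.pointMass a) b) atTop
        (𝓝 (YangBaxter.semigroupKernel Q τ a b)) := fun hm a b =>
    YangBaxter.tendsto_apply_apply (YangBaxter.tendsto_pow_exp hnorm hlim hm) _ b
  -- The entries are limits of the multi-step transition probabilities with `⌊τ * v⌋₊` steps.
  have hnn : ∀ τ, 0 ≤ τ → ∀ a b, 0 ≤ YangBaxter.semigroupKernel Q τ a b := by
    intro τ hτ a b
    refine ge_of_tendsto (hpow (tendsto_nat_floor_mul_div_atTop hτ) a b) ?_
    filter_upwards [eventually_gt_atTop u] with v hv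
    have hv0 : 0 < v := hu.trans hv
    exact (YangBaxter.kernelPow_eq (YangBaxter.arrayKernel_nonneg (by positivity)
      ((div_le_one hv0).2 hv.le)) (hT v hv) _ a b).1
  refine ⟨YangBaxter.semigroupKernel Q, YangBaxter.isTransitionFunction_semigroupKernel hQ
    (YangBaxter.hasSum_generator u) hnn, ?_⟩
  intro Ω _ P _ Λ hΛ n τ hτ hτ0 a ha
  have hmono : ∀ v : ℝ, 0 ≤ v → Monotone fun j => ⌊τ j * v⌋₊ := fun v hv i j hij =>
    Nat.floor_mono (mul_le_mul_of_nonneg_right (hτ hij) hv)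
  have hτnn : ∀ j, 0 ≤ τ j := fun j => hτ0 ▸ hτ (Nat.zero_le j)
  have hprod : Tendsto (fun v : ℝ => ∏ j ∈ Finset.range n,
      (T v ^ (⌊τ (j + 1) * v⌋₊ - ⌊τ j * v⌋₊)) (YangBaxter.pointMass (a j)) (a (j + 1))) atTop
      (𝓝 (∏ j ∈ Finset.range n,
        YangBaxter.semigroupKernel Q (τ (j + 1) - τ j) (a j) (a (j + 1)))) := by
    refine tendsto_finsetProd _ fun j _ => hpow ?_ _ _
    -- The number of steps between consecutive observations, divided by `v`, tends to `τ (j + 1) - τ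
    -- j`; monotonicity makes the natural subtraction exact.
    refine ((tendsto_nat_floor_mul_div_atTop (hτnn (j + 1))).sub
      (tendsto_nat_floor_mul_div_atTop (hτnn j))).congr' ?_
    filter_upwards [eventually_ge_atTop 0] with v hv
    rw [Nat.cast_sub (hmono v hv j.le_succ), sub_div]
  refine hprod.congr' ?_
  filter_upwards [eventually_gt_atTop u] with v hv
  exact ((hΛ v hv).measureReal_columns hu hv (hT v hv) (hmono v (hu.trans hv).le)
    (by simp [hτ0]) ha n).symm
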